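/- Let $n\ge 1$, let $D,D'\subset\mathbb C^{n+1}$ be domains, and let $p\in\partial D$, $p'\in\partial D'$ be points near which $\partial D$, respectively $\partial D'$, is $C^\infty$-smooth, and at which it is strongly pseudoconvex. A sequence $Z_k\to p$ in $D$ converges *non-tangentially* if $|Z_k-p|\le c\,\mathrm{dist}(Z_k,\partial D)$ for some constant $c$ and all $k$. Let $\mathcal J^0_{p,p'}(D,D')$ be the set of germs at $p$ of holomorphic maps $F:U\cap D\to D'$, with $U$ an open neighbourhood of $p$, such that $F(Z_k)\to p'$ whenever $Z_k\to p$ non-tangentially. Such an $F$ is *non-tangentially differentiable* at $p$, with *non-tangential differential* the complex linear map $dF_p$, if $F(Z_k)=p'+dF_p(Z_k-p)+o(|Z_k-p|)$ whenever $Z_k\to p$ non-tangentially in $D$. Call local holomorphic coordinates $(z,w)\in\mathbb C^n\times\mathbb C$ vanishing at $p$ *normalized* if in them $D$ is given near $0$ by $\operatorname{Im}w>\Phi(z,\operatorname{Re}w)$, with $\Phi$ smooth and $\Phi(z,u)=\|z\|^2+O(|(z,u)|^3)$; likewise for $D'$ at $p'$. For such coordinates at $p$ and $p'$ let $C$ (of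 size $n\times n$) and $\lambda$ (of size $1\times 1$) be the diagonal blocks of the matrix of $dF_p$ ($\lambda$ is then real), let $\mu_1\ge\dots\ge\mu_n\ge0$ be the singular values of $C$, and call the numbers $\mu_j/\sqrt\lambda$ the *singular values* of $dF_p$. Give $z,\bar z$ weight $1$ and $u=\operatorname{Re}w$ weight $2$. In coordinates vanishing at $p$, $\partial D$ is in *Chern–Moser normal form up to weight $m$* if near $0$ the domain $D$ is given by $\operatorname{Im}w>\Phi(z,\operatorname{Re} w)$ with $\Phi$ smooth and $$\Phi(z,u)=\|z\|^2+\sum_{k,l\ge2}P_{(k,l)}(z,\bar z,u)+(\text{terms of weight}>m),$$ where the sum is a polynomial, $P_{(k,l)}$ has bidegree $(k,l)$ in $(z,\bar z)$, and $\operatorname{tr}P_{(2,2)}=0$, $\operatorname{tr}^2P_{(2,3)}=\operatorname{tr}^2P_{(3,2)}=0$, $\operatorname{tr}^3P_{(3,3)}=0$. Here $\operatorname{tr}$ is the usual trace (a contraction of a $z$-index with a $\bar z$-index), which on bidegree $(k,l)$ is $\frac1{kl}\sum_\alpha\partial^2/\partial z_\alpha\partial\bar z_\alpha$. The germ $F$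 is *$1$-flat* if, for every $m$, there are local holomorphic coordinates vanishing at $p$ and at $p'$ in which $\partial D$ and $\partial D'$ are in Chern–Moser normal form up to weight $m$ and $F=\mathrm{id}+o(1)$, i.e. $F$ is in these coordinates non-tangentially differentiable at $0$ with value $0$ and differential $\mathrm{id}$. **Statement.** Normalized coordinates exist at $p$ and at $p'$. For every choice of them and every germ $F\in\mathcal J^0_{p,p'}(D,D')$, the germ $F$ is $1$-flat if and only if it is non-tangentially differentiable at $p$ and all singular values of its non-tangential differential at $p$ are equal to $1$. -/

import Mathlib

open Filter Topology Asymptotics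
open scoped ContDiff

noncomputable section

namespace FlatGerm

/-- The space `ℂⁿ⁺¹ = ℂⁿ × ℂ` with its points written `(z, w)`. It carries the maximum of the
Euclidean norms of the two factors. This norm is equivalent to the Euclidean norm of `ℂⁿ⁺¹`, and
norms are used below only up to multiplicative constants. -/
abbrev Space (n : ℕ) : Type := EuclideanSpace ℂ (Fin n) × ℂ

/-- Four times the Levi form of `r` at `p`, evaluated at the vector `v`: for a `C²` function `r` one
has `4 ∑ ∂²r/∂Z_j∂Z̄_k v_j v̄_k = D²r(v, v) + D²r(iv, iv)`. -/
def leviForm {n : ℕ} (r : Space n → ℝ) (p v : Space n) : ℝ :=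
  iteratedFDeriv ℝ 2 r p ![v, v] +
    iteratedFDeriv ℝ 2 r p ![Complex.I • v, Complex.I • v]

/-- Near `p` the set `D` has a `C^∞` boundary, passing through `p`, and it is strongly
pseudoconvex at `p`: there is a smooth local defining function `r` whose Levi form at `p` is
positive definite on the complex tangent space at `p`. -/
def IsStronglyPseudoconvexAt {n : ℕ} (D : Set (Space n)) (p : Space n) : Prop :=
  ∃ (V : Set (Space n)) (r : Space n → ℝ), IsOpen V ∧ p ∈ V ∧ ContDiffOn ℝ ∞ r V ∧
    (∀ q ∈ V, q ∈ D ↔ r q < 0) ∧ r p = 0 ∧ fderiv ℝ r p ≠ 0 ∧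
    ∀ v : Space n, v ≠ 0 → fderiv ℝ r p v = 0 → fderiv ℝ r p (Complex.I • v) = 0 →
      0 < leviForm r p v

/-- The points of `D` whose distance to `p` is at most `c` times their distance to `∂D`.
A sequence converges to `p` non-tangentially in `D` if and only if it converges to `p` and stays in
one of these regions. -/
def approachRegion {n : ℕ} (D : Set (Space n)) (p : Space n) (c : ℝ) : Set (Space n) :=
  {Z | Z ∈ D ∧ dist Z p ≤ c * Metric.infDist Z (frontier D)}

/-- `F(Z) → p'` whenever `Z → p` non-tangentially in `D`. -/
def HasNTLimit {n : ℕ} (F : Space n → Space n) (D : Set (Space n)) (p p' : Space n) : Prop :=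
  ∀ c : ℝ, Tendsto F (𝓝[approachRegion D p c] p) (𝓝 p')

/-- `F` is non-tangentially differentiable at `p`, with value `p'` and differential `L`:
`F(Z) = p' + L(Z - p) + o(‖Z - p‖)` as `Z → p` non-tangentially in `D`. -/
def HasNTDifferential {n : ℕ} (F : Space n → Space n) (D : Set (Space n)) (p p' : Space n)
    (L : Space n →L[ℂ] Space n) : Prop :=
  ∀ c : ℝ, (fun Z => F Z - p' - L (Z - p)) =o[𝓝[approachRegion D p c] p] (fun Z => Z - p)

/-- The pair `(U, F)` represents an element of `𝒥⁰_{p,p'}(D, D')`: a germ at `p` of a holomorphic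
map from `D` to `D'` sending `p` to `p'` in the non-tangential sense. The values of `F` outside
`U ∩ D` are irrelevant. -/
structure RepresentsGerm {n : ℕ} (D D' : Set (Space n)) (p p' : Space n)
    (U : Set (Space n)) (F : Space n → Space n) : Prop where
  isOpen : IsOpen U
  mem : p ∈ U
  holomorphic : DifferentiableOn ℂ F (U ∩ D)
  mapsTo : Set.MapsTo F (U ∩ D) D'
  ntLimit : HasNTLimit F D p p'

/-- `φ` is a system of local holomorphic coordinates of `ℂⁿ⁺¹` near `p`, vanishing at `p`. -/
structure IsLocalCoord {n : ℕ} (p : Space n) (φ : OpenPartialHomeomorph (Space n) (Space n)) :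
    Prop where
  mem : p ∈ φ.source
  map : φ p = 0
  holomorphic : DifferentiableOn ℂ φ φ.source
  holomorphic_symm : DifferentiableOn ℂ φ.symm φ.target

/-- In the coordinates `(z, w) = φ` the set `D` is given near `p` by `Im w > Φ(z, Re w)`, with `Φ`
real-valued and smooth near the origin. -/
def IsGraphDomain {n : ℕ} (D : Set (Space n)) (p : Space n)
    (φ : OpenPartialHomeomorph (Space n) (Space n))
    (Φ : EuclideanSpace ℂ (Fin n) × ℝ → ℝ) : Prop :=
  (∀ᶠ x in 𝓝 0, ContDiffAt ℝ ∞ Φ x) ∧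
  ∀ᶠ q in 𝓝 p, q ∈ D ↔ Φ ((φ q).1, (φ q).2.re) < (φ q).2.im

/-- Coordinates near `p` in which `D = {Im w > ‖z‖² + O(|(z, Re w)|³)}`. -/
def IsNormalizedCoord {n : ℕ} (D : Set (Space n)) (p : Space n)
    (φ : OpenPartialHomeomorph (Space n) (Space n)) : Prop :=
  IsLocalCoord p φ ∧ ∃ Φ : EuclideanSpace ℂ (Fin n) × ℝ → ℝ, IsGraphDomain D p φ Φ ∧
    (fun x => Φ x - ‖x.1‖ ^ 2) =O[𝓝 0] (fun x => ‖x‖ ^ 3)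

/-- The variables `z₁, …, zₙ, z̄₁, …, z̄ₙ, u`. -/
inductive Var (n : ℕ) : Type
  | z (j : Fin n)
  | zbar (j : Fin n)
  | u

/-- Grading by the degree in `z`. -/
def degZ {n : ℕ} : Var n → ℕ
  | .z _ => 1
  | .zbar _ => 0
  | .u => 0

/-- Grading by the degree in `z̄`. -/
def degZbar {n : ℕ} : Var n → ℕ
  | .z _ => 0
  | .zbar _ => 1
  | .u => 0

/-- The substitution `z_j ↦ z_j`, `z̄_j ↦ conj z_j`, `u ↦ u` at a point `(z, u)` of `ℂⁿ × ℝ`. -/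
def varValue {n : ℕ} (x : EuclideanSpace ℂ (Fin n) × ℝ) : Var n → ℂ
  | .z j => x.1 j
  | .zbar j => (starRingEnd ℂ) (x.1 j)
  | .u => (x.2 : ℂ)

/-- The part `P_{(k,l)}` of `P` which has degree `k` in `z` and degree `l` in `z̄`
(its coefficients are polynomials in `u`). -/
def bidegreePart {n : ℕ} (k l : ℕ) (P : MvPolynomial (Var n) ℂ) : MvPolynomial (Var n) ℂ :=
  MvPolynomial.weightedHomogeneousComponent degZ k
    (MvPolynomial.weightedHomogeneousComponent degZbar l P)

/-- The operator `∑_α ∂²/∂z_α∂z̄_α`. On polynomials of bidegree `(k, l)` it is `k l` times the trace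
`tr`, the contraction of the last `z`-index with the last `z̄`-index of the symmetric coefficients.
Only the vanishing of iterated traces is used below, so that the factor plays no role. -/
def traceOp {n : ℕ} (P : MvPolynomial (Var n) ℂ) : MvPolynomial (Var n) ℂ :=
  ∑ j : Fin n, MvPolynomial.pderiv (Var.z j) (MvPolynomial.pderiv (Var.zbar j) P)

/-- The Chern-Moser normalization of a polynomial in `(z, z̄, u)`: every monomial is divisible by
some `z_i z_j z̄_k z̄_l`, and
`tr P_{(2,2)} = 0`, `tr² P_{(2,3)} = 0`, `tr² P_{(3,2)} = 0`, `tr³ P_{(3,3)} = 0`. -/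
structure IsChernMoserNormal {n : ℕ} (P : MvPolynomial (Var n) ℂ) : Prop where
  divisible : ∀ d ∈ P.support, 2 ≤ Finsupp.weight degZ d ∧ 2 ≤ Finsupp.weight degZbar d
  trace22 : traceOp (bidegreePart 2 2 P) = 0
  trace23 : traceOp (traceOp (bidegreePart 2 3 P)) = 0
  trace32 : traceOp (traceOp (bidegreePart 3 2 P)) = 0
  trace33 : traceOp (traceOp (traceOp (bidegreePart 3 3 P))) = 0

/-- In the coordinates `φ` the hypersurface `∂D` is in Chern-Moser normal form in all terms of
weight at most `m`, where `z`, `z̄` have weight `1` and `u = Re w` has weight `2`: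
`D = {Im w > ‖z‖² + P(z, z̄, u) + (terms of weight > m)}` near the origin, with `P` normalized. -/
def IsChernMoserCoord {n : ℕ} (D : Set (Space n)) (p : Space n) (m : ℕ)
    (φ : OpenPartialHomeomorph (Space n) (Space n)) : Prop :=
  IsLocalCoord p φ ∧ ∃ (Φ : EuclideanSpace ℂ (Fin n) × ℝ → ℝ) (P : MvPolynomial (Var n) ℂ),
    IsGraphDomain D p φ Φ ∧ IsChernMoserNormal P ∧
    (fun x => ((Φ x - ‖x.1‖ ^ 2 : ℝ) : ℂ) - MvPolynomial.eval (varValue x) P)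
      =O[𝓝 0] (fun x => (‖x.1‖ + √|x.2|) ^ (m + 1))

/-- The germ is `1`-flat: in suitable local holomorphic coordinates `φ` at `p` and `φ'` at `p'`, in
which `∂D` and `∂D'` are in Chern-Moser normal form, one has `F = id + o(1)`, that is, the map
`φ' ∘ F ∘ φ⁻¹` has the value `0` and the differential `id` at the origin, non-tangentially.

For boundaries which are merely smooth, normalizing *all* terms requires formal coordinate changes,
which need not converge; the normalization is therefore required up to any prescribed weight
`m`. -/
def IsOneFlat {n : ℕ} (D D' : Set (Space n)) (p p' : Space n) (F : Space n → Space n) : Prop :=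
  ∀ m : ℕ, ∃ φ φ' : OpenPartialHomeomorph (Space n) (Space n),
    IsChernMoserCoord D p m φ ∧ IsChernMoserCoord D' p' m φ' ∧
    HasNTDifferential (fun x => φ' (F (φ.symm x))) (φ.target ∩ φ.symm ⁻¹' D) 0 0
      (ContinuousLinearMap.id ℂ (Space n))

/-- The map `L`, from the tangent space at `p` to that at `p'`, written in the coordinates `φ`, `φ'`:
`dφ'_{p'} ∘ L ∘ (dφ_p)⁻¹`. -/
def inCoords {n : ℕ} (p' : Space n) (φ φ' : OpenPartialHomeomorph (Space n) (Space n))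
    (L : Space n →L[ℂ] Space n) : Space n →L[ℂ] Space n :=
  (fderiv ℂ φ' p').comp (L.comp (fderiv ℂ φ.symm 0))

/-- The block `C` of `M = (C A; B λ)`. -/
def blockC {n : ℕ} (M : Space n →L[ℂ] Space n) :
    EuclideanSpace ℂ (Fin n) →ₗ[ℂ] EuclideanSpace ℂ (Fin n) :=
  LinearMap.fst ℂ _ _ ∘ₗ M.toLinearMap ∘ₗ LinearMap.inl ℂ _ _

/-- The block `λ` of `M = (C A; B λ)`. -/
def blockLambda {n : ℕ} (M : Space n →L[ℂ] Space n) : ℂ := (M (0, 1)).2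

/-- The number `μ_j / √λ`, for the `j`-th singular value `μ_j` of the block `C`. For the
non-tangential differential of a germ in normalized coordinates, `λ` is real and positive. -/
def singularValue {n : ℕ} (M : Space n →L[ℂ] Space n) (j : Fin n) : ℝ :=
  (blockC M).singularValues j / √(blockLambda M).re

/-- `F` is non-tangentially differentiable at `p`, and all singular values of its non-tangential
differential, computed in the coordinates `φ`, `φ'`, are equal to `1`. -/
def AllSingularValuesOne {n : ℕ} (D : Set (Space n)) (p p' : Space n)
    (φ φ' : OpenPartialHomeomorph (Space n) (Space n)) (F : Space n → Space n) : Prop :=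
  ∃ L : Space n →L[ℂ] Space n, HasNTDifferential F D p p' L ∧
    ∀ j : Fin n, singularValue (inCoords p' φ φ' L) j = 1

end FlatGerm

end

/-! In normalized coordinates the non-tangential differential of a germ is block triangular, M = (C
A; 0 λ) with λ ≥ 0. Indeed, along a ray tv with Im v₂ > 0 the image stays above a graph of size
O(t²), so v ↦ (Mv)₂ sends the upper half space into the closed half plane (`isUpper_of_im_nonneg`).
Call M conformal if λ > 0 and ‖Cz‖² = λ‖z‖² (`IsConformal`). Since n ≥ 1, this means exactly that
all μ_j/√λ equal 1 (`IsUpper.isConformal_iff`). It remains to show that F is 1-flat if and only if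
dF exists and is conformal (`RepresentsGerm.isOneFlat_iff`).

Necessity: a change between two normalized coordinate systems has a conformal differential. A map T
that is holomorphic across the boundary and preserves the domains satisfies ‖Cz‖² ≤ λ‖z‖², by the
minimum principle for Im T₂ on small discs whose boundary circles lie just inside the domain
(`norm_sq_le_of_mapsTo`). The same bound for the inverse gives equality. Chern-Moser coordinates of
weight 5 are normalized, so if F = id + o(1) in such coordinates, then M is a product of two
conformal maps.

Sufficiency: replacing φ' by M⁻¹ ∘ φ' turns the differential into the identity. As M is conformal,
the boundary keeps its model form ‖z‖² (`IsModelFunction.comp_conformal`). Both coordinate systems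
are then brought to Chern-Moser form by changes whose differential at the origin is the identity
(`exists_chernMoserCoord`), which leaves dF = id untouched.

Such changes are built weight by weight (`exists_improvement`). Adding a weighted homogeneous map
(f, g) to the change alters the next weight of the equation by Im g - 2 Re⟨f, z⟩ on the
hyperquadric. This linear operator is onto modulo normal forms (`mem_solvable`), even when f has no
term linear in w, and that restriction is what keeps the differential equal to the identity.
Surjectivity is pure algebra: Fischer decompositions split off the trace-free parts, and
combinations of holomorphic terms and their conjugates reach the rest.

Normalized coordinates exist because linear algebra and a quadratic shear give a model equation at a
strongly pseudoconvex point (`IsStronglyPseudoconvexAt.exists_model`), after which the normalization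
up to weight 5 applies. -/

noncomputable section

namespace FlatGerm

open MvPolynomial

/-! ### Polynomial algebra in (z, z̄, u): bidegrees, traces, Fischer decompositions, conjugation -/

/-- Polynomials in `(z, z̄, u)`. -/
abbrev Poly (n : ℕ) : Type := MvPolynomial (Var n) ℂ

/-- The variables as a disjoint union. -/
def varEquiv (n : ℕ) : Fin n ⊕ Fin n ⊕ Unit ≃ Var n where
  toFun
    | .inl j => .z j
    | .inr (.inl j) => .zbar j
    | .inr (.inr _) => .u
  invFun
    | .z j => .inl j
    | .zbar j => .inr (.inl j)
    | .u => .inr (.inr ())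
  left_inv := by rintro (j | j | ⟨⟩) <;> rfl
  right_inv := by rintro (j | j | _) <;> rfl

instance (n : ℕ) : Fintype (Var n) := Fintype.ofEquiv _ (varEquiv n)

variable {n : ℕ}

theorem sum_var {M : Type*} [AddCommMonoid M] (f : Var n → M) :
    ∑ i, f i = ∑ j, f (.z j) + (∑ j, f (.zbar j) + f .u) := by
  rw [← (varEquiv n).sum_comp f, Fintype.sum_sum_type, Fintype.sum_sum_type]
  simp [varEquiv]

/-- Grading by the degree in `u`. -/
def degU : Var n → ℕ
  | .z _ => 0
  | .zbar _ => 0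
  | .u => 1

/-- The weights: `z`, `z̄` have weight `1` and `u` has weight `2`. -/
def wt : Var n → ℕ
  | .z _ => 1
  | .zbar _ => 1
  | .u => 2

theorem weight_wt (d : Var n →₀ ℕ) : Finsupp.weight wt d =
    Finsupp.weight degZ d + Finsupp.weight degZbar d + 2 * Finsupp.weight degU d := by
  simp only [Finsupp.weight_eq_sum, sum_var, wt, degZ, degZbar, degU]
  simp
  ring

/-- `Q` has degree `k` in `z`, degree `l` in `z̄`, and does not depend on `u`. -/
structure IsType (k l : ℕ) (Q : Poly n) : Prop where
  z : IsWeightedHomogeneous degZ Q k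
  zbar : IsWeightedHomogeneous degZbar Q l
  u : IsWeightedHomogeneous degU Q 0

namespace IsType

variable {k l k' l' : ℕ} {P Q : Poly n}

theorem mul (hP : IsType k l P) (hQ : IsType k' l' Q) : IsType (k + k') (l + l') (P * Q) :=
  ⟨hP.z.mul hQ.z, hP.zbar.mul hQ.zbar, hP.u.mul hQ.u⟩

theorem sub (hP : IsType k l P) (hQ : IsType k l Q) : IsType k l (P - Q) :=
  ⟨hP.z.sub hQ.z, hP.zbar.sub hQ.zbar, hP.u.sub hQ.u⟩

theorem C_mul (c : ℂ) (hP : IsType k l P) : IsType k l (C c * P) :=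
  ⟨hP.z.C_mul c, hP.zbar.C_mul c, hP.u.C_mul c⟩

theorem sum {ι : Type*} (s : Finset ι) {f : ι → Poly n} (h : ∀ i ∈ s, IsType k l (f i)) :
    IsType k l (∑ i ∈ s, f i) :=
  ⟨IsWeightedHomogeneous.sum s f k fun i hi => (h i hi).z,
    IsWeightedHomogeneous.sum s f l fun i hi => (h i hi).zbar,
    IsWeightedHomogeneous.sum s f 0 fun i hi => (h i hi).u⟩

theorem X_z (j : Fin n) : IsType 1 0 (X (.z j) : Poly n) :=
  ⟨isWeightedHomogeneous_X .., isWeightedHomogeneous_X .., isWeightedHomogeneous_X ..⟩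

theorem X_zbar (j : Fin n) : IsType 0 1 (X (.zbar j) : Poly n) :=
  ⟨isWeightedHomogeneous_X .., isWeightedHomogeneous_X .., isWeightedHomogeneous_X ..⟩

theorem pow (hP : IsType k l P) (m : ℕ) : IsType (m * k) (m * l) (P ^ m) := by
  have := hP.z.pow m
  have := hP.zbar.pow m
  have := hP.u.pow m
  constructor <;> simp_all

theorem pderiv_z (j : Fin n) (hP : IsType (k + 1) l P) : IsType k l (pderiv (.z j) P) :=
  ⟨hP.z.pderiv rfl, hP.zbar.pderiv rfl, hP.u.pderiv rfl⟩

theorem pderiv_zbar (j : Fin n) (hP : IsType k (l + 1) P) : IsType k l (pderiv (.zbar j) P) :=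
  ⟨hP.z.pderiv rfl, hP.zbar.pderiv rfl, hP.u.pderiv rfl⟩

theorem traceOp (hP : IsType (k + 1) (l + 1) P) : IsType k l (traceOp P) :=
  sum _ fun j _ => (hP.pderiv_zbar j).pderiv_z j

theorem wt_mul_u (hP : IsType k l P) (j : ℕ) :
    IsWeightedHomogeneous wt (P * X .u ^ j) (k + l + 2 * j) := by
  have h : IsWeightedHomogeneous wt P (k + l) := fun d hd => by
    rw [weight_wt, hP.z hd, hP.zbar hd, hP.u hd, mul_zero, add_zero]
  refine h.mul ?_
  rw [mul_comm 2]
  exact (isWeightedHomogeneous_X ℂ wt Var.u).pow j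

theorem bidegreePart_mul_u (hP : IsType k l P) (k' l' j : ℕ) :
    bidegreePart k' l' (P * X .u ^ j) = if k' = k ∧ l' = l then P * X .u ^ j else 0 := by
  have hz : IsWeightedHomogeneous degZ (P * X .u ^ j) k := by
    simpa [degZ] using hP.z.mul ((isWeightedHomogeneous_X ℂ degZ Var.u).pow j)
  have hzb : IsWeightedHomogeneous degZbar (P * X .u ^ j) l := by
    simpa [degZbar] using hP.zbar.mul ((isWeightedHomogeneous_X ℂ degZbar Var.u).pow j)
  rw [bidegreePart, weightedHomogeneousComponent_of_mem (n := l) hzb]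
  by_cases hl : l' = l
  · rw [if_pos hl, weightedHomogeneousComponent_of_mem (n := k) hz]
    simp [hl]
  · simp [hl]

end IsType

/-- `traceOp` as a linear map. -/
def traceL (n : ℕ) : Poly n →ₗ[ℂ] Poly n :=
  ∑ j : Fin n, (pderiv (Var.z j)).toLinearMap ∘ₗ (pderiv (Var.zbar j)).toLinearMap

theorem traceL_apply (P : Poly n) : traceL n P = traceOp P := by
  simp [traceL, traceOp]

theorem traceOp_add (P Q : Poly n) : traceOp (P + Q) = traceOp P + traceOp Q := by
  simp only [← traceL_apply, map_add]

theorem traceOp_sub (P Q : Poly n) : traceOp (P - Q) = traceOp P - traceOp Q := by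
  simp only [← traceL_apply, map_sub]

theorem traceOp_smul (c : ℂ) (P : Poly n) : traceOp (c • P) = c • traceOp P := by
  simp only [← traceL_apply, map_smul]

theorem traceOp_zero : traceOp (0 : Poly n) = 0 := by
  simp only [← traceL_apply, map_zero]

theorem traceOp_C_mul (c : ℂ) (P : Poly n) : traceOp (C c * P) = C c * traceOp P := by
  rw [C_mul', traceOp_smul, C_mul']

theorem traceOp_mul_u (P : Poly n) (j : ℕ) : traceOp (P * X .u ^ j) = traceOp P * X .u ^ j := by
  classical
  simp only [traceOp, Finset.sum_mul]
  refine Finset.sum_congr rfl fun i _ => ?_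
  simp [Derivation.leibniz, Derivation.leibniz_pow, pderiv_X, mul_comm]

/-- The polynomial `‖z‖² = ∑ z_j z̄_j`. -/
def nsq (n : ℕ) : Poly n := ∑ j : Fin n, X (.z j) * X (.zbar j)

theorem isType_sq : IsType 1 1 (nsq n) :=
  IsType.sum _ fun j _ => (IsType.X_z j).mul (IsType.X_zbar j)

theorem pderiv_z_sq (j : Fin n) : pderiv (.z j) (nsq n) = X (.zbar j) := by
  classical
  simp [nsq, Derivation.leibniz, pderiv_X, Pi.single_apply]

theorem pderiv_zbar_sq (j : Fin n) : pderiv (.zbar j) (nsq n) = X (.z j) := by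
  classical
  simp [nsq, Derivation.leibniz, pderiv_X, Pi.single_apply]

theorem sum_z_mul_pderiv {k : ℕ} {P : Poly n} (hP : IsWeightedHomogeneous degZ P k) :
    ∑ j, X (.z j) * pderiv (.z j) P = C (k : ℂ) * P := by
  have := hP.sum_weight_X_mul_pderiv
  rw [sum_var] at this
  simpa [degZ] using this

theorem sum_zbar_mul_pderiv {l : ℕ} {P : Poly n} (hP : IsWeightedHomogeneous degZbar P l) :
    ∑ j, X (.zbar j) * pderiv (.zbar j) P = C (l : ℂ) * P := by
  have := hP.sum_weight_X_mul_pderiv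
  rw [sum_var] at this
  simpa [degZbar] using this

/-- The commutator of the trace operator with multiplication by ‖z‖²: the mixed Leibniz terms are
the two Euler operators, which act as k and l, and the Laplacian of ‖z‖² contributes n. All
constants in the Fischer decompositions come from this rule. -/
theorem traceOp_sq_mul {k l : ℕ} {P : Poly n} (hP : IsType k l P) :
    traceOp (nsq n * P) = nsq n * traceOp P + C ((n + k + l : ℕ) : ℂ) * P := by
  classical
  have h : ∀ j : Fin n, pderiv (.z j) (pderiv (.zbar j) (nsq n * P)) =
      P + X (.z j) * pderiv (.z j) P + X (.zbar j) * pderiv (.zbar j) P +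
        nsq n * pderiv (.z j) (pderiv (.zbar j) P) := fun j => by
    rw [Derivation.leibniz, pderiv_zbar_sq, map_add]
    simp only [smul_eq_mul, Derivation.leibniz, pderiv_z_sq, pderiv_X_self]
    ring
  simp only [traceOp, h, Finset.sum_add_distrib, sum_z_mul_pderiv hP.z, sum_zbar_mul_pderiv hP.zbar,
    ← Finset.mul_sum]
  simp
  ring

theorem traceOp_of_zbar {k : ℕ} {P : Poly n} (hP : IsType k 0 P) : traceOp P = 0 := by
  refine Finset.sum_eq_zero fun j _ => ?_
  suffices h : pderiv (.zbar j) P = 0 by rw [h, map_zero]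
  refine pderiv_eq_zero_of_notMem_vars fun hj => ?_
  obtain ⟨d, hd, hjd⟩ := (mem_vars_iff_mem_support _).1 hj
  have := hP.zbar (mem_support_iff.1 hd)
  rw [Finsupp.weight_eq_sum, sum_var] at this
  simp only [degZbar, smul_eq_mul, mul_zero, mul_one, Finset.sum_const_zero, zero_add, add_zero,
    Finset.sum_eq_zero_iff] at this
  exact (Finsupp.mem_support_iff.1 hjd) (this j (Finset.mem_univ _))

/-- Fischer decomposition in bidegree `(2, 2)`. -/
theorem exists_traceFree_two_two {Q : Poly n} (hQ : IsType 2 2 Q) :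
    ∃ b, IsType 1 1 b ∧ traceOp (Q - nsq n * b) = 0 := by
  -- The equation to solve is (n + 2) b = tr Q - ‖z‖² tr b. Applying the trace again gives tr² Q =
  -- (2n + 2) tr b, so `c` is the forced value of tr b.
  set c := C (((2 * n + 2 : ℕ) : ℂ)⁻¹) * traceOp (traceOp Q)
  have h2 : ((2 * n + 2 : ℕ) : ℂ) ≠ 0 := Nat.cast_ne_zero.2 (by omega)
  have h1 : ((n + 2 : ℕ) : ℂ) ≠ 0 := Nat.cast_ne_zero.2 (by omega)
  have hc : IsType 0 0 c := (hQ.traceOp.traceOp).C_mul _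
  have hsc : IsType 1 1 (nsq n * c) := isType_sq.mul hc
  set b := C (((n + 2 : ℕ) : ℂ)⁻¹) * (traceOp Q - nsq n * c)
  have hb : IsType 1 1 b := (hQ.traceOp.sub hsc).C_mul _
  have e1 : C ((n + 2 : ℕ) : ℂ) * b = traceOp Q - nsq n * c := by
    rw [← mul_assoc, ← C_mul, mul_inv_cancel₀ h1, C_1, one_mul]
  have e2 : C ((2 * n + 2 : ℕ) : ℂ) * c = traceOp (traceOp Q) := by
    rw [← mul_assoc, ← C_mul, mul_inv_cancel₀ h2, C_1, one_mul]
  have e3 : traceOp b = c := by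
    have h : C ((n + 2 : ℕ) : ℂ) * traceOp b = C ((n + 2 : ℕ) : ℂ) * c := by
      rw [← traceOp_C_mul, e1, traceOp_sub, traceOp_sq_mul hc, traceOp_of_zbar hc, ← e2]
      simp only [map_natCast]
      push_cast
      ring
    exact mul_left_cancel₀ (by rwa [Ne, C_eq_zero]) h
  refine ⟨b, hb, ?_⟩
  rw [traceOp_sub, traceOp_sq_mul hb, e3]
  have : C ((n + 1 + 1 : ℕ) : ℂ) * b = traceOp Q - nsq n * c := e1
  rw [this]
  ring

/-- Fischer decomposition in bidegree `(3, 2)`. -/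
theorem exists_traceFree_three_two {Q : Poly n} (hQ : IsType 3 2 Q) :
    ∃ a, IsType 1 0 a ∧ traceOp (traceOp (Q - nsq n ^ 2 * a)) = 0 := by
  -- The eigenvalue of tr² ∘ ‖z‖⁴ on linear forms: one trace of ‖z‖⁴ a gives 2n + 4, the next gives
  -- n + 1.
  set m : ℂ := (2 * n + 4 : ℕ) * (n + 1 : ℕ)
  have hm : m ≠ 0 := mul_ne_zero (Nat.cast_ne_zero.2 (by omega)) (Nat.cast_ne_zero.2 (by omega))
  set a := C m⁻¹ * traceOp (traceOp Q)
  have ha : IsType 1 0 a := (hQ.traceOp.traceOp).C_mul _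
  have e : C m * a = traceOp (traceOp Q) := by
    rw [← mul_assoc, ← C_mul, mul_inv_cancel₀ hm, C_1, one_mul]
  refine ⟨a, ha, ?_⟩
  have h1 : traceOp (nsq n * a) = C ((n + 1 : ℕ) : ℂ) * a := by
    rw [traceOp_sq_mul ha, traceOp_of_zbar ha, mul_zero, zero_add]
  have h2 : traceOp (nsq n * (nsq n * a)) = C ((2 * n + 4 : ℕ) : ℂ) * (nsq n * a) := by
    rw [traceOp_sq_mul (isType_sq.mul ha), h1]
    simp only [map_natCast]
    push_cast
    ring
  rw [show Q - nsq n ^ 2 * a = Q - nsq n * (nsq n * a) by ring, traceOp_sub, traceOp_sub, h2,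
    traceOp_C_mul, h1, ← mul_assoc, ← C_mul, ← e, sub_self]

/-- Fischer decomposition in bidegree `(3, 3)`. -/
theorem exists_traceFree_three_three (hn : 1 ≤ n) {Q : Poly n} (hQ : IsType 3 3 Q) :
    ∃ c, IsType 0 0 c ∧ traceOp (traceOp (traceOp (Q - nsq n ^ 3 * c))) = 0 := by
  -- The three successive traces of ‖z‖⁶ contribute 3n + 6, 2n + 2 and n. The last factor is the
  -- reason for requiring n ≥ 1.
  set m : ℂ := (3 * n + 6 : ℕ) * ((2 * n + 2 : ℕ) * (n : ℕ))
  have hm : m ≠ 0 := mul_ne_zero (Nat.cast_ne_zero.2 (by omega))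
    (mul_ne_zero (Nat.cast_ne_zero.2 (by omega)) (Nat.cast_ne_zero.2 (by omega)))
  set a := C m⁻¹ * traceOp (traceOp (traceOp Q))
  have ha : IsType 0 0 a := (hQ.traceOp.traceOp.traceOp).C_mul _
  have e : C m * a = traceOp (traceOp (traceOp Q)) := by
    rw [← mul_assoc, ← C_mul, mul_inv_cancel₀ hm, C_1, one_mul]
  refine ⟨a, ha, ?_⟩
  have h1 : traceOp (nsq n * a) = C (n : ℂ) * a := by
    rw [traceOp_sq_mul ha, traceOp_of_zbar ha, mul_zero, zero_add, add_zero, add_zero]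
  have h2 : traceOp (nsq n * (nsq n * a)) = C ((2 * n + 2 : ℕ) : ℂ) * (nsq n * a) := by
    rw [traceOp_sq_mul (isType_sq.mul ha), h1]
    simp only [map_natCast]
    push_cast
    ring
  have h3 : traceOp (nsq n * (nsq n * (nsq n * a))) =
      C ((3 * n + 6 : ℕ) : ℂ) * (nsq n * (nsq n * a)) := by
    rw [traceOp_sq_mul (isType_sq.mul (isType_sq.mul ha)), h2]
    simp only [map_natCast]
    push_cast
    ring
  rw [show Q - nsq n ^ 3 * a = Q - nsq n * (nsq n * (nsq n * a)) by ring, traceOp_sub, traceOp_sub,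
    traceOp_sub, h3, traceOp_C_mul, h2, traceOp_C_mul, traceOp_C_mul, h1, ← mul_assoc,
    ← mul_assoc, ← C_mul, ← C_mul, mul_assoc, ← e, sub_self]

/-- The polynomials in Chern-Moser normal form are a linear subspace. -/
def normalForms (n : ℕ) : Submodule ℂ (Poly n) where
  carrier := {P | IsChernMoserNormal P}
  zero_mem' := ⟨by simp, by simp [bidegreePart, traceOp_zero], by simp [bidegreePart, traceOp_zero],
    by simp [bidegreePart, traceOp_zero], by simp [bidegreePart, traceOp_zero]⟩
  add_mem' := by
    classical
    intro P Q hP hQ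
    refine ⟨fun d hd => ?_, ?_, ?_, ?_, ?_⟩
    · rcases Finset.mem_union.1 (support_add hd) with h | h
      exacts [hP.divisible d h, hQ.divisible d h]
    · simpa [bidegreePart, traceOp_add, hP.trace22] using
        congrArg₂ (· + ·) hP.trace22 hQ.trace22
    · simpa [bidegreePart, traceOp_add, hP.trace22] using
        congrArg₂ (· + ·) hP.trace23 hQ.trace23
    · simpa [bidegreePart, traceOp_add, hP.trace22] using
        congrArg₂ (· + ·) hP.trace32 hQ.trace32
    · simpa [bidegreePart, traceOp_add, hP.trace22] using
        congrArg₂ (· + ·) hP.trace33 hQ.trace33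
  smul_mem' := by
    intro c P hP
    refine ⟨fun d hd => hP.divisible d (support_smul hd), ?_, ?_, ?_, ?_⟩
    · simpa [bidegreePart, traceOp_smul] using congrArg (c • ·) hP.trace22
    · simpa [bidegreePart, traceOp_smul] using congrArg (c • ·) hP.trace23
    · simpa [bidegreePart, traceOp_smul] using congrArg (c • ·) hP.trace32
    · simpa [bidegreePart, traceOp_smul] using congrArg (c • ·) hP.trace33

theorem IsType.isChernMoserNormal {k l : ℕ} {Q : Poly n} (hQ : IsType k l Q) (hk : 2 ≤ k)
    (hl : 2 ≤ l) (h22 : k = 2 → l = 2 → FlatGerm.traceOp Q = 0)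
    (h23 : k = 2 → l = 3 → FlatGerm.traceOp (FlatGerm.traceOp Q) = 0)
    (h32 : k = 3 → l = 2 → FlatGerm.traceOp (FlatGerm.traceOp Q) = 0)
    (h33 : k = 3 → l = 3 → FlatGerm.traceOp (FlatGerm.traceOp (FlatGerm.traceOp Q)) = 0) (j : ℕ) :
    IsChernMoserNormal (Q * X .u ^ j) := by
  have hz : IsWeightedHomogeneous degZ (Q * X .u ^ j) k := by
    simpa [degZ] using hQ.z.mul ((isWeightedHomogeneous_X ℂ degZ Var.u).pow j)
  have hzb : IsWeightedHomogeneous degZbar (Q * X .u ^ j) l := by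
    simpa [degZbar] using hQ.zbar.mul ((isWeightedHomogeneous_X ℂ degZbar Var.u).pow j)
  refine ⟨fun d hd => ?_, ?_, ?_, ?_, ?_⟩
  · rw [hz (mem_support_iff.1 hd), hzb (mem_support_iff.1 hd)]
    exact ⟨hk, hl⟩
  all_goals
    rw [hQ.bidegreePart_mul_u]
    split_ifs with h
    · simp only [traceOp_mul_u]
      first
        | rw [h22 h.1.symm h.2.symm, zero_mul]
        | rw [h23 h.1.symm h.2.symm, zero_mul]
        | rw [h32 h.1.symm h.2.symm, zero_mul]
        | rw [h33 h.1.symm h.2.symm, zero_mul]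
    · simp only [traceOp_zero]

/-- The involution of the variables exchanging `z` and `z̄`. -/
def swapVar : Var n → Var n
  | .z j => .zbar j
  | .zbar j => .z j
  | .u => .u

theorem swapVar_swapVar (v : Var n) : swapVar (swapVar v) = v := by cases v <;> rfl

theorem swapVar_injective : Function.Injective (swapVar : Var n → Var n) :=
  Function.LeftInverse.injective swapVar_swapVar

/-- Complex conjugation of polynomials in `(z, z̄, u)`. -/
def conjP : Poly n →+* Poly n :=
  (rename swapVar).toRingHom.comp (map (starRingEnd ℂ))

theorem conjP_apply (P : Poly n) : conjP P = rename swapVar (map (starRingEnd ℂ) P) := rfl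

@[simp] theorem conjP_C (c : ℂ) : conjP (C c : Poly n) = C (starRingEnd ℂ c) := by
  simp [conjP_apply]

@[simp] theorem conjP_X (v : Var n) : conjP (X v : Poly n) = X (swapVar v) := by
  simp [conjP_apply]

theorem conjP_conjP (P : Poly n) : conjP (conjP P) = P := by
  induction P using MvPolynomial.induction_on with
  | C c => simp
  | add p q hp hq => simp [hp, hq]
  | mul_X p i hp => simp [hp, swapVar_swapVar]

theorem eval_conjP (x : EuclideanSpace ℂ (Fin n) × ℝ) (P : Poly n) :
    eval (varValue x) (conjP P) = starRingEnd ℂ (eval (varValue x) P) := by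
  induction P using MvPolynomial.induction_on with
  | C c => simp
  | add p q hp hq => simp [hp, hq]
  | mul_X p i hp => cases i <;> simp [hp, swapVar, varValue]

theorem coeff_conjP (P : Poly n) (d : Var n →₀ ℕ) :
    coeff d (conjP P) = starRingEnd ℂ (coeff (d.mapDomain swapVar) P) := by
  have h : (d.mapDomain swapVar).mapDomain swapVar = d := by
    rw [← Finsupp.mapDomain_comp, show swapVar ∘ swapVar = (id : Var n → Var n) from
      funext swapVar_swapVar, Finsupp.mapDomain_id]
  rw [conjP_apply, ← h, coeff_rename_mapDomain _ swapVar_injective, coeff_map, h]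

theorem weight_mapDomain_swapVar (w : Var n → ℕ) (d : Var n →₀ ℕ) :
    Finsupp.weight w (d.mapDomain swapVar) = Finsupp.weight (w ∘ swapVar) d := by
  simp [Finsupp.weight, Finsupp.linearCombination_mapDomain]

theorem degZ_comp_swapVar : (degZ ∘ swapVar : Var n → ℕ) = degZbar := by
  funext v; cases v <;> rfl

theorem degZbar_comp_swapVar : (degZbar ∘ swapVar : Var n → ℕ) = degZ := by
  funext v; cases v <;> rfl

theorem degU_comp_swapVar : (degU ∘ swapVar : Var n → ℕ) = degU := by
  funext v; cases v <;> rfl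

theorem wt_comp_swapVar : (wt ∘ swapVar : Var n → ℕ) = wt := by
  funext v; cases v <;> rfl

theorem isWeightedHomogeneous_conjP {w : Var n → ℕ} {k : ℕ} {P : Poly n}
    (hP : IsWeightedHomogeneous w P k) : IsWeightedHomogeneous (w ∘ swapVar) (conjP P) k := by
  intro d hd
  rw [coeff_conjP] at hd
  rw [← weight_mapDomain_swapVar]
  exact hP fun h => hd (by rw [h, map_zero])

theorem IsType.conjP {k l : ℕ} {P : Poly n} (hP : IsType k l P) : IsType l k (conjP P) :=
  ⟨degZbar_comp_swapVar ▸ isWeightedHomogeneous_conjP hP.zbar,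
    degZ_comp_swapVar ▸ isWeightedHomogeneous_conjP hP.z,
    degU_comp_swapVar ▸ isWeightedHomogeneous_conjP hP.u⟩

theorem bidegreePart_conjP (k l : ℕ) (P : Poly n) :
    bidegreePart k l (conjP P) = conjP (bidegreePart l k P) := by
  classical
  ext d
  simp only [bidegreePart, coeff_weightedHomogeneousComponent, coeff_conjP,
    weight_mapDomain_swapVar, degZ_comp_swapVar, degZbar_comp_swapVar]
  split_ifs <;> simp

theorem pderiv_conjP (v : Var n) (P : Poly n) :
    pderiv (swapVar v) (conjP P) = conjP (pderiv v P) := by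
  rw [conjP_apply, pderiv_rename swapVar_injective, pderiv_map, conjP_apply]

theorem pderiv_pderiv_comm (v w : Var n) (P : Poly n) :
    pderiv v (pderiv w P) = pderiv w (pderiv v P) := by
  classical
  induction P using MvPolynomial.induction_on with
  | C c => simp
  | add p q hp hq => simp [hp, hq]
  | mul_X p i hp =>
    have h (a b : Var n) : pderiv a (pderiv b (X i : Poly n)) = 0 := by
      rw [pderiv_X, Pi.single_apply]
      split_ifs <;> simp
    simp only [Derivation.leibniz, smul_eq_mul, map_add, h, hp]
    ring

theorem traceOp_conjP (P : Poly n) : traceOp (conjP P) = conjP (traceOp P) := by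
  simp only [traceOp, map_sum]
  refine Finset.sum_congr rfl fun j _ => ?_
  rw [← pderiv_conjP, ← pderiv_conjP, pderiv_pderiv_comm]
  rfl

theorem IsChernMoserNormal.conjP {P : Poly n} (hP : IsChernMoserNormal P) :
    IsChernMoserNormal (conjP P) := by
  refine ⟨fun d hd => ?_, ?_, ?_, ?_, ?_⟩
  · rw [mem_support_iff, coeff_conjP] at hd
    have := hP.divisible (d.mapDomain swapVar) (mem_support_iff.2 fun h => hd (by rw [h, map_zero]))
    rw [weight_mapDomain_swapVar, weight_mapDomain_swapVar, degZ_comp_swapVar,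
      degZbar_comp_swapVar] at this
    exact this.symm
  · rw [bidegreePart_conjP, traceOp_conjP, hP.trace22, map_zero]
  · rw [bidegreePart_conjP, traceOp_conjP, traceOp_conjP, hP.trace32, map_zero]
  · rw [bidegreePart_conjP, traceOp_conjP, traceOp_conjP, hP.trace23, map_zero]
  · rw [bidegreePart_conjP, traceOp_conjP, traceOp_conjP, traceOp_conjP, hP.trace33, map_zero]

@[simp] theorem conjP_sq : conjP (nsq n) = nsq n := by
  simp [nsq, swapVar, mul_comm]

end FlatGerm

end

/-! ### The Chern-Moser operator is onto modulo normal forms -/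

noncomputable section

namespace FlatGerm

open MvPolynomial

variable {n : ℕ}

theorem eval_pow_weight_mul {w : Var n → ℕ} {k : ℕ} {P : Poly n}
    (hP : IsWeightedHomogeneous w P k) (t : ℂ) (x : Var n → ℂ) :
    eval (fun v => t ^ w v * x v) P = t ^ k * eval x P := by
  rw [eval_eq', eval_eq', Finset.mul_sum]
  refine Finset.sum_congr rfl fun d hd => ?_
  have h := hP (mem_support_iff.1 hd)
  rw [Finsupp.weight_eq_sum] at h
  simp only [mul_pow, Finset.prod_mul_distrib, ← pow_mul]
  rw [Finset.prod_pow_eq_pow_sum, ← h]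
  simp only [smul_eq_mul, mul_comm (w _)]
  ring

/-- The values `z_j ↦ z_j`, `z̄_j ↦ 0`, `u ↦ 0`. -/
def holoValue (z : EuclideanSpace ℂ (Fin n)) : Var n → ℂ
  | .z j => z j
  | .zbar _ => 0
  | .u => 0

/-- Setting z̄ and u to zero makes the evaluation holomorphic in z. Nothing changes for type (k, 0),
by homogeneity of degree 0 in z̄ and in u with dilation parameter 0. -/
theorem eval_holoValue {k : ℕ} {P : Poly n} (hP : IsType k 0 P)
    (x : EuclideanSpace ℂ (Fin n) × ℝ) : eval (holoValue x.1) P = eval (varValue x) P := by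
  have h := eval_pow_weight_mul hP.zbar 0 (varValue x)
  rw [pow_zero, one_mul] at h
  rw [← h]
  have h' := eval_pow_weight_mul hP.u 0 (fun v => 0 ^ degZbar v * varValue x v)
  rw [pow_zero, one_mul] at h'
  rw [← h']
  congr 2
  funext v
  cases v <;> simp [holoValue, varValue, degU, degZbar]

theorem eval_holoValue_smul {k l : ℕ} {P : Poly n} (hP : IsType k l P) (t : ℂ)
    (z : EuclideanSpace ℂ (Fin n)) :
    eval (holoValue (t • z)) P = t ^ k * eval (holoValue z) P := by
  rw [← eval_pow_weight_mul hP.z]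
  congr 2
  funext v
  cases v <;> simp [holoValue, degZ]

theorem eval_holoValue_zero {k l : ℕ} {P : Poly n} (hP : IsType k l P) (hk : k ≠ 0) :
    eval (holoValue 0) P = 0 := by
  simpa [hk] using eval_holoValue_smul hP 0 0

theorem contDiff_eval {𝕜 E : Type*} [NontriviallyNormedField 𝕜] [NormedAlgebra 𝕜 ℂ]
    [NormedAddCommGroup E] [NormedSpace 𝕜 E] {m : WithTop ℕ∞}
    {f : E → Var n → ℂ} (hf : ∀ v, ContDiff 𝕜 m fun e => f e v) (P : Poly n) :
    ContDiff 𝕜 m fun e => eval (f e) P := by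
  induction P using MvPolynomial.induction_on with
  | C c => simpa using contDiff_const
  | add p q hp hq => simpa using hp.add hq
  | mul_X p i hp => simpa using hp.mul (hf i)

theorem contDiff_holoValue {m : WithTop ℕ∞} (v : Var n) :
    ContDiff ℂ m fun y : Space n => holoValue y.1 v := by
  cases v with
  | z j => exact ((EuclideanSpace.proj (𝕜 := ℂ) j).contDiff).comp contDiff_fst
  | zbar j => exact contDiff_const
  | u => exact contDiff_const

/-- A holomorphic map `h = (f, g)` of `ℂⁿ × ℂ` with `f` of weight `m` and `g` of weight `m + 1`,
where `w` has weight `2`. For `m = 2` linear terms in `w` are excluded from `f`. -/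
structure IsWeightedMap (m : ℕ) (h : Space n → Space n) : Prop where
  contDiff : ContDiff ℂ ∞ h
  dilate : ∀ (t : ℂ) (y : Space n), h (t • y.1, t ^ 2 * y.2) =
    (t ^ m • (h y).1, t ^ (m + 1) * (h y).2)
  eq_zero : m = 2 → ∀ w, (h (0, w)).1 = 0

namespace IsWeightedMap

variable {m : ℕ} {h h' : Space n → Space n}

theorem zero (m : ℕ) : IsWeightedMap m (fun _ => 0 : Space n → Space n) :=
  ⟨contDiff_const, by simp [Prod.ext_iff], by simp⟩

theorem add (hh : IsWeightedMap m h) (hh' : IsWeightedMap m h') :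
    IsWeightedMap m (fun y => h y + h' y) :=
  ⟨hh.contDiff.add hh'.contDiff, fun t y => by
    rw [hh.dilate, hh'.dilate]
    simp [mul_add], fun h2 w => by simp [hh.eq_zero h2, hh'.eq_zero h2]⟩

theorem smul (c : ℂ) (hh : IsWeightedMap m h) : IsWeightedMap m (fun y => c • h y) :=
  ⟨hh.contDiff.const_smul c, fun t y => by
    rw [hh.dilate]
    ext <;> simp <;> ring, fun h2 w => by simp [hh.eq_zero h2]⟩

end IsWeightedMap

/-- The value of `w` on the hyperquadric `Im w = ‖z‖²`. -/
def quadricW (x : EuclideanSpace ℂ (Fin n) × ℝ) : ℂ := x.2 + Complex.I * (‖x.1‖ ^ 2 : ℝ)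

/-- The Chern-Moser operator `h = (f, g) ↦ g + ⟨f, z⟩` on the hyperquadric. -/
def cmOp (h : Space n → Space n) (x : EuclideanSpace ℂ (Fin n) × ℝ) : ℂ :=
  (h (x.1, quadricW x)).2 + inner ℂ x.1 (h (x.1, quadricW x)).1

theorem cmOp_add (h h' : Space n → Space n) (x : EuclideanSpace ℂ (Fin n) × ℝ) :
    cmOp (fun y => h y + h' y) x = cmOp h x + cmOp h' x := by
  simp [cmOp]; ring

theorem cmOp_smul (c : ℂ) (h : Space n → Space n) (x : EuclideanSpace ℂ (Fin n) × ℝ) :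
    cmOp (fun y => c • h y) x = c * cmOp h x := by
  simp [cmOp]; ring

/-- The polynomials of weight `m + 1` that are solvable modulo normal forms. -/
def solvable (n m : ℕ) : Submodule ℂ (Poly n) where
  -- Using two independent maps makes the condition complex linear and stable under conjugation. For
  -- real right-hand sides the two are merged into one map in `exists_weightedMap`.
  carrier := {E | ∃ (h h' : Space n → Space n) (N : Poly n), IsWeightedMap m h ∧
    IsWeightedMap m h' ∧ IsChernMoserNormal N ∧ IsWeightedHomogeneous wt N (m + 1) ∧
    ∀ x, eval (varValue x) E = cmOp h x + starRingEnd ℂ (cmOp h' x) + eval (varValue x) N}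
  zero_mem' := ⟨_, _, 0, IsWeightedMap.zero m, IsWeightedMap.zero m, (normalForms n).zero_mem,
    isWeightedHomogeneous_zero .., by simp [cmOp]⟩
  add_mem' := by
    rintro E E' ⟨h₁, h₂, N, hh₁, hh₂, hN, hN', hE⟩ ⟨h₁', h₂', N₂, hh₁', hh₂', hN₂, hN₂', hE'⟩
    refine ⟨_, _, N + N₂, hh₁.add hh₁', hh₂.add hh₂', (normalForms n).add_mem hN hN₂,
      hN'.add hN₂', fun x => ?_⟩
    simp only [map_add, hE, hE', cmOp_add]
    ring
  smul_mem' := by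
    rintro c E ⟨h₁, h₂, N, hh₁, hh₂, hN, hN', hE⟩
    refine ⟨_, _, c • N, hh₁.smul c, hh₂.smul (starRingEnd ℂ c), (normalForms n).smul_mem c hN,
      (weightedHomogeneousSubmodule ℂ wt (m + 1)).smul_mem c hN', fun x => ?_⟩
    simp only [smul_eval, hE, cmOp_smul, map_mul, Complex.conj_conj]
    ring

variable {m : ℕ}

theorem conjP_mem_solvable {E : Poly n} (hE : E ∈ solvable n m) : conjP E ∈ solvable n m := by
  obtain ⟨h₁, h₂, N, hh₁, hh₂, hN, hN', hE⟩ := hE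
  refine ⟨h₂, h₁, conjP N, hh₂, hh₁, hN.conjP, wt_comp_swapVar ▸ isWeightedHomogeneous_conjP hN',
    fun x => ?_⟩
  simp only [eval_conjP, hE, map_add, Complex.conj_conj]
  ring

theorem normal_mem_solvable {N : Poly n} (hN : IsChernMoserNormal N)
    (hN' : IsWeightedHomogeneous wt N (m + 1)) : N ∈ solvable n m :=
  ⟨_, _, N, IsWeightedMap.zero m, IsWeightedMap.zero m, hN, hN', by simp [cmOp]⟩

/-- The polynomial `u + i‖z‖²`. -/
def polyW (n : ℕ) : Poly n := X .u + C Complex.I * nsq n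

theorem eval_sq (x : EuclideanSpace ℂ (Fin n) × ℝ) :
    eval (varValue x) (nsq n) = (‖x.1‖ ^ 2 : ℝ) := by
  rw [EuclideanSpace.norm_sq_eq]
  simp only [nsq, map_sum, map_mul, eval_X, varValue, Complex.mul_conj, Complex.normSq_eq_norm_sq,
    Complex.ofReal_sum]

theorem eval_polyW (x : EuclideanSpace ℂ (Fin n) × ℝ) :
    eval (varValue x) (polyW n) = quadricW x := by
  simp [polyW, quadricW, eval_sq, varValue]

/-- Generators from g = Q(z) wʲ with f = 0. -/
theorem mul_polyW_pow_mem_of_zero {k j : ℕ} {Q : Poly n} (hQ : IsType k 0 Q)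
    (hm : k + 2 * j = m + 1) : Q * polyW n ^ j ∈ solvable n m := by
  refine ⟨fun y => (0, eval (holoValue y.1) Q * y.2 ^ j), _, 0, ⟨?_, fun t y => ?_, by simp⟩,
    IsWeightedMap.zero m, (normalForms n).zero_mem, isWeightedHomogeneous_zero .., fun x => ?_⟩
  · exact contDiff_const.prodMk ((contDiff_eval contDiff_holoValue Q).mul (contDiff_snd.pow j))
  · simp only [eval_holoValue_smul hQ, smul_zero, Prod.mk.injEq, true_and]
    rw [← hm]
    ring
  · simp [cmOp, eval_holoValue hQ, eval_polyW]

/-- Generators from f_i = (∂Q/∂z̄_i) wʲ with g = 0: as Q is linear in z̄, Euler's identity gives ⟨f,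
z⟩ = Q wʲ. The excluded pair k = 0, j = 1 would make f linear in w, which `IsWeightedMap.eq_zero`
forbids. -/
theorem mul_polyW_pow_mem_of_one {k j : ℕ} {Q : Poly n} (hQ : IsType k 1 Q)
    (hm : k + 2 * j = m) (hkj : ¬ (k = 0 ∧ j = 1)) : Q * polyW n ^ j ∈ solvable n m := by
  have hd (i : Fin n) : IsType k 0 (pderiv (.zbar i) Q) := hQ.pderiv_zbar i
  refine ⟨fun y => (WithLp.toLp 2 fun i =>
      eval (holoValue y.1) (pderiv (.zbar i) Q) * y.2 ^ j, 0), _, 0,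
    ⟨?_, fun t y => ?_, fun h2 w => ?_⟩,
    IsWeightedMap.zero m, (normalForms n).zero_mem, isWeightedHomogeneous_zero .., fun x => ?_⟩
  · refine ContDiff.prodMk ?_ contDiff_const
    rw [contDiff_euclidean]
    exact fun i => (contDiff_eval contDiff_holoValue _).mul (contDiff_snd.pow j)
  · simp only [eval_holoValue_smul (hd _), mul_zero, Prod.mk.injEq, and_true]
    ext i
    simp only [PiLp.smul_apply, smul_eq_mul]
    rw [← hm]
    ring
  · ext i
    have hk : k ≠ 0 := by omega
    simp [eval_holoValue_zero (hd i) hk]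
  · have h := congrArg (eval (varValue x)) (sum_zbar_mul_pderiv hQ.zbar)
    simp only [map_sum, map_mul, eval_X, varValue, Nat.cast_one, map_one, one_mul] at h
    simp only [cmOp, map_mul, map_pow, eval_polyW, ← h, eval_holoValue (hd _), zero_add,
      PiLp.inner_apply, RCLike.inner_apply, map_zero, add_zero, Finset.sum_mul, Prod.snd_zero,
      Prod.fst_zero, PiLp.zero_apply, zero_mul, Finset.sum_const_zero]
    exact Finset.sum_congr rfl fun i _ => by ring

/-- All polynomials of type `(k, l)` times powers of `u`, of total weight `m + 1`, are solvable. -/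
def TypeSolvable (n m k l : ℕ) : Prop :=
  ∀ (Q : Poly n) (j : ℕ), IsType k l Q → k + l + 2 * j = m + 1 → Q * X .u ^ j ∈ solvable n m

theorem TypeSolvable.symm {k l : ℕ} (h : TypeSolvable n m k l) : TypeSolvable n m l k := by
  intro Q j hQ hj
  have := conjP_mem_solvable (h (conjP Q) j hQ.conjP (by omega))
  simpa [conjP_conjP, swapVar] using this

/-- No trace condition applies in these bidegrees, so the polynomials are already normal. -/
theorem typeSolvable_of_le {k l : ℕ} (hk : 2 ≤ k) (hl : 2 ≤ l) (h : 4 ≤ k ∨ 4 ≤ l) :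
    TypeSolvable n m k l := by
  intro Q j hQ hj
  refine normal_mem_solvable (hQ.isChernMoserNormal hk hl ?_ ?_ ?_ ?_ j) (hj ▸ hQ.wt_mul_u j) <;>
    intros <;> omega

/-- The `i`-th term of the expansion of `Q (u + i‖z‖²)ʲ`. -/
def expTerm (Q : Poly n) (j i : ℕ) : Poly n :=
  C (j.choose i * Complex.I ^ i) * (Q * nsq n ^ i * X .u ^ (j - i))

theorem mul_polyW_pow_sub_mem {k l j a : ℕ} {Q : Poly n} (hQ : IsType k l Q)
    (hj : k + l + 2 * j = m + 1) (h : ∀ i, a ≤ i → TypeSolvable n m (k + i) (l + i)) :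
    Q * polyW n ^ j - ∑ i ∈ Finset.range a, expTerm Q j i ∈ solvable n m := by
  -- Padding the binomial sum with its vanishing terms beyond j allows the first `a` terms to be
  -- split off whatever the size of `a`.
  have hs : ∀ b, Q * polyW n ^ j = ∑ i ∈ Finset.range (j + 1 + b), expTerm Q j i := fun b => by
    rw [Finset.sum_range_add, polyW, add_comm (X _), add_pow, Finset.mul_sum]
    have : ∑ x ∈ Finset.range b, expTerm Q j (j + 1 + x) = 0 :=
      Finset.sum_eq_zero fun x _ => by
        rw [expTerm, Nat.choose_eq_zero_of_lt (by omega)]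
        simp
    rw [this, add_zero]
    refine Finset.sum_congr rfl fun i _ => ?_
    rw [expTerm, mul_pow, C_mul, C_pow, map_natCast]
    ring
  rw [hs a, show j + 1 + a = a + (j + 1) by ring, Finset.sum_range_add, add_sub_cancel_left]
  refine Submodule.sum_mem _ fun i _ => ?_
  rw [expTerm]
  by_cases hi : a + i ≤ j
  · rw [C_mul']
    refine Submodule.smul_mem _ _ (h (a + i) (by omega) _ _ ?_ (by omega))
    simpa using hQ.mul (isType_sq.pow (a + i))
  · rw [Nat.choose_eq_zero_of_lt (by omega)]
    simp

/-- Since w = u + i‖z‖², the polynomials Q wʲ and Q uʲ differ only by terms further along the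
diagonal (k + i, l + i). The types are therefore settled from high bidegree down to low. -/
theorem typeSolvable_of_gen {k l : ℕ}
    (hgen : ∀ (Q : Poly n) (j : ℕ), IsType k l Q → k + l + 2 * j = m + 1 →
      Q * polyW n ^ j ∈ solvable n m)
    (h : ∀ i, 1 ≤ i → TypeSolvable n m (k + i) (l + i)) : TypeSolvable n m k l := by
  intro Q j hQ hj
  have := (solvable n m).sub_mem (hgen Q j hQ hj) (mul_polyW_pow_sub_mem hQ hj h)
  simpa [expTerm] using this

/-- Conjugation replaces u + i‖z‖² by u - i‖z‖², so only the odd terms survive in Q wʲ - Q w̄ʲ. -/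
theorem conjP_expTerm (Q : Poly n) (j i : ℕ) :
    conjP (expTerm (conjP Q) j i) = C ((-1) ^ i) * expTerm Q j i := by
  simp only [expTerm, map_mul, conjP_C, conjP_conjP, map_pow, conjP_sq, conjP_X, swapVar,
    Complex.conj_I, map_natCast, map_neg, map_one]
  ring

theorem smul_cancel_mem {c : ℂ} (hc : c ≠ 0) {P : Poly n} (h : C c * P ∈ solvable n m) :
    P ∈ solvable n m := by
  rw [C_mul'] at h
  exact (Submodule.smul_mem_iff _ hc).1 h

theorem C_mul_mem (c : ℂ) {P : Poly n} (h : P ∈ solvable n m) : C c * P ∈ solvable n m := by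
  rw [C_mul']
  exact Submodule.smul_mem _ _ h

/-- Generators in bidegree `(k, l)` and `(l, k)` together give the odd part of the expansion. -/
theorem sub_conj_mem {k l j a : ℕ} {Q : Poly n} (hQ : IsType k l Q)
    (hj : k + l + 2 * j = m + 1) (h : ∀ i, a ≤ i → TypeSolvable n m (k + i) (l + i))
    (h₁ : Q * polyW n ^ j ∈ solvable n m) (h₂ : conjP Q * polyW n ^ j ∈ solvable n m) :
    ∑ i ∈ Finset.range a, C (1 - (-1) ^ i) * expTerm Q j i ∈ solvable n m := by
  have e₁ := (solvable n m).sub_mem h₁ (mul_polyW_pow_sub_mem hQ hj h)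
  have e₂ := conjP_mem_solvable ((solvable n m).sub_mem h₂
    (mul_polyW_pow_sub_mem (m := m) (j := j) (a := a) hQ.conjP (by omega) fun i hi => (h i hi).symm))
  rw [sub_sub_cancel] at e₁ e₂
  rw [map_sum] at e₂
  have := (solvable n m).sub_mem e₁ e₂
  rw [← Finset.sum_sub_distrib] at this
  convert this using 2 with i
  rw [conjP_expTerm, C_sub, C_1]
  ring

theorem typeSolvable_one {k : ℕ} (hk : 3 ≤ k) : TypeSolvable n m k 1 :=
  typeSolvable_of_gen (fun _ _ hQ hj => mul_polyW_pow_mem_of_one hQ (by omega) (by omega))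
    fun i hi => typeSolvable_of_le (by omega) (by omega) (by omega)

theorem typeSolvable_zero {k : ℕ} (hk : 2 ≤ k) : TypeSolvable n m k 0 :=
  typeSolvable_of_gen (fun _ _ hQ hj => mul_polyW_pow_mem_of_zero hQ (by omega)) fun i hi => by
    rw [zero_add]
    rcases (show i = 1 ∨ 2 ≤ i by omega) with rfl | h
    · exact typeSolvable_one (by omega)
    · exact typeSolvable_of_le (by omega) (by omega) (by omega)

/-- After the trace-free part is split off, ‖z‖⁴ a uʲ remains with a linear in z. No generator has
bidegree (3, 2), so this term is extracted from expansions starting in bidegrees (1, 0), (0, 1) and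
(2, 1). -/
theorem typeSolvable_three_two : TypeSolvable n m 3 2 := by
  intro Q j hQ hj
  obtain ⟨a, ha, htr⟩ := exists_traceFree_three_two hQ
  have hs2 : IsType 3 2 (nsq n ^ 2 * a) := by simpa using (isType_sq.pow 2).mul ha
  have hN : (Q - nsq n ^ 2 * a) * X .u ^ j ∈ solvable n m :=
    normal_mem_solvable ((hQ.sub hs2).isChernMoserNormal (by omega) (by omega) (by omega)
      (by omega) (fun _ _ => htr) (by omega) j) (hj ▸ (hQ.sub hs2).wt_mul_u j)
  have h1 := sub_conj_mem (m := m) (j := j + 2) (a := 3) ha (by omega)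
    (fun i hi => typeSolvable_of_le (by omega) (by omega) (by omega))
    (mul_polyW_pow_mem_of_zero ha (by omega))
    (mul_polyW_pow_mem_of_one ha.conjP (by omega) (by omega))
  have has : IsType 2 1 (a * nsq n) := ha.mul isType_sq
  -- Among the terms i = 0, 1, 2 of a wʲ⁺² only i = 1 is odd, with coefficient 2(j + 2)i.
  have h2 : a * nsq n * X .u ^ (j + 1) ∈ solvable n m := by
    have hc : (2 * ((j + 2 : ℕ) * Complex.I) : ℂ) ≠ 0 := by
      simp [Complex.I_ne_zero]; norm_cast
    refine smul_cancel_mem hc ?_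
    convert h1 using 1
    simp only [Finset.sum_range_succ, Finset.range_zero, Finset.sum_empty, expTerm, C_mul, C_sub,
      C_pow, C_neg, map_natCast, map_ofNat, C_1, Nat.choose_zero_right, Nat.choose_one_right]
    simp
    ring
  -- The first two terms of a‖z‖² wʲ⁺¹ are a‖z‖² uʲ⁺¹, already solvable, and i(j + 1) a‖z‖⁴ uʲ.
  have h3 : a * nsq n * nsq n * X .u ^ j ∈ solvable n m := by
    have hc : (((j + 1 : ℕ) : ℂ) * Complex.I) ≠ 0 := by
      simp [Complex.I_ne_zero]; norm_cast
    have e := (solvable n m).sub_mem (mul_polyW_pow_mem_of_one (j := j + 1) has (by omega)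
      (by omega)) (mul_polyW_pow_sub_mem (j := j + 1) (a := 2) has (by omega)
      (fun i hi => typeSolvable_of_le (by omega) (by omega) (by omega)))
    refine smul_cancel_mem hc ?_
    convert (solvable n m).sub_mem e h2 using 1
    simp [Finset.sum_range_succ, expTerm]
  convert (solvable n m).add_mem hN h3 using 1
  ring

theorem typeSolvable_two_one : TypeSolvable n m 2 1 :=
  typeSolvable_of_gen (fun _ _ hQ hj => mul_polyW_pow_mem_of_one hQ (by omega) (by omega))
    fun i hi => by
      rcases (show i = 1 ∨ 2 ≤ i by omega) with rfl | h
      · exact typeSolvable_three_two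
      · exact typeSolvable_of_le (by omega) (by omega) (by omega)

theorem typeSolvable_one_zero : TypeSolvable n m 1 0 :=
  typeSolvable_of_gen (fun _ _ hQ hj => mul_polyW_pow_mem_of_zero hQ (by omega))
    fun i hi => by
      rw [zero_add]
      rcases (show i = 1 ∨ i = 2 ∨ 3 ≤ i by omega) with rfl | rfl | h
      · exact typeSolvable_two_one
      · exact typeSolvable_three_two
      · exact typeSolvable_of_le (by omega) (by omega) (by omega)

/-- What remains is ‖z‖² b uʲ with b of type (1, 1): it is the odd term of the expansion of b wʲ⁺¹.
The (3, 3) term has even index and cancels, so the argument does not depend on the later treatment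
of bidegree (3, 3). -/
theorem typeSolvable_two_two : TypeSolvable n m 2 2 := by
  intro Q j hQ hj
  obtain ⟨b, hb, htr⟩ := exists_traceFree_two_two hQ
  have hs : IsType 2 2 (nsq n * b) := isType_sq.mul hb
  have hN : (Q - nsq n * b) * X .u ^ j ∈ solvable n m :=
    normal_mem_solvable ((hQ.sub hs).isChernMoserNormal (by omega) (by omega) (fun _ _ => htr)
      (by omega) (by omega) (by omega) j) (hj ▸ (hQ.sub hs).wt_mul_u j)
  have h1 := sub_conj_mem (m := m) (j := j + 1) (a := 3) hb (by omega)
    (fun i hi => typeSolvable_of_le (by omega) (by omega) (by omega))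
    (mul_polyW_pow_mem_of_one hb (by omega) (by omega))
    (mul_polyW_pow_mem_of_one hb.conjP (by omega) (by omega))
  have h2 : b * nsq n * X .u ^ j ∈ solvable n m := by
    have hc : (2 * ((j + 1 : ℕ) * Complex.I) : ℂ) ≠ 0 := by
      simp [Complex.I_ne_zero]; norm_cast
    refine smul_cancel_mem hc ?_
    convert h1 using 1
    simp only [Finset.sum_range_succ, Finset.range_zero, Finset.sum_empty, expTerm, C_mul, C_sub,
      C_pow, C_neg, map_natCast, map_ofNat, C_1, Nat.choose_zero_right, Nat.choose_one_right]
    simp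
    ring
  convert (solvable n m).add_mem hN h2 using 1
  ring

/-- The remaining term c‖z‖⁶ uʲ appears in two relations: the odd part of c wʲ⁺³, and the expansion
of c‖z‖² wʲ⁺². Both also contain c‖z‖² uʲ⁺², and the second a solvable (2, 2) term. -/
theorem typeSolvable_three_three (hn : 1 ≤ n) : TypeSolvable n m 3 3 := by
  intro Q j hQ hj
  obtain ⟨c, hc, htr⟩ := exists_traceFree_three_three hn hQ
  have hs : IsType 3 3 (nsq n ^ 3 * c) := by simpa using (isType_sq.pow 3).mul hc
  have hN : (Q - nsq n ^ 3 * c) * X .u ^ j ∈ solvable n m :=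
    normal_mem_solvable ((hQ.sub hs).isChernMoserNormal (by omega) (by omega) (by omega)
      (by omega) (by omega) (fun _ _ => htr) j) (hj ▸ (hQ.sub hs).wt_mul_u j)
  have h1 := sub_conj_mem (m := m) (j := j + 3) (a := 4) hc (by omega)
    (fun i hi => typeSolvable_of_le (by omega) (by omega) (by omega))
    (mul_polyW_pow_mem_of_zero hc (by omega))
    (mul_polyW_pow_mem_of_zero hc.conjP (by omega))
  have hcs : IsType 1 1 (c * nsq n) := hc.mul isType_sq
  have hcs2 : IsType 2 2 (c * nsq n * nsq n) := hcs.mul isType_sq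
  have h2 := (solvable n m).sub_mem (mul_polyW_pow_mem_of_one (m := m) (j := j + 2) hcs (by omega)
      (by omega)) (mul_polyW_pow_sub_mem (j := j + 2) (a := 3) hcs (by omega)
      (fun i hi => typeSolvable_of_le (by omega) (by omega) (by omega)))
  have h3 := typeSolvable_two_two (m := m) _ (j + 1) hcs2 (by omega)
  have hch : (j + 3) * (j + 2).choose 2 = 3 * (j + 3).choose 3 := by
    have := Nat.add_one_mul_choose_eq (j + 2) 2
    linarith
  have hpos : 0 < (j + 3).choose 3 := Nat.choose_pos (by omega)
  have h4 : c * nsq n * nsq n * nsq n * X .u ^ j ∈ solvable n m := by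
    have hne : (2 * (2 * (j + 3).choose 3 * Complex.I) : ℂ) ≠ 0 := by
      have : ((j + 3).choose 3 : ℂ) ≠ 0 := Nat.cast_ne_zero.2 hpos.ne'
      simp [Complex.I_ne_zero, this]
    refine smul_cancel_mem hne ?_
    -- The coefficients eliminate c‖z‖² uʲ⁺² and c‖z‖⁴ uʲ⁺¹. By `hch` the two contributions to c‖z‖⁶
    -- uʲ stand in the ratio 3 : 1, hence do not cancel.
    have e := (solvable n m).sub_mem (C_mul_mem (2 * (j + 2 : ℕ) * (j + 3 : ℕ) * Complex.I * Complex.I) h3)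
      ((solvable n m).sub_mem (C_mul_mem (2 * (j + 3 : ℕ) * Complex.I) h2) h1)
    convert e using 1
    have hI : (C Complex.I : Poly n) ^ 2 = -1 := by
      rw [← C_pow, Complex.I_sq, C_neg, C_1]
    have hI3 : (C Complex.I : Poly n) ^ 3 = - C Complex.I := by
      rw [pow_succ, hI]; ring
    have hch' : ((j : Poly n) + 3) * ((j + 2).choose 2 : ℕ) = 3 * ((j + 3).choose 3 : ℕ) := by
      exact_mod_cast congrArg (Nat.cast : ℕ → Poly n) hch
    simp only [Finset.sum_range_succ, Finset.range_zero, Finset.sum_empty, expTerm, C_mul, C_sub,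
      C_pow, C_neg, map_natCast, map_ofNat, C_1, C_add, Nat.choose_zero_right, Nat.choose_one_right,
      sub_sub_cancel, Nat.sub_zero, show j + 2 - 1 = j + 1 by omega, show j + 3 - 1 = j + 2 by omega,
      Nat.add_sub_cancel, Nat.cast_add, Nat.cast_ofNat, Nat.cast_one]
    linear_combination (2 * ((j : Poly n) + 3) * ((j + 2).choose 2 : ℕ) - 2 * ((j + 3).choose 3 : ℕ)) *
      (c * nsq n ^ 3 * X .u ^ j) * hI3 - 2 * C Complex.I * (c * nsq n ^ 3 * X .u ^ j) * hch'
  convert (solvable n m).add_mem hN h4 using 1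
  ring

theorem typeSolvable_one_one (hn : 1 ≤ n) : TypeSolvable n m 1 1 :=
  typeSolvable_of_gen (fun _ _ hQ hj => mul_polyW_pow_mem_of_one hQ (by omega) (by omega))
    fun i hi => by
      rcases (show i = 1 ∨ i = 2 ∨ 3 ≤ i by omega) with rfl | rfl | h
      · exact typeSolvable_two_two
      · exact typeSolvable_three_three hn
      · exact typeSolvable_of_le (by omega) (by omega) (by omega)

theorem typeSolvable_zero_zero (hn : 1 ≤ n) : TypeSolvable n m 0 0 :=
  typeSolvable_of_gen (fun _ _ hQ hj => mul_polyW_pow_mem_of_zero hQ (by omega))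
    fun i hi => by
      rw [zero_add]
      rcases (show i = 1 ∨ i = 2 ∨ i = 3 ∨ 4 ≤ i by omega) with rfl | rfl | rfl | h
      · exact typeSolvable_one_one hn
      · exact typeSolvable_two_two
      · exact typeSolvable_three_three hn
      · exact typeSolvable_of_le (by omega) (by omega) (by omega)

theorem typeSolvable_of_ge (hn : 1 ≤ n) {k l : ℕ} (h : l ≤ k) : TypeSolvable n m k l := by
  rcases (show l = 0 ∨ l = 1 ∨ 2 ≤ l by omega) with rfl | rfl | hl
  · rcases (show k = 0 ∨ k = 1 ∨ 2 ≤ k by omega) with rfl | rfl | hk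
    · exact typeSolvable_zero_zero hn
    · exact typeSolvable_one_zero
    · exact typeSolvable_zero hk
  · rcases (show k = 1 ∨ k = 2 ∨ 3 ≤ k by omega) with rfl | rfl | hk
    · exact typeSolvable_one_one hn
    · exact typeSolvable_two_one
    · exact typeSolvable_one hk
  · rcases (show (k = 2 ∧ l = 2) ∨ (k = 3 ∧ l = 2) ∨ (k = 3 ∧ l = 3) ∨ 4 ≤ k by omega) with
      ⟨rfl, rfl⟩ | ⟨rfl, rfl⟩ | ⟨rfl, rfl⟩ | hk
    · exact typeSolvable_two_two
    · exact typeSolvable_three_two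
    · exact typeSolvable_three_three hn
    · exact typeSolvable_of_le (by omega) hl (by omega)

theorem typeSolvable (hn : 1 ≤ n) (k l : ℕ) : TypeSolvable n m k l := by
  rcases le_total l k with h | h
  · exact typeSolvable_of_ge hn h
  · exact (typeSolvable_of_ge hn h).symm

theorem mem_solvable (hn : 1 ≤ n) {E : Poly n} (hE : IsWeightedHomogeneous wt E (m + 1)) :
    E ∈ solvable n m := by
  classical
  rw [E.as_sum]
  refine Submodule.sum_mem _ fun d hd => ?_
  have hw := hE (mem_support_iff.1 hd)
  rw [weight_wt] at hw
  have h0 (w : Var n → ℕ) : Finsupp.weight w (d.erase Var.u) + d .u * w .u =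
      Finsupp.weight w d := by
    conv_rhs => rw [← Finsupp.erase_add_single Var.u d]
    rw [map_add, Finsupp.weight_single, smul_eq_mul]
  have hz := h0 degZ
  have hzb := h0 degZbar
  have hu := h0 degU
  simp only [degZ, degZbar, mul_zero, add_zero] at hz hzb
  have hU : Finsupp.weight degU d = d .u := by
    simp [Finsupp.weight_eq_sum, sum_var, degU]
  simp only [hU, degU, mul_one, Nat.add_eq_right] at hu
  have : monomial d (coeff d E) = monomial (d.erase .u) (coeff d E) * X .u ^ (d .u) := by
    rw [X_pow_eq_monomial, monomial_mul, Finsupp.erase_add_single, mul_one]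
  rw [this]
  exact typeSolvable hn _ _ _ _ ⟨isWeightedHomogeneous_monomial _ _ _ hz,
    isWeightedHomogeneous_monomial _ _ _ hzb, isWeightedHomogeneous_monomial _ _ _ hu⟩ (by omega)

end FlatGerm

end

/-! ### Real right-hand sides and Taylor expansion by weights -/

noncomputable section

namespace FlatGerm

open MvPolynomial

variable {n m : ℕ}

theorem IsWeightedMap.smul_prod {h : Space n → Space n} (hh : IsWeightedMap m h) (a b : ℂ) :
    IsWeightedMap m (fun y => (a • (h y).1, b * (h y).2)) :=
  ⟨(hh.contDiff.fst.const_smul a).prodMk (contDiff_const.mul hh.contDiff.snd), fun t y => by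
    rw [hh.dilate]
    ext <;> simp <;> ring, fun h2 w => by simp [hh.eq_zero h2]⟩

/-- Solvability of the linearized Chern-Moser equation for real right-hand sides. -/
theorem exists_weightedMap (hn : 1 ≤ n) {E : Poly n} (hE : IsWeightedHomogeneous wt E (m + 1)) :
    ∃ (h : Space n → Space n) (N : Poly n), IsWeightedMap m h ∧ IsChernMoserNormal N ∧
      IsWeightedHomogeneous wt N (m + 1) ∧ (∀ x, (eval (varValue x) N).im = 0) ∧
      ∀ x, (eval (varValue x) E).re = (h (x.1, quadricW x)).2.im -
        2 * (inner ℂ x.1 (h (x.1, quadricW x)).1).re + (eval (varValue x) N).re := by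
  obtain ⟨h, h', N, hh, hh', hN, hN', hEq⟩ := mem_solvable hn hE
  -- With f = -(f₁ + f₂)/2 and g = i(g₁ + g₂), the expression Im g - 2 Re⟨f, z⟩ is the real part of
  -- the sum of the two Chern-Moser operators. Averaging N with its conjugate makes it real without
  -- changing Re N.
  refine ⟨_, ((1 / 2 : ℂ)) • (N + conjP N), (hh.add hh').smul_prod (-(1 / 2)) Complex.I,
    (normalForms n).smul_mem _ ((normalForms n).add_mem hN hN.conjP),
    (weightedHomogeneousSubmodule ℂ wt (m + 1)).smul_mem _
      (hN'.add (wt_comp_swapVar ▸ isWeightedHomogeneous_conjP hN')), fun x => ?_, fun x => ?_⟩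
  · simp [smul_eval, eval_conjP]
  · rw [hEq]
    simp only [cmOp, smul_eval, eval_conjP, map_add, inner_smul_right, inner_add_right,
      Prod.fst_add, Prod.snd_add]
    have := inner_re_symm (𝕜 := ℂ) x.1 (h' (x.1, quadricW x)).1
    simp only [RCLike.re_eq_complex_re] at this
    simp
    linarith

/-- The space `ℂⁿ × ℝ` with coordinates `(z, u)`. -/
abbrev RSpace (n : ℕ) : Type := EuclideanSpace ℂ (Fin n) × ℝ

theorem exists_eval_eq_linear (ℓ : RSpace n →ₗ[ℝ] ℝ) :
    ∃ T : Poly n, ∀ x, (ℓ x : ℂ) = eval (varValue x) T := by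
  classical
  refine ⟨(∑ j, (C (ℓ (EuclideanSpace.single j 1, 0) / 2 : ℂ) * (X (.z j) + X (.zbar j)) +
    C (ℓ (EuclideanSpace.single j Complex.I, 0) / (2 * Complex.I) : ℂ) *
      (X (.z j) - X (.zbar j)))) + C (ℓ (0, 1) : ℂ) * X .u, fun x => ?_⟩
  have hx : x = ∑ j, ((x.1 j).re • ((EuclideanSpace.single j 1, 0) : RSpace n) +
      (x.1 j).im • ((EuclideanSpace.single j Complex.I, 0) : RSpace n)) + x.2 • (0, 1) := by
    ext i
    · simp only [Prod.fst_add, Prod.fst_sum, Prod.smul_fst, smul_zero, add_zero, PiLp.add_apply,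
        WithLp.ofLp_sum, Finset.sum_apply, PiLp.smul_apply, PiLp.single_apply]
      simp [Finset.sum_add_distrib, Complex.re_add_im]
    · simp [Prod.snd_sum]
  conv_lhs => rw [hx]
  simp only [map_add, map_sum, map_smul, smul_eq_mul, map_mul, eval_C, eval_X, map_sub, varValue,
    Complex.ofReal_add, Complex.ofReal_sum, Complex.ofReal_mul, Complex.add_conj, Complex.sub_conj]
  congr 1
  · refine Finset.sum_congr rfl fun j _ => ?_
    field_simp [Complex.I_ne_zero]
    push_cast
    ring
  · ring

/-- Induction on k: expanding one argument in a real basis writes the form on the diagonal as a sum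
of linear forms times forms of degree k. -/
theorem exists_eval_eq_multilinear (k : ℕ) (f : RSpace n [×k]→L[ℝ] ℝ) :
    ∃ T : Poly n, ∀ x, (f (fun _ => x) : ℂ) = eval (varValue x) T := by
  induction k with
  | zero => exact ⟨C (f 0 : ℂ), fun x => by simp [Subsingleton.elim (fun _ => x) (0 : Fin 0 → _)]⟩
  | succ k ih =>
    set b := Module.finBasis ℝ (RSpace n)
    choose T hT using fun i => ih (f.curryLeft (b i))
    choose S hS using fun i => exists_eval_eq_linear (b.coord i)
    refine ⟨∑ i, S i * T i, fun x => ?_⟩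
    have : f (fun _ => x) = f.curryLeft x (fun _ => x) := by
      rw [ContinuousMultilinearMap.curryLeft_apply]
      congr 1
      funext i
      refine Fin.cases ?_ (fun i => ?_) i <;> simp
    rw [this]
    have h2 : f.curryLeft x = ∑ i, b.coord i x • f.curryLeft (b i) := by
      conv_lhs => rw [← b.sum_repr x]
      simp only [map_sum, map_smul, Module.Basis.coord_apply]
    rw [h2]
    simp [← hT, ← hS]

/-- Taylor's theorem in the coordinates `(z, z̄, u)`. -/
theorem exists_taylor {G : RSpace n → ℝ} (m : ℕ) (hG : ContDiffAt ℝ ∞ G 0) :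
    ∃ T : Poly n, (fun x => (G x : ℂ) - eval (varValue x) T) =O[𝓝 0] fun x => ‖x‖ ^ (m + 1) := by
  choose T hT using fun k => exists_eval_eq_multilinear k (iteratedFDeriv ℝ k G 0)
  refine ⟨∑ k ∈ Finset.range (m + 1), C ((k.factorial : ℂ)⁻¹) * T k, ?_⟩
  have hG' : ContDiffAt ℝ (m + 1 : ℕ) G 0 := hG.of_le (by exact_mod_cast le_top)
  have hev := hG'.eventually (by simp)
  have hcont : ContinuousAt (iteratedFDeriv ℝ (m + 1) G) 0 := by
    exact (hG'.iteratedFDeriv_right (m := 0) (i := m + 1) (by simp)).continuousAt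
  obtain ⟨r, hr, hball⟩ := Metric.eventually_nhds_iff_ball.1
    (hev.and (hcont.norm.eventually (gt_mem_nhds (lt_add_one _))))
  set K := ‖iteratedFDeriv ℝ (m + 1) G 0‖ + 1
  refine IsBigO.of_bound ((m.factorial : ℝ)⁻¹ * K) ?_
  filter_upwards [Metric.ball_mem_nhds 0 hr] with x hx
  have hmem : ∀ t ∈ Set.Icc (0 : ℝ) 1, (0 : RSpace n) + t • x ∈ Metric.ball 0 r := fun t ht => by
    rw [zero_add, mem_ball_zero_iff, norm_smul, Real.norm_of_nonneg ht.1]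
    rw [mem_ball_zero_iff] at hx
    nlinarith [norm_nonneg x, ht.2]
  have key := map_add_eq_sum_add_integral_iteratedFDeriv (n := m) (f := G) (x := 0) (y := x)
    (fun t ht => by exact_mod_cast (hball _ (hmem t ht)).1)
  rw [zero_add] at key
  have e : (G x : ℂ) - eval (varValue x) (∑ k ∈ Finset.range (m + 1), C ((k.factorial : ℂ)⁻¹) * T k)
      = (((m.factorial : ℝ)⁻¹ • ∫ t in (0 : ℝ)..1, (1 - t) ^ m •
        iteratedFDeriv ℝ (m + 1) G (0 + t • x) (fun _ => x) : ℝ) : ℂ) := by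
    rw [key]
    simp only [map_sum, map_mul, eval_C, ← hT]
    push_cast
    simp
  rw [e, Complex.norm_real, norm_smul, mul_assoc]
  simp only [norm_inv, RCLike.norm_natCast, norm_pow, norm_norm]
  gcongr
  have hb : ∀ t ∈ Set.uIoc (0 : ℝ) 1, ‖(1 - t) ^ m •
      iteratedFDeriv ℝ (m + 1) G (0 + t • x) (fun _ => x)‖ ≤ K * ‖x‖ ^ (m + 1) := fun t ht => by
    rw [Set.uIoc_of_le zero_le_one] at ht
    have ht' : t ∈ Set.Icc (0 : ℝ) 1 := ⟨ht.1.le, ht.2⟩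
    rw [norm_smul, norm_pow, Real.norm_of_nonneg (by linarith [ht.2])]
    have h1 : (1 - t) ^ m ≤ 1 := pow_le_one₀ (by linarith [ht.2]) (by linarith [ht.1])
    have h2 := (iteratedFDeriv ℝ (m + 1) G (0 + t • x)).le_opNorm (fun _ => x)
    rw [Finset.prod_const, Finset.card_univ, Fintype.card_fin] at h2
    have h3 := (hball _ (hmem t ht')).2.le
    calc _ ≤ 1 * (K * ‖x‖ ^ (m + 1)) := by
          gcongr
          exact h2.trans (by gcongr)
      _ = _ := one_mul _
  simpa using intervalIntegral.norm_integral_le_of_norm_le_const hb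

/-- The weighted dilation `(z, u) ↦ (tz, t²u)`. -/
def dil (t : ℝ) (x : RSpace n) : RSpace n := (t • x.1, t ^ 2 * x.2)

theorem eval_dil {k : ℕ} {P : Poly n} (hP : IsWeightedHomogeneous wt P k) (t : ℝ) (x : RSpace n) :
    eval (varValue (dil t x)) P = (t : ℂ) ^ k * eval (varValue x) P := by
  rw [← eval_pow_weight_mul hP]
  congr 2
  funext v
  cases v <;> simp [varValue, wt, dil]

theorem norm_dil_le {t : ℝ} (ht : 0 ≤ t) (ht1 : t ≤ 1) (x : RSpace n) : ‖dil t x‖ ≤ t * ‖x‖ := by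
  rw [dil, Prod.norm_mk, norm_smul, norm_mul, norm_pow, Real.norm_of_nonneg ht]
  refine max_le ?_ ?_
  · gcongr; exact norm_fst_le x
  · rw [sq, mul_assoc]
    gcongr
    calc _ ≤ 1 * ‖x.2‖ := by gcongr
      _ ≤ _ := by rw [one_mul]; exact norm_snd_le x

theorem tendsto_dil (x : RSpace n) : Tendsto (fun t => dil t x) (𝓝[>] 0) (𝓝 0) := by
  have : Continuous fun t : ℝ => dil t x := by unfold dil; fun_prop
  have h := (this.tendsto 0).mono_left (nhdsWithin_le_nhds (s := Set.Ioi 0))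
  simpa [dil, ← Prod.zero_eq_mk] using h

theorem isBigO_dil (x : RSpace n) : (fun t => ‖dil t x‖) =O[𝓝[>] 0] fun t : ℝ => t := by
  refine IsBigO.of_bound ‖x‖ ?_
  filter_upwards [Ioo_mem_nhdsGT (zero_lt_one' ℝ)] with t ht
  rw [norm_norm, Real.norm_of_nonneg ht.1.le, mul_comm]
  exact norm_dil_le ht.1.le ht.2.le x

theorem isLittleO_pow_nhdsGT {a b : ℕ} (h : a < b) :
    (fun t : ℝ => t ^ b) =o[𝓝[>] 0] fun t => t ^ a :=
  (isLittleO_pow_pow h).mono nhdsWithin_le_nhds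

theorem sum_isLittleO_lead {a : ℕ → ℂ} {M k : ℕ} (hk : k < M) (h : ∀ i < k, a i = 0) :
    (fun t : ℝ => ∑ j ∈ Finset.range M, (t : ℂ) ^ j * a j - (t : ℂ) ^ k * a k)
      =o[𝓝[>] 0] fun t => t ^ k := by
  have : (fun t : ℝ => ∑ j ∈ Finset.range M, (t : ℂ) ^ j * a j - (t : ℂ) ^ k * a k) =
      fun t : ℝ => ∑ j ∈ (Finset.range M).erase k, (t : ℂ) ^ j * a j := by
    funext t
    rw [← Finset.add_sum_erase _ _ (Finset.mem_range.2 hk), add_sub_cancel_left]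
  rw [this]
  refine IsLittleO.fun_sum fun j hj => ?_
  rcases lt_or_gt_of_ne (Finset.ne_of_mem_erase hj) with hlt | hgt
  · simp [h j hlt]
  · refine IsBigO.trans_isLittleO ?_ (isLittleO_pow_nhdsGT hgt)
    refine IsBigO.of_bound ‖a j‖ (Eventually.of_forall fun t => ?_)
    simp [mul_comm]

theorem eq_zero_of_isLittleO {c : ℂ} {k : ℕ}
    (h : (fun t : ℝ => (t : ℂ) ^ k * c) =o[𝓝[>] 0] fun t => t ^ k) : c = 0 := by
  by_contra hc
  have h2 : (fun t : ℝ => t ^ k) =O[𝓝[>] 0] fun t : ℝ => (t : ℂ) ^ k * c := by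
    refine IsBigO.of_bound ‖c‖⁻¹ (Eventually.of_forall fun t => ?_)
    have := norm_pos_iff.2 hc
    simp
    field_simp
    rfl
  have h3 := h2.trans_isLittleO h
  refine isLittleO_irrefl (Eventually.frequently ?_) h3
  filter_upwards [self_mem_nhdsWithin] with t ht
  exact (pow_pos ht k).ne'

/-- The first non-vanishing coefficient would dominate as t → 0; strong induction removes the
coefficients one at a time. -/
theorem coeff_eq_zero_of_isLittleO {a : ℕ → ℂ} {M m : ℕ} (hm : m < M)
    (h : (fun t : ℝ => ∑ j ∈ Finset.range M, (t : ℂ) ^ j * a j) =o[𝓝[>] 0] fun t => t ^ m) :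
    ∀ i ≤ m, a i = 0 := by
  intro i
  induction i using Nat.strong_induction_on with
  | _ i ih =>
    intro hi
    have h1 := sum_isLittleO_lead (a := a) (M := M) (k := i) (by omega)
      fun j hj => ih j hj (by omega)
    have h2 : (fun t : ℝ => ∑ j ∈ Finset.range M, (t : ℂ) ^ j * a j) =o[𝓝[>] 0] fun t => t ^ i := by
      rcases hi.eq_or_lt with rfl | hlt
      · exact h
      · exact h.trans (isLittleO_pow_nhdsGT hlt)
    exact eq_zero_of_isLittleO ((h2.sub h1).congr_left fun t => by ring)

theorem exists_sum_components (T : Poly n) (m : ℕ) : ∃ M, m < M ∧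
    T = ∑ j ∈ Finset.range M, weightedHomogeneousComponent wt j T := by
  classical
  refine ⟨(T.support.sup (Finsupp.weight wt)) + m + 1, by omega, ?_⟩
  ext d
  rw [coeff_sum]
  simp only [coeff_weightedHomogeneousComponent]
  rw [Finset.sum_ite_eq]
  split_ifs with h
  · rfl
  · by_contra hd
    have := Finset.le_sup (f := Finsupp.weight wt) (mem_support_iff.2 hd)
    rw [Finset.mem_range] at h
    omega

theorem isLittleO_remainder {G : RSpace n → ℝ} {T : Poly n} {k : ℕ}
    (hT : (fun x => (G x : ℂ) - eval (varValue x) T) =O[𝓝 0] fun x => ‖x‖ ^ (k + 1))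
    (x : RSpace n) :
    (fun t => (G (dil t x) : ℂ) - eval (varValue (dil t x)) T) =o[𝓝[>] 0] fun t => t ^ k :=
  ((hT.comp_tendsto (tendsto_dil x)).trans ((isBigO_dil x).pow (k + 1))).trans_isLittleO
    (isLittleO_pow_nhdsGT (Nat.lt_succ_self k))

/-- The weight of a monomial is at least its degree, so an ordinary Taylor polynomial of order m + 1
already contains all terms of weight at most m + 1. Smallness along dilations kills the weights up
to m, and E is the component of weight m + 1. -/
theorem exists_leading_part {G : RSpace n → ℝ} (hG : ContDiffAt ℝ ∞ G 0)
    (h : ∀ x, (fun t => G (dil t x)) =o[𝓝[>] 0] fun t => t ^ m) :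
    ∃ E : Poly n, IsWeightedHomogeneous wt E (m + 1) ∧
      ∀ x, (fun t => G (dil t x) - t ^ (m + 1) * (eval (varValue x) E).re)
        =o[𝓝[>] 0] fun t => t ^ (m + 1) := by
  obtain ⟨T, hT⟩ := exists_taylor (m + 1) hG
  obtain ⟨M, hM, hTM⟩ := exists_sum_components T (m + 1)
  refine ⟨weightedHomogeneousComponent wt (m + 1) T,
    weightedHomogeneousComponent_isWeightedHomogeneous _ _, fun x => ?_⟩
  set a : ℕ → ℂ := fun j => eval (varValue x) (weightedHomogeneousComponent wt j T)
  have hev : ∀ t, eval (varValue (dil t x)) T = ∑ j ∈ Finset.range M, (t : ℂ) ^ j * a j := fun t => by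
    conv_lhs => rw [hTM]
    rw [map_sum]
    exact Finset.sum_congr rfl fun j _ =>
      eval_dil (weightedHomogeneousComponent_isWeightedHomogeneous _ _) t x
  have hrem := isLittleO_remainder hT x
  simp only [hev] at hrem
  have hcx : (fun t => (G (dil t x) : ℂ)) =o[𝓝[>] 0] fun t => t ^ m := by
    rw [← isLittleO_norm_left]
    simpa using (h x).norm_left
  have h0 := coeff_eq_zero_of_isLittleO (a := a) (M := M) (m := m) (by omega)
    ((hcx.sub (hrem.trans (isLittleO_pow_nhdsGT (Nat.lt_succ_self m)))).congr_left
      fun t => by ring)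
  have h1 := sum_isLittleO_lead (a := a) (M := M) (k := m + 1) hM fun i hi => h0 i (by omega)
  have h2 := (hrem.add h1)
  have h3 : (fun t : ℝ => ((G (dil t x) : ℂ) - (t : ℂ) ^ (m + 1) * a (m + 1)).re) =o[𝓝[>] 0]
      fun t => t ^ (m + 1) :=
    (IsBigO.of_bound 1 (Eventually.of_forall fun t => by
      rw [one_mul]; exact Complex.abs_re_le_norm _)).trans_isLittleO
      (h2.congr_left fun t => by ring)
  refine h3.congr_left fun t => ?_
  rw [← Complex.ofReal_pow, Complex.sub_re, Complex.re_ofReal_mul, Complex.ofReal_re]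

theorem norm_varValue_le (x : RSpace n) (v : Var n) :
    ‖varValue x v‖ ≤ (‖x.1‖ + √|x.2|) ^ wt v := by
  have h0 : 0 ≤ √|x.2| := Real.sqrt_nonneg _
  cases v with
  | z j => simpa [varValue, wt] using (PiLp.norm_apply_le x.1 j).trans (le_add_of_nonneg_right h0)
  | zbar j =>
    simpa [varValue, wt] using (PiLp.norm_apply_le x.1 j).trans (le_add_of_nonneg_right h0)
  | u =>
    simp only [varValue, wt, Complex.norm_real, Real.norm_eq_abs]
    calc |x.2| = √|x.2| ^ 2 := (Real.sq_sqrt (abs_nonneg _)).symm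
      _ ≤ _ := by gcongr; linarith [norm_nonneg x.1]

theorem norm_eval_le {k : ℕ} {P : Poly n} (hP : IsWeightedHomogeneous wt P k) (x : RSpace n) :
    ‖eval (varValue x) P‖ ≤ (∑ d ∈ P.support, ‖coeff d P‖) * (‖x.1‖ + √|x.2|) ^ k := by
  rw [eval_eq', Finset.sum_mul]
  refine (norm_sum_le _ _).trans (Finset.sum_le_sum fun d hd => ?_)
  rw [norm_mul, norm_prod]
  refine mul_le_mul_of_nonneg_left ?_ (norm_nonneg _)
  rw [← hP (mem_support_iff.1 hd), Finsupp.weight_eq_sum, ← Finset.prod_pow_eq_pow_sum]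
  refine Finset.prod_le_prod (fun i _ => norm_nonneg _) fun i _ => ?_
  rw [norm_pow, smul_eq_mul, mul_comm, pow_mul]
  exact pow_le_pow_left₀ (norm_nonneg _) (norm_varValue_le x i) _

theorem tendsto_weightNorm :
    Tendsto (fun x : RSpace n => ‖x.1‖ + √|x.2|) (𝓝 0) (𝓝 0) := by
  have : Continuous fun x : RSpace n => ‖x.1‖ + √|x.2| := by fun_prop
  simpa using this.tendsto 0

theorem norm_le_weightNorm : ∀ᶠ x : RSpace n in 𝓝 0, ‖x‖ ≤ ‖x.1‖ + √|x.2| := by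
  filter_upwards [Metric.ball_mem_nhds 0 one_pos] with x hx
  rw [mem_ball_zero_iff] at hx
  have h2 : |x.2| ≤ 1 := (norm_snd_le x).trans hx.le
  refine max_le (le_add_of_nonneg_right (Real.sqrt_nonneg _)) ?_
  have h3 : √|x.2| ≤ 1 := Real.sqrt_le_one.2 h2
  have h4 := Real.sq_sqrt (abs_nonneg x.2)
  rw [Real.norm_eq_abs]
  nlinarith [norm_nonneg x.1, Real.sqrt_nonneg |x.2|]

theorem weightNorm_pow_isBigO {a b : ℕ} (h : a ≤ b) :
    (fun x : RSpace n => (‖x.1‖ + √|x.2|) ^ b) =O[𝓝 0] fun x => (‖x.1‖ + √|x.2|) ^ a := by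
  refine IsBigO.of_bound 1 ?_
  filter_upwards [tendsto_weightNorm.eventually (gt_mem_nhds one_pos)] with x hx
  have h0 : 0 ≤ ‖x.1‖ + √|x.2| := by positivity
  rw [one_mul, Real.norm_of_nonneg (pow_nonneg h0 _), Real.norm_of_nonneg (pow_nonneg h0 _)]
  exact pow_le_pow_of_le_one h0 hx.le h

/-- Smallness on each dilation orbit separately, with no uniformity, suffices: for smooth G it
forces the finitely many Taylor components of weight at most m to vanish, and the rest is bounded
uniformly. -/
theorem isBigO_of_dil {G : RSpace n → ℝ} (hG : ContDiffAt ℝ ∞ G 0)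
    (h : ∀ x, (fun t => G (dil t x)) =o[𝓝[>] 0] fun t => t ^ m) :
    G =O[𝓝 0] fun x => (‖x.1‖ + √|x.2|) ^ (m + 1) := by
  obtain ⟨T, hT⟩ := exists_taylor m hG
  obtain ⟨M, hM, hTM⟩ := exists_sum_components T m
  have h0 : ∀ x, ∀ i ≤ m, eval (varValue x) (weightedHomogeneousComponent wt i T) = 0 := by
    intro x
    have hev : ∀ t, eval (varValue (dil t x)) T = ∑ j ∈ Finset.range M, (t : ℂ) ^ j *
        eval (varValue x) (weightedHomogeneousComponent wt j T) := fun t => by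
      conv_lhs => rw [hTM]
      rw [map_sum]
      exact Finset.sum_congr rfl fun j _ =>
        eval_dil (weightedHomogeneousComponent_isWeightedHomogeneous _ _) t x
    have hrem := isLittleO_remainder hT x
    simp only [hev] at hrem
    have hcx : (fun t => (G (dil t x) : ℂ)) =o[𝓝[>] 0] fun t => t ^ m := by
      rw [← isLittleO_norm_left]
      simpa using (h x).norm_left
    exact coeff_eq_zero_of_isLittleO hM ((hcx.sub hrem).congr_left fun t => by ring)
  have h1 : (fun x : RSpace n => eval (varValue x) T) =O[𝓝 0]
      fun x => (‖x.1‖ + √|x.2|) ^ (m + 1) := by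
    rw [hTM]
    simp only [map_sum]
    refine IsBigO.fun_sum fun j _ => ?_
    rcases le_or_gt j m with hj | hj
    · simp only [h0 _ j hj]
      exact isBigO_zero _ _
    · refine IsBigO.trans ?_ (weightNorm_pow_isBigO (show m + 1 ≤ j by omega))
      refine IsBigO.of_bound (∑ d ∈ (weightedHomogeneousComponent wt j T).support,
        ‖coeff d (weightedHomogeneousComponent wt j T)‖) (Eventually.of_forall fun x =>
        (norm_eval_le (weightedHomogeneousComponent_isWeightedHomogeneous j T) x).trans_eq ?_)
      rw [Real.norm_of_nonneg (by positivity)]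
  have h2 : (fun x : RSpace n => ‖x‖ ^ (m + 1)) =O[𝓝 0]
      fun x => (‖x.1‖ + √|x.2|) ^ (m + 1) := by
    refine IsBigO.pow (IsBigO.of_bound 1 ?_) _
    filter_upwards [norm_le_weightNorm] with x hx
    rw [one_mul, norm_norm, Real.norm_of_nonneg (by positivity)]
    exact hx
  have h3 : (fun x => (G x : ℂ)) =O[𝓝 0] fun x => (‖x.1‖ + √|x.2|) ^ (m + 1) :=
    ((hT.trans h2).add h1).congr_left fun x => by ring
  rw [← isBigO_norm_left] at h3 ⊢
  simpa using h3

end FlatGerm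

end

/-! ### Chern-Moser normalization weight by weight -/

noncomputable section

namespace FlatGerm

open MvPolynomial

section Increment

variable {E : Type*} [NormedAddCommGroup E] [NormedSpace ℝ E]

/-- Removing the second-order Taylor part from ρ leaves a function R with R'(y) = o(‖y‖). The bound
is the mean value inequality for R on the ball of radius max(‖a‖, ‖b‖). -/
theorem norm_sub_quadratic_le {ρ : E → ℝ} (hρ : ContDiffAt ℝ ∞ ρ 0) {ε : ℝ} (hε : 0 < ε) :
    ∃ r > 0, ∀ a b : E, ‖a‖ < r → ‖b‖ < r →
      ‖(ρ a - ρ b - fderiv ℝ ρ 0 (a - b) - fderiv ℝ (fderiv ℝ ρ) 0 b (a - b)) -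
        (1 / 2) * fderiv ℝ (fderiv ℝ ρ) 0 (a - b) (a - b)‖ ≤ ε * max ‖a‖ ‖b‖ * ‖a - b‖ := by
  set A := fderiv ℝ ρ 0
  set B := fderiv ℝ (fderiv ℝ ρ) 0
  have hsymm : ∀ v w, B v w = B w v := fun v w =>
    (hρ.isSymmSndFDerivAt (by simp; exact WithTop.coe_le_coe.2 (le_top : (2 : ℕ∞) ≤ ⊤))).eq v w
  have hdiff : ∀ᶠ y in 𝓝 (0 : E), DifferentiableAt ℝ ρ y :=
    ((hρ.of_le (m := 1) (by simp)).eventually (by simp)).mono fun y hy =>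
      hy.differentiableAt (by simp)
  have hB : HasFDerivAt (fderiv ℝ ρ) B 0 :=
    ((hρ.fderiv_right (m := 1) (by norm_cast)).differentiableAt (by simp)).hasFDerivAt
  have ho := (hasFDerivAt_iff_isLittleO_nhds_zero.1 hB).def hε
  obtain ⟨r, hr, hball⟩ := Metric.eventually_nhds_iff_ball.1 (hdiff.and ho)
  refine ⟨r, hr, fun a b ha hb => ?_⟩
  set R : E → ℝ := fun y => ρ y - A y - (1 / 2) * B y y
  have hR : ∀ y ∈ Metric.ball (0 : E) r, HasFDerivAt R (fderiv ℝ ρ y - A - B y) y := fun y hy => by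
    have h1 := ((hball y hy).1.hasFDerivAt.sub A.hasFDerivAt).sub
      ((B.hasFDerivAt.clm_apply (hasFDerivAt_id y)).const_mul (1 / 2 : ℝ))
    refine h1.congr_fderiv ?_
    ext v
    simp [hsymm v y]
    ring
  have hconv : Convex ℝ (Metric.closedBall (0 : E) (max ‖a‖ ‖b‖)) := convex_closedBall _ _
  have hsub : Metric.closedBall (0 : E) (max ‖a‖ ‖b‖) ⊆ Metric.ball 0 r :=
    Metric.closedBall_subset_ball (max_lt ha hb)
  have key := hconv.norm_image_sub_le_of_norm_hasFDerivWithin_le (C := ε * max ‖a‖ ‖b‖) (x := b)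
    (y := a) (fun y hy => (hR y (hsub hy)).hasFDerivWithinAt) (fun y hy => ?_)
    (by simp) (by simp)
  · have e : (ρ a - ρ b - A (a - b) - B b (a - b)) - (1 / 2) * B (a - b) (a - b) = R a - R b := by
      simp only [R, map_sub, sub_apply]
      rw [hsymm a b]
      ring
    rw [e]
    exact key
  · have h2 := (hball y (hsub hy)).2
    rw [zero_add] at h2
    rw [mem_closedBall_zero_iff] at hy
    exact h2.trans (by gcongr)

theorem isLittleO_increment {ρ : E → ℝ} (hρ : ContDiffAt ℝ ∞ ρ 0) {a b : ℝ → E} {m : ℕ}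
    (ha : a =O[𝓝[>] 0] fun t => t) (hb : b =O[𝓝[>] 0] fun t => t)
    (hab : (fun t => a t - b t) =O[𝓝[>] 0] fun t => t ^ m) :
    (fun t => (ρ (a t) - ρ (b t) - fderiv ℝ ρ 0 (a t - b t) -
      fderiv ℝ (fderiv ℝ ρ) 0 (b t) (a t - b t)) -
        (1 / 2) * fderiv ℝ (fderiv ℝ ρ) 0 (a t - b t) (a t - b t)) =o[𝓝[>] 0]
      fun t => t ^ (m + 1) := by
  have h1 : (fun t => max ‖a t‖ ‖b t‖ * ‖a t - b t‖) =O[𝓝[>] 0] fun t => t ^ (m + 1) := by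
    have hm : (fun t => max ‖a t‖ ‖b t‖) =O[𝓝[>] 0] fun t : ℝ => t := by
      refine IsBigO.trans (g := fun t => ‖a t‖ + ‖b t‖) ?_ (ha.norm_left.add hb.norm_left)
      refine IsBigO.of_bound 1 (Eventually.of_forall fun t => ?_)
      rw [one_mul, Real.norm_of_nonneg (by positivity), Real.norm_of_nonneg (by positivity)]
      exact max_le (by simp) (by simp)
    exact (hm.mul hab.norm_left).congr_right fun t => by ring
  have hid : Tendsto (fun t : ℝ => t) (𝓝[>] 0) (𝓝 0) := nhdsWithin_le_nhds
  have ha0 : Tendsto (fun t => ‖a t‖) (𝓝[>] 0) (𝓝 0) := (ha.trans_tendsto hid).norm.trans (by simp)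
  have hb0 : Tendsto (fun t => ‖b t‖) (𝓝[>] 0) (𝓝 0) := (hb.trans_tendsto hid).norm.trans (by simp)
  refine IsLittleO.trans_isBigO ?_ h1
  rw [isLittleO_iff]
  intro ε hε
  obtain ⟨r, hr, h⟩ := norm_sub_quadratic_le hρ hε
  filter_upwards [ha0.eventually (gt_mem_nhds hr), hb0.eventually (gt_mem_nhds hr)] with t h1 h2
  refine (h _ _ h1 h2).trans_eq ?_
  rw [norm_mul, norm_norm, Real.norm_of_nonneg (by positivity : 0 ≤ max ‖a t‖ ‖b t‖), mul_assoc]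

end Increment

variable {n m : ℕ}

/-- A function of the form `-Im w + ‖z‖² + O(|w| |(z, w)|) + O(|(z, w)|³)`. -/
structure IsModelFunction (ρ : Space n → ℝ) : Prop where
  contDiffAt : ∀ᶠ y in 𝓝 0, ContDiffAt ℝ ∞ ρ y
  zero : ρ 0 = 0
  fderiv : ∀ v, fderiv ℝ ρ 0 v = -v.2.im
  hess : ∀ z, _root_.fderiv ℝ (_root_.fderiv ℝ ρ) 0 (z, 0) (z, 0) = 2 * ‖z‖ ^ 2

/-- Polarization of `hess`. -/
theorem IsModelFunction.hess_inner {ρ : Space n → ℝ} (hρ : IsModelFunction ρ)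
    (z v : EuclideanSpace ℂ (Fin n)) :
    _root_.fderiv ℝ (_root_.fderiv ℝ ρ) 0 (z, 0) (v, 0) = 2 * (inner ℂ z v).re := by
  have hsymm := (hρ.contDiffAt.self_of_nhds.isSymmSndFDerivAt (by simp; exact WithTop.coe_le_coe.2 (le_top : (2 : ℕ∞) ≤ ⊤))).eq (v, 0) (z, 0)
  have h1 := hρ.hess (z + v)
  have h2 := norm_add_sq (𝕜 := ℂ) z v
  rw [show ((z + v, 0) : Space n) = (z, 0) + (v, 0) by simp] at h1
  simp only [map_add, add_apply, hρ.hess, hsymm] at h1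
  rw [h2] at h1
  simp only [RCLike.re_eq_complex_re] at h1
  linarith

/-- The points of the model hypersurface `Im w = ‖z‖² + Re P`. -/
def graphPt (P : Poly n) (x : RSpace n) : Space n :=
  (x.1, x.2 + Complex.I * ((‖x.1‖ ^ 2 + (eval (varValue x) P).re : ℝ) : ℂ))

theorem contDiff_varValue {k : WithTop ℕ∞} (v : Var n) :
    ContDiff ℝ k fun x : RSpace n => varValue x v := by
  have hz (j : Fin n) : ContDiff ℝ k fun x : RSpace n => x.1 j :=
    ((EuclideanSpace.proj (𝕜 := ℂ) j).restrictScalars ℝ).contDiff.comp contDiff_fst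
  cases v with
  | z j => exact hz j
  | zbar j => exact Complex.conjCLE.contDiff.comp (hz j)
  | u => exact Complex.ofRealCLM.contDiff.comp contDiff_snd

theorem contDiff_graphPt {k : WithTop ℕ∞} (P : Poly n) : ContDiff ℝ k (graphPt P) := by
  refine contDiff_fst.prodMk ((Complex.ofRealCLM.contDiff.comp contDiff_snd).add
    (contDiff_const.mul (Complex.ofRealCLM.contDiff.comp ?_)))
  exact ((contDiff_norm_sq ℝ).comp contDiff_fst).add
    (Complex.reCLM.contDiff.comp (contDiff_eval contDiff_varValue P))

theorem norm_eval_le_of_weight {w : Var n → ℕ} {k : ℕ} {P : Poly n}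
    (hP : ∀ d ∈ P.support, k ≤ Finsupp.weight w d) {x : Var n → ℂ} {r : ℝ} (hr : 0 ≤ r)
    (hr1 : r ≤ 1) (hx : ∀ v, ‖x v‖ ≤ r ^ w v) :
    ‖eval x P‖ ≤ (∑ d ∈ P.support, ‖coeff d P‖) * r ^ k := by
  rw [eval_eq', Finset.sum_mul]
  refine (norm_sum_le _ _).trans (Finset.sum_le_sum fun d hd => ?_)
  rw [norm_mul, norm_prod]
  refine mul_le_mul_of_nonneg_left ?_ (norm_nonneg _)
  refine le_trans ?_ (pow_le_pow_of_le_one hr hr1 (hP d hd))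
  rw [Finsupp.weight_eq_sum, ← Finset.prod_pow_eq_pow_sum]
  refine Finset.prod_le_prod (fun i _ => norm_nonneg _) fun i _ => ?_
  rw [norm_pow, smul_eq_mul, mul_comm, pow_mul]
  exact pow_le_pow_left₀ (norm_nonneg _) (hx i) _

theorem IsChernMoserNormal.isBigO {P : Poly n} (hP : IsChernMoserNormal P) :
    (fun x : RSpace n => eval (varValue x) P) =O[𝓝 0] fun x => ‖x.1‖ ^ 4 := by
  refine IsBigO.of_bound (∑ d ∈ P.support, ‖coeff d P‖) ?_
  filter_upwards [Metric.ball_mem_nhds 0 one_pos] with x hx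
  rw [mem_ball_zero_iff] at hx
  rw [Real.norm_of_nonneg (by positivity)]
  refine norm_eval_le_of_weight (w := fun v => degZ v + degZbar v) (fun d hd => ?_) (norm_nonneg _)
    ((norm_fst_le x).trans hx.le) fun v => ?_
  · have h := hP.divisible d hd
    have : Finsupp.weight (fun v => degZ v + degZbar v) d =
        Finsupp.weight degZ d + Finsupp.weight degZbar d := by
      simp [Finsupp.weight_eq_sum, mul_add, Finset.sum_add_distrib]
    omega
  · cases v with
    | z j => simpa [varValue, degZ, degZbar] using PiLp.norm_apply_le x.1 j
    | zbar j => simpa [varValue, degZ, degZbar] using PiLp.norm_apply_le x.1 j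
    | u => simpa [varValue, degZ, degZbar] using (norm_snd_le x).trans hx.le

theorem IsChernMoserNormal.graphPt_zero {P : Poly n} (hP : IsChernMoserNormal P) :
    graphPt P 0 = 0 := by
  obtain ⟨c, hc⟩ := hP.isBigO.bound
  have h0 := hc.self_of_nhds
  have h1 : eval (varValue 0) P = 0 := by simpa using h0
  simp [graphPt, h1, Prod.mk_zero_zero]

theorem IsChernMoserNormal.isLittleO_dil {P : Poly n} (hP : IsChernMoserNormal P) (x : RSpace n) :
    (fun t => eval (varValue (dil t x)) P) =o[𝓝[>] 0] fun t => t ^ 2 := by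
  have h1 : (fun t => ‖(dil t x).1‖) =O[𝓝[>] 0] fun t : ℝ => t :=
    (IsBigO.of_bound 1 (Eventually.of_forall fun t => by
      rw [one_mul, norm_norm, norm_norm]; exact norm_fst_le (dil t x))).trans (isBigO_dil x)
  exact ((hP.isBigO.comp_tendsto (tendsto_dil x)).trans (h1.pow 4)).trans_isLittleO
    (isLittleO_pow_nhdsGT (by norm_num))

/-- The behaviour of `w / t²` at the dilated point of the model hypersurface. -/
theorem exists_graphPt_dil {P : Poly n} (hP : IsChernMoserNormal P) (x : RSpace n) :
    ∃ q : ℝ → ℂ, Tendsto q (𝓝[>] 0) (𝓝 (quadricW x)) ∧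
      ∀ᶠ t in 𝓝[>] 0, graphPt P (dil t x) = ((t : ℂ) • x.1, (t : ℂ) ^ 2 * q t) := by
  refine ⟨fun t => quadricW x + Complex.I * ((eval (varValue (dil t x)) P).re / t ^ 2 : ℝ), ?_, ?_⟩
  · have h : (fun t => (eval (varValue (dil t x)) P).re) =o[𝓝[>] 0] fun t => t ^ 2 :=
      (IsBigO.of_bound 1 (Eventually.of_forall fun t => by
        rw [one_mul]; exact Complex.abs_re_le_norm _)).trans_isLittleO (hP.isLittleO_dil x)
    have h2 := (Complex.continuous_ofReal.tendsto 0).comp h.tendsto_div_nhds_zero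
    simpa using (h2.const_mul Complex.I).const_add (quadricW x)
  · filter_upwards [self_mem_nhdsWithin] with t ht
    have ht0 : (t : ℂ) ≠ 0 := Complex.ofReal_ne_zero.2 (ne_of_gt ht)
    ext
    · simp [graphPt, dil]
    · simp only [graphPt, dil, quadricW, norm_smul, mul_pow, Real.norm_eq_abs, sq_abs]
      push_cast
      field_simp
      ring

theorem IsWeightedMap.map_zero {h : Space n → Space n} (hh : IsWeightedMap m h) (hm : 2 ≤ m) :
    h 0 = 0 := by
  have := hh.dilate 0 0
  simpa [show m ≠ 0 by omega, Prod.mk_zero_zero] using this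

/-- Test the derivative along (tz, 0), of order t, and (0, t²w), of order t². Homogeneity makes h
smaller than the curve in every case except f(0, t²w) for m = 2, which is why `eq_zero` is part of
`IsWeightedMap`. -/
theorem IsWeightedMap.hasFDerivAt {h : Space n → Space n} (hh : IsWeightedMap m h) (hm : 2 ≤ m) :
    HasFDerivAt h (0 : Space n →L[ℂ] Space n) 0 := by
  have hd : HasFDerivAt h (fderiv ℂ h 0) 0 :=
    (hh.contDiff.differentiable (by simp) 0).hasFDerivAt
  suffices fderiv ℂ h 0 = 0 by rwa [this] at hd
  set L := fderiv ℂ h 0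
  have ho := hasFDerivAt_iff_isLittleO_nhds_zero.1 hd
  simp only [zero_add, hh.map_zero hm, sub_zero] at ho
  -- along a curve `c(t)` of order `k`
  have key : ∀ (y : Space n) (k : ℕ) (c : ℝ → Space n), k ≠ 0 → (∀ t, c t = (t : ℂ) ^ k • y) →
      (fun t => h (c t)) =o[𝓝[>] 0] (fun t => t ^ k) → L y = 0 := by
    intro y k c hk hc hlo
    have hct : Tendsto c (𝓝[>] 0) (𝓝 0) := by
      have : Continuous fun t : ℝ => (t : ℂ) ^ k • y := by fun_prop
      have h2 := (this.tendsto 0).mono_left (nhdsWithin_le_nhds (s := Set.Ioi 0))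
      rw [funext hc]
      simpa [hk] using h2
    have hcO : c =O[𝓝[>] 0] fun t => t ^ k := by
      refine IsBigO.of_bound ‖y‖ (Eventually.of_forall fun t => ?_)
      rw [hc, norm_smul, mul_comm]
      simp
    have h1 := hlo.sub ((ho.comp_tendsto hct).trans_isBigO hcO)
    have h2 : (fun t : ℝ => (t : ℂ) ^ k * (‖L y‖ : ℂ)) =o[𝓝[>] 0] fun t => t ^ k := by
      rw [← isLittleO_norm_left] at h1 ⊢
      refine h1.congr_left fun t => ?_
      simp [hc, norm_smul]
    exact norm_eq_zero.1 (Complex.ofReal_eq_zero.1 (eq_zero_of_isLittleO h2))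
  have hpow : ∀ {a b : ℕ} (v : EuclideanSpace ℂ (Fin n)), a < b →
      (fun t : ℝ => (t : ℂ) ^ b • v) =o[𝓝[>] 0] fun t => t ^ a := fun v hab =>
    IsBigO.trans_isLittleO (IsBigO.of_bound ‖v‖ (Eventually.of_forall fun t => by
      rw [norm_smul, mul_comm]; simp)) (isLittleO_pow_nhdsGT hab)
  have hpow' : ∀ {a b : ℕ} (v : ℂ), a < b →
      (fun t : ℝ => (t : ℂ) ^ b * v) =o[𝓝[>] 0] fun t => t ^ a := fun v hab =>
    IsBigO.trans_isLittleO (IsBigO.of_bound ‖v‖ (Eventually.of_forall fun t => by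
      rw [norm_mul, mul_comm]; simp)) (isLittleO_pow_nhdsGT hab)
  have hz : ∀ z, L (z, 0) = 0 := fun z => by
    refine key (z, 0) 1 (fun t => ((t : ℂ) • z, 0)) one_ne_zero (fun t => by simp) ?_
    have e : ∀ t : ℝ, h ((t : ℂ) • z, 0) =
        ((t : ℂ) ^ m • (h (z, 0)).1, (t : ℂ) ^ (m + 1) * (h (z, 0)).2) := fun t => by
      rw [← hh.dilate]; simp
    simp only [e]
    exact (hpow _ (by omega)).prod_left (hpow' _ (by omega))
  have hw : ∀ w, L (0, w) = 0 := fun w => by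
    refine key (0, w) 2 (fun t => (0, (t : ℂ) ^ 2 * w)) two_ne_zero (fun t => by simp) ?_
    have e : ∀ t : ℝ, h (0, (t : ℂ) ^ 2 * w) =
        ((t : ℂ) ^ m • (h (0, w)).1, (t : ℂ) ^ (m + 1) * (h (0, w)).2) := fun t => by
      rw [← hh.dilate]; simp
    simp only [e]
    refine IsLittleO.prod_left ?_ (hpow' _ (by omega))
    rcases hm.eq_or_lt with rfl | hm
    · simp [hh.eq_zero rfl]
    · exact hpow _ hm
  ext1
  · ext1 z; simp [hz]
  · ext1; simp [hw]

section Asymptotic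

variable {E F G : Type*} [NormedAddCommGroup E] [NormedSpace ℝ E] [NormedAddCommGroup F]
  [NormedSpace ℝ F] [NormedAddCommGroup G] [NormedSpace ℝ G] {l : Filter ℝ} {a b : ℕ}
  {u : ℝ → E} {v : ℝ → F}

theorem isBigO_bilinear (B : E →L[ℝ] F →L[ℝ] G) : (fun t => B (u t) (v t)) =O[l]
    fun t => ‖u t‖ * ‖v t‖ :=
  IsBigO.of_bound ‖B‖ (Eventually.of_forall fun t => by
    rw [norm_mul, norm_norm, norm_norm, ← mul_assoc]
    exact B.le_opNorm₂ _ _)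

theorem isLittleO_bilinear_left (B : E →L[ℝ] F →L[ℝ] G) (hu : u =o[l] fun t => t ^ a)
    (hv : v =O[l] fun t => t ^ b) : (fun t => B (u t) (v t)) =o[l] fun t => t ^ (a + b) :=
  (isBigO_bilinear B).trans_isLittleO
    ((hu.norm_left.mul_isBigO hv.norm_left).congr_right fun t => by ring)

theorem isLittleO_bilinear_right (B : E →L[ℝ] F →L[ℝ] G) (hu : u =O[l] fun t => t ^ a)
    (hv : v =o[l] fun t => t ^ b) : (fun t => B (u t) (v t)) =o[l] fun t => t ^ (a + b) :=
  (isBigO_bilinear B).trans_isLittleO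
    ((hu.norm_left.mul_isLittleO hv.norm_left).congr_right fun t => by ring)

end Asymptotic

theorem isBigO_pow_smul {E : Type*} [NormedAddCommGroup E] [NormedSpace ℂ E] {l : Filter ℝ} (a : ℕ) (e : E) :
    (fun t : ℝ => (t : ℂ) ^ a • e) =O[l] fun t => t ^ a :=
  IsBigO.of_bound ‖e‖ (Eventually.of_forall fun t => by rw [norm_smul, mul_comm]; simp)

theorem isLittleO_pow_smul_sub {E : Type*} [NormedAddCommGroup E] [NormedSpace ℂ E] {l : Filter ℝ} (a : ℕ) {q : ℝ → E} {e : E}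
    (hq : Tendsto q l (𝓝 e)) :
    (fun t : ℝ => (t : ℂ) ^ a • q t - (t : ℂ) ^ a • e) =o[l] fun t => t ^ a := by
  have h1 : (fun t : ℝ => (t : ℂ) ^ a) =O[l] fun t => t ^ a :=
    IsBigO.of_bound 1 (Eventually.of_forall fun t => by simp)
  have h2 : (fun t => q t - e) =o[l] fun _ => (1 : ℝ) :=
    (isLittleO_one_iff ℝ).2 (by simpa using hq.sub_const e)
  exact ((h1.smul_isLittleO h2).congr_left fun t => smul_sub _ _ _).congr_right fun t => by simp

theorem graphPt_dil_sub_isLittleO {P : Poly n} (hP : IsChernMoserNormal P) (x : RSpace n) :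
    (fun t => graphPt P (dil t x) - ((t : ℂ) • x.1, 0)) =o[𝓝[>] 0] fun t : ℝ => t ^ 1 := by
  obtain ⟨q, hq, hqe⟩ := exists_graphPt_dil hP x
  have h1 : (fun t : ℝ => (t : ℂ) ^ 2 • q t) =O[𝓝[>] 0] fun t => t ^ 2 :=
    (((isLittleO_pow_smul_sub 2 hq).isBigO).add (isBigO_pow_smul 2 (quadricW x))).congr_left
      fun t => by ring
  have h2 : (fun t : ℝ => (((0 : EuclideanSpace ℂ (Fin n)), (t : ℂ) ^ 2 * q t) : Space n))
      =o[𝓝[>] 0] fun t => t ^ 1 :=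
    (isLittleO_zero _ _).prod_left (h1.trans_isLittleO (isLittleO_pow_nhdsGT one_lt_two))
  refine h2.congr' ?_ EventuallyEq.rfl
  filter_upwards [hqe] with t ht
  rw [ht]
  simp

theorem isBigO_of_sub_isLittleO {u : ℝ → Space n} {z : EuclideanSpace ℂ (Fin n)}
    (h : (fun t => u t - ((t : ℂ) • z, 0)) =o[𝓝[>] 0] fun t : ℝ => t ^ 1) :
    u =O[𝓝[>] 0] fun t : ℝ => t := by
  have h1 : (fun t : ℝ => (t : ℂ) ^ 1 • ((z, 0) : Space n)) =O[𝓝[>] 0] fun t => t ^ 1 :=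
    isBigO_pow_smul 1 _
  exact ((h.isBigO.add h1).congr_left fun t => by simp).congr_right fun t => pow_one t

theorem map_graphPt_dil_sub_isLittleO {P : Poly n} (hP : IsChernMoserNormal P) {H : Space n → Space n}
    (hH0 : H 0 = 0) (hH1 : HasFDerivAt H (ContinuousLinearMap.id ℂ (Space n)) 0) (x : RSpace n) :
    (fun t => H (graphPt P (dil t x)) - ((t : ℂ) • x.1, 0)) =o[𝓝[>] 0] fun t : ℝ => t ^ 1 := by
  have h1 := graphPt_dil_sub_isLittleO hP x
  have hO := isBigO_of_sub_isLittleO h1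
  have ht : Tendsto (fun t => graphPt P (dil t x)) (𝓝[>] 0) (𝓝 0) :=
    hO.trans_tendsto nhdsWithin_le_nhds
  have h2 := hasFDerivAt_iff_isLittleO_nhds_zero.1 hH1
  simp only [zero_add, hH0, sub_zero, ContinuousLinearMap.id_apply] at h2
  have h3 := (h2.comp_tendsto ht).trans_isBigO hO
  simp only [Function.comp_def] at h3
  simp only [pow_one] at h1 ⊢
  exact (h3.add h1).congr_left fun t => by abel

/-- One step of the Chern-Moser normalization: the defining function vanishes to one more weight
after a change of the coordinates and of the model hypersurface. -/
theorem exists_improvement (hn : 1 ≤ n) (hm : 2 ≤ m) {ρ : Space n → ℝ} (hρ : IsModelFunction ρ)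
    {H : Space n → Space n} (hH : ContDiff ℂ ∞ H) (hH0 : H 0 = 0)
    (hH1 : HasFDerivAt H (ContinuousLinearMap.id ℂ (Space n)) 0) {P : Poly n}
    (hP : IsChernMoserNormal P) (hPre : ∀ x, (eval (varValue x) P).im = 0)
    (h : ∀ x, (fun t => ρ (H (graphPt P (dil t x)))) =o[𝓝[>] 0] fun t => t ^ m) :
    ∃ (H' : Space n → Space n) (P' : Poly n), ContDiff ℂ ∞ H' ∧ H' 0 = 0 ∧
      HasFDerivAt H' (ContinuousLinearMap.id ℂ (Space n)) 0 ∧ IsChernMoserNormal P' ∧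
      (∀ x, (eval (varValue x) P').im = 0) ∧
      ∀ x, (fun t => ρ (H' (graphPt P' (dil t x)))) =o[𝓝[>] 0] fun t => t ^ (m + 1) := by
  have hg0 := hP.graphPt_zero
  have hG : ContDiffAt ℝ ∞ (fun x => ρ (H (graphPt P x))) 0 := by
    have h1 : ContDiffAt ℝ ∞ ρ (H (graphPt P 0)) := by
      rw [hg0, hH0]; exact hρ.contDiffAt.self_of_nhds
    exact h1.comp 0 ((hH.restrict_scalars ℝ).comp (contDiff_graphPt P)).contDiffAt
  obtain ⟨E, hE, hEG⟩ := exists_leading_part hG h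
  -- The error E of weight m + 1 is absorbed in two ways: f corrects the coordinate change, and N is
  -- added to the model hypersurface.
  obtain ⟨f, N, hf, hN, hNw, hNre, hsol⟩ := exists_weightedMap hn hE
  refine ⟨fun y => H y + f y, P + N, hH.add hf.contDiff, by simp [hH0, hf.map_zero hm],
    (hH1.add (hf.hasFDerivAt hm)).congr_fderiv (add_zero _), (normalForms n).add_mem hP hN,
    fun x => by simp [hPre, hNre], fun x => ?_⟩
  have hPN : IsChernMoserNormal (P + N) := (normalForms n).add_mem hP hN
  obtain ⟨q, hq, hqe⟩ := exists_graphPt_dil hPN x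
  set z := x.1
  set f₀ := (f (z, quadricW x)).1
  set g₀ := (f (z, quadricW x)).2
  set ν := (eval (varValue x) N).re
  set γ := fun t => graphPt P (dil t x)
  set γ' := fun t => graphPt (P + N) (dil t x)
  set b := fun t => H (γ t)
  set a := fun t => H (γ' t) + f (γ' t)
  have hγO : γ =O[𝓝[>] 0] fun t : ℝ => t :=
    isBigO_of_sub_isLittleO (graphPt_dil_sub_isLittleO hP x)
  have hγO' : γ' =O[𝓝[>] 0] fun t : ℝ => t :=
    isBigO_of_sub_isLittleO (graphPt_dil_sub_isLittleO hPN x)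
  have hb := map_graphPt_dil_sub_isLittleO hP hH0 hH1 x
  have hbO : b =O[𝓝[>] 0] fun t : ℝ => t := isBigO_of_sub_isLittleO hb
  have hdiff : ∀ t, γ' t - γ t = (t : ℂ) ^ (m + 1) • ((0, Complex.I * (ν : ℂ)) : Space n) :=
    fun t => by
      ext
      · simp [γ, γ', graphPt]
      · have := congrArg Complex.re (eval_dil hNw t x)
        rw [← Complex.ofReal_pow, Complex.re_ofReal_mul] at this
        simp only [γ, γ', graphPt, Prod.snd_sub, Prod.smul_snd, map_add, Complex.add_re, this, ν]
        push_cast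
        simp
        ring
  -- The two model points differ by t^(m+1)(0, iν). Since dH = id at the origin, strict
  -- differentiability shows that H preserves this difference up to o(t^(m+1)).
  have hstrict : (fun t => H (γ' t) - H (γ t) - (γ' t - γ t)) =o[𝓝[>] 0] fun t => t ^ (m + 1) := by
    have h1 := (hH.contDiffAt.hasStrictFDerivAt' hH1 (by simp)).isLittleO
    have h2 : Tendsto (fun t => (γ' t, γ t)) (𝓝[>] 0) (𝓝 (0, 0)) :=
      (hγO'.trans_tendsto nhdsWithin_le_nhds).prodMk_nhds (hγO.trans_tendsto nhdsWithin_le_nhds)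
    have h3 := h1.comp_tendsto h2
    refine h3.trans_isBigO ?_
    simp only [Function.comp_def, hdiff]
    exact isBigO_pow_smul _ _
  have hfq : Tendsto (fun t => f (z, q t)) (𝓝[>] 0) (𝓝 (f (z, quadricW x))) :=
    (hf.contDiff.continuous.tendsto _).comp (tendsto_const_nhds.prodMk_nhds hq)
  have hf1 : (fun t => (f (γ' t)).1 - (t : ℂ) ^ m • f₀) =o[𝓝[>] 0] fun t => t ^ m := by
    refine (isLittleO_pow_smul_sub m ((continuous_fst.tendsto _).comp hfq)).congr' ?_
      EventuallyEq.rfl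
    filter_upwards [hqe] with t ht
    have := hf.dilate t (z, q t)
    simp only at this
    simp only [γ', ht, this, Function.comp_def, f₀]
  have hf2 : (fun t => (f (γ' t)).2 - (t : ℂ) ^ (m + 1) • g₀) =o[𝓝[>] 0] fun t => t ^ (m + 1) := by
    refine (isLittleO_pow_smul_sub (m + 1) ((continuous_snd.tendsto _).comp hfq)).congr' ?_
      EventuallyEq.rfl
    filter_upwards [hqe] with t ht
    have := hf.dilate t (z, q t)
    simp only at this
    simp only [γ', ht, this, Function.comp_def, g₀, smul_eq_mul]
  have hsucc : (fun t : ℝ => t ^ (m + 1)) =o[𝓝[>] 0] fun t => t ^ m :=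
    isLittleO_pow_nhdsGT (Nat.lt_succ_self m)
  have hD1 : (fun t => (a t - b t).1 - (t : ℂ) ^ m • f₀) =o[𝓝[>] 0] fun t => t ^ m := by
    have h1 := ((isBigO_fst_prod' (E' := EuclideanSpace ℂ (Fin n))).trans_isLittleO
      hstrict).trans hsucc
    refine (h1.add hf1).congr_left fun t => ?_
    rw [hdiff]
    simp [a, b]
    abel
  have hD2 : (fun t => (a t - b t).2 - (t : ℂ) ^ (m + 1) • (Complex.I * ν + g₀))
      =o[𝓝[>] 0] fun t => t ^ (m + 1) := by
    have h1 := (isBigO_snd_prod' (F' := ℂ)).trans_isLittleO hstrict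
    refine (h1.add hf2).congr_left fun t => ?_
    rw [hdiff]
    simp [a, b]
    ring
  have hD2O : (fun t => (a t - b t).2) =O[𝓝[>] 0] fun t => t ^ (m + 1) :=
    (hD2.isBigO.add (isBigO_pow_smul (m + 1) _)).congr_left fun t => sub_add_cancel _ _
  have hD : (fun t => (a t - b t) - (t : ℂ) ^ m • ((f₀, 0) : Space n)) =o[𝓝[>] 0]
      fun t => t ^ m := by
    refine (hD1.prod_left (hD2O.trans_isLittleO hsucc)).congr_left fun t => ?_
    ext <;> simp
  have hDO : (fun t => a t - b t) =O[𝓝[>] 0] fun t => t ^ m :=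
    (hD.isBigO.add (isBigO_pow_smul m _)).congr_left fun t => sub_add_cancel _ _
  have hDO1 : (fun t => a t - b t) =O[𝓝[>] 0] fun t => t ^ 1 :=
    hDO.trans (isLittleO_pow_nhdsGT (by omega)).isBigO
  have haO : a =O[𝓝[>] 0] fun t : ℝ => t := by
    simp only [pow_one] at hDO1
    exact (hDO1.add hbO).congr_left fun t => sub_add_cancel _ _
  set B := fderiv ℝ (fderiv ℝ ρ) 0
  -- The increment of ρ from `b` to `a` has a linear part, which contributes -(ν + Im g₀) by `e1`,
  -- and a part B(b, a - b), which contributes 2 Re⟨z, f₀⟩ by `e2`, both times t^(m+1).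
  have hinc := isLittleO_increment hρ.contDiffAt.self_of_nhds haO hbO hDO
  have e1 : (fun t => fderiv ℝ ρ 0 (a t - b t) + t ^ (m + 1) * (ν + g₀.im)) =o[𝓝[>] 0]
      fun t => t ^ (m + 1) := by
    have h1 : (fun t => ((a t - b t).2 - (t : ℂ) ^ (m + 1) • (Complex.I * ν + g₀)).im)
        =o[𝓝[>] 0] fun t => t ^ (m + 1) :=
      (IsBigO.of_bound 1 (Eventually.of_forall fun t => by
        rw [one_mul]; exact Complex.abs_im_le_norm _)).trans_isLittleO hD2
    refine h1.neg_left.congr_left fun t => ?_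
    rw [hρ.fderiv, ← Complex.ofReal_pow, Complex.sub_im, smul_eq_mul, Complex.im_ofReal_mul]
    simp
    ring
  have e2 : (fun t => B (b t) (a t - b t) - t ^ (m + 1) * (2 * (inner ℂ z f₀).re)) =o[𝓝[>] 0]
      fun t => t ^ (m + 1) := by
    have h1 := isLittleO_bilinear_left B hb hDO
    have h2 := isLittleO_bilinear_right (a := 1) B
      (isBigO_pow_smul (l := 𝓝[>] 0) 1 ((z, 0) : Space n)) hD
    rw [add_comm 1 m] at h1 h2
    refine (h1.add h2).congr_left fun t => ?_
    have h3 : B ((t : ℂ) ^ 1 • ((z, 0) : Space n)) ((t : ℂ) ^ m • ((f₀, 0) : Space n)) =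
        t ^ (m + 1) * (2 * (inner ℂ z f₀).re) := by
      rw [← hρ.hess_inner, ← Complex.ofReal_pow, ← Complex.ofReal_pow, Complex.coe_smul,
        Complex.coe_smul, map_smul, map_smul]
      simp only [smul_apply, smul_eq_mul, B]
      ring
    have h4 : ((t : ℂ) • z, (0 : ℂ)) = (t : ℂ) ^ 1 • ((z, 0) : Space n) := by simp
    generalize a t - b t = D
    have h5 : B ((t : ℂ) ^ 1 • ((z, 0) : Space n)) (D - (t : ℂ) ^ m • ((f₀, 0) : Space n)) =
        B ((t : ℂ) • z, (0 : ℂ)) D - t ^ (m + 1) * (2 * (inner ℂ z f₀).re) := by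
      rw [map_sub, h3, h4]
    rw [h5, map_sub, sub_apply]
    ring
  -- This part has order t^(2m), negligible against t^(m+1) because m ≥ 2.
  have e3 : (fun t => (1 / 2) * B (a t - b t) (a t - b t)) =o[𝓝[>] 0] fun t => t ^ (m + 1) := by
    refine IsLittleO.const_mul_left ?_ _
    refine IsBigO.trans_isLittleO ((isBigO_bilinear B).trans (hDO.norm_left.mul hDO.norm_left)) ?_
    refine (isLittleO_pow_nhdsGT (show m + 1 < m + m by omega)).congr_left fun t => pow_add _ _ _
  -- The choice of f and N in `hsol` makes the coefficients of t^(m+1) cancel.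
  refine ((((hinc.add (hEG x)).add e1).add e2).add e3).congr_left fun t => ?_
  rw [hsol]
  simp only [b, γ, B, f₀, g₀, ν, z]
  ring

/-- The Chern-Moser normalization up to a given weight. -/
theorem exists_normalization (hn : 1 ≤ n) (hm : 2 ≤ m) {ρ : Space n → ℝ} (hρ : IsModelFunction ρ) :
    ∃ (H : Space n → Space n) (P : Poly n), ContDiff ℂ ∞ H ∧ H 0 = 0 ∧
      HasFDerivAt H (ContinuousLinearMap.id ℂ (Space n)) 0 ∧ IsChernMoserNormal P ∧
      (∀ x, (eval (varValue x) P).im = 0) ∧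
      ∀ x, (fun t => ρ (H (graphPt P (dil t x)))) =o[𝓝[>] 0] fun t => t ^ m := by
  induction m, hm using Nat.le_induction with
  | base =>
    -- In weight 2 a model function is -Im w + ‖z‖², which vanishes on the hyperquadric; no
    -- correction is needed.
    refine ⟨id, 0, contDiff_id, rfl, hasFDerivAt_id 0, (normalForms n).zero_mem, by simp,
      fun x => ?_⟩
    have h0 : IsChernMoserNormal (0 : Poly n) := (normalForms n).zero_mem
    have h1 := graphPt_dil_sub_isLittleO h0 x
    have hO := isBigO_of_sub_isLittleO h1
    have hO1 : (fun t => graphPt 0 (dil t x)) =O[𝓝[>] 0] fun t : ℝ => t ^ 1 := by simpa using hO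
    have hinc := isLittleO_increment (m := 1) hρ.contDiffAt.self_of_nhds hO
      (isBigO_zero (fun t : ℝ => t) _) (b := fun _ => 0) (by simpa using hO)
    have e1 := isLittleO_bilinear_left (fderiv ℝ (fderiv ℝ ρ) 0) h1 hO1
    have e2 := isLittleO_bilinear_right (a := 1) (fderiv ℝ (fderiv ℝ ρ) 0)
      (isBigO_pow_smul (l := 𝓝[>] 0) 1 ((x.1, 0) : Space n)) h1
    refine (hinc.add ((e1.add e2).const_mul_left (1 / 2))).congr_left fun t => ?_
    have h3 : fderiv ℝ (fderiv ℝ ρ) 0 ((t : ℂ) ^ 1 • ((x.1, 0) : Space n))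
        ((t : ℂ) ^ 1 • ((x.1, 0) : Space n)) = t ^ 2 * (2 * ‖x.1‖ ^ 2) := by
      rw [← hρ.hess, pow_one, Complex.coe_smul, map_smul, map_smul]
      simp only [smul_apply, smul_eq_mul]
      ring
    have h4 : ((t : ℂ) • x.1, (0 : ℂ)) = (t : ℂ) ^ 1 • ((x.1, 0) : Space n) := by simp
    have h5 : (graphPt 0 (dil t x)).2.im = t ^ 2 * ‖x.1‖ ^ 2 := by
      rw [graphPt, Complex.add_im, Complex.ofReal_im, Complex.mul_im, Complex.ofReal_re,
        Complex.ofReal_im]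
      simp [dil, norm_smul, mul_pow]
    rw [h4]
    simp only [map_sub, sub_apply, h3, h5, sub_zero, hρ.zero, hρ.fderiv, _root_.map_zero, zero_apply,
      id]
    ring
  | succ m hm ih =>
    obtain ⟨H, P, hH, hH0, hH1, hP, hPre, h⟩ := ih
    exact exists_improvement hn hm hρ hH hH0 hH1 hP hPre h

end FlatGerm

end

/-! ### Chern-Moser coordinates of a given weight -/

noncomputable section

namespace FlatGerm

open MvPolynomial

variable {n m : ℕ}

/-- A smooth map between real or complex Banach spaces with invertible derivative at a point is a
local homeomorphism near that point, with invertible derivative at each point of the source. -/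
theorem exists_local_inverse {𝕜 E : Type*} [RCLike 𝕜] [NormedAddCommGroup E] [NormedSpace 𝕜 E]
    [CompleteSpace E] {H : E → E} {A : E ≃L[𝕜] E} {a : E}
    (hH : ∀ᶠ x in 𝓝 a, ContDiffAt 𝕜 ∞ H x) (hA : HasFDerivAt H (A : E →L[𝕜] E) a) :
    ∃ e : OpenPartialHomeomorph E E, (e : E → E) = H ∧ a ∈ e.source ∧
      ∀ y ∈ e.target, ContDiffAt 𝕜 ∞ e.symm y ∧ ContDiffAt 𝕜 ∞ H (e.symm y) := by
  have hHa := hH.self_of_nhds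
  set e₀ := hHa.toOpenPartialHomeomorph H hA (by simp)
  have hcont : ContinuousAt (fderiv 𝕜 H) a := (hHa.fderiv_right (m := 0) (by simp)).continuousAt
  have hinv : ∀ᶠ x in 𝓝 a, ∃ B : E ≃L[𝕜] E, (B : E →L[𝕜] E) = fderiv 𝕜 H x :=
    hcont.eventually (by rw [hA.fderiv]; exact A.nhds)
  obtain ⟨s, hs, hso, has⟩ := eventually_nhds_iff.1 (hH.and hinv)
  refine ⟨e₀.restrOpen s hso, rfl, ⟨hHa.mem_toOpenPartialHomeomorph_source hA (by simp), has⟩,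
    fun y hy => ?_⟩
  have hmem := (e₀.restrOpen s hso).map_target hy
  rw [OpenPartialHomeomorph.restrOpen_source] at hmem
  obtain ⟨hc, B, hB⟩ := hs _ hmem.2
  refine ⟨(e₀.restrOpen s hso).contDiffAt_symm hy (f₀' := B) ?_ hc, hc⟩
  rw [hB]
  exact (hc.differentiableAt (by simp)).hasFDerivAt

/-- A hypersurface `σ = 0` with `dσ = -d(Im w)` at the origin is a smooth graph. -/
theorem exists_graph {σ : Space n → ℝ} (hσ : ∀ᶠ y in 𝓝 0, ContDiffAt ℝ ∞ σ y) (h0 : σ 0 = 0)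
    (h1 : ∀ v, fderiv ℝ σ 0 v = -v.2.im) :
    ∃ Φ : RSpace n → ℝ, (∀ᶠ x in 𝓝 0, ContDiffAt ℝ ∞ Φ x) ∧
      (∀ᶠ y : Space n in 𝓝 0, σ y < 0 ↔ Φ (y.1, y.2.re) < y.2.im) ∧
      ∀ g : RSpace n → ℝ, Tendsto g (𝓝 0) (𝓝 0) →
        ∀ᶠ x in 𝓝 0, |Φ x - g x| ≤ 2 * |σ (x.1, x.2 + Complex.I * (g x : ℂ))| := by
  set ι : RSpace n × ℝ →L[ℝ] Space n :=
    (ContinuousLinearMap.fst ℝ _ _ ∘L ContinuousLinearMap.fst ℝ _ _).prod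
      (Complex.ofRealCLM ∘L (ContinuousLinearMap.snd ℝ _ _ ∘L ContinuousLinearMap.fst ℝ _ _) +
        (Complex.I • Complex.ofRealCLM) ∘L ContinuousLinearMap.snd ℝ _ _) with hι
  have hιa : ∀ a, ι a = (a.1.1, a.1.2 + Complex.I * (a.2 : ℂ)) := fun a => by
    simp [hι]
  have hιt : Tendsto ι (𝓝 0) (𝓝 0) := by simpa using ι.continuous.tendsto 0
  set S : RSpace n × ℝ → ℝ := fun a => σ (ι a)
  have hSc : ∀ᶠ a in 𝓝 0, ContDiffAt ℝ ∞ S a :=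
    (hιt.eventually hσ).mono fun a ha => ha.comp a ι.contDiff.contDiffAt
  have hSd : HasFDerivAt S (-ContinuousLinearMap.snd ℝ (RSpace n) ℝ) 0 := by
    have hd : HasFDerivAt σ (fderiv ℝ σ 0) (ι 0) := by
      rw [map_zero]
      exact (hσ.self_of_nhds.differentiableAt (by simp)).hasFDerivAt
    refine (hd.comp 0 ι.hasFDerivAt).congr_fderiv (ContinuousLinearMap.ext fun a => ?_)
    simp [h1, hιa]
  have hS0 : S 0 = 0 := by simp [S, h0]
  -- Straightening: (x, v) ↦ (x, S(x, v)) has derivative (x, v) ↦ (x, -v) at the origin, and Φ(x) is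
  -- the last component of its local inverse at (x, 0).
  set A : (RSpace n × ℝ) ≃L[ℝ] (RSpace n × ℝ) :=
    (ContinuousLinearEquiv.refl ℝ (RSpace n)).prodCongr (ContinuousLinearEquiv.neg ℝ)
  have hΨc : ∀ᶠ a in 𝓝 (0 : RSpace n × ℝ), ContDiffAt ℝ ∞ (fun a => (a.1, S a)) a :=
    hSc.mono fun a ha => contDiffAt_fst.prodMk ha
  have hΨd : HasFDerivAt (fun a : RSpace n × ℝ => (a.1, S a))
      (A : RSpace n × ℝ →L[ℝ] RSpace n × ℝ) 0 := by
    refine (hasFDerivAt_fst.prodMk hSd).congr_fderiv (ContinuousLinearMap.ext fun a => ?_)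
    simp [A, Prod.map]
  obtain ⟨e, he, hes, hsymm⟩ := exists_local_inverse hΨc hΨd
  have he0 : e 0 = 0 := by rw [he]; simp [hS0, Prod.mk_zero_zero]
  have het : (0 : RSpace n × ℝ) ∈ e.target := he0 ▸ e.map_source hes
  have hes0 : e.symm 0 = 0 := by conv_lhs => rw [← he0, e.left_inv hes]
  set Φ : RSpace n → ℝ := fun x => (e.symm (x, 0)).2
  have hj : Tendsto (fun x : RSpace n => (x, (0 : ℝ))) (𝓝 0) (𝓝 0) := by
    have : Continuous fun x : RSpace n => (x, (0 : ℝ)) := by fun_prop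
    simpa [Prod.mk_zero_zero] using this.tendsto 0
  have htar : ∀ᶠ x : RSpace n in 𝓝 0, (x, (0 : ℝ)) ∈ e.target :=
    hj.eventually (e.open_target.mem_nhds het)
  have hΦc : ∀ᶠ x in 𝓝 0, ContDiffAt ℝ ∞ Φ x := htar.mono fun x hx =>
    contDiffAt_snd.comp x ((hsymm _ hx).1.comp x (contDiffAt_id.prodMk contDiffAt_const))
  have hΦ0 : Φ 0 = 0 := by simp [Φ, Prod.mk_zero_zero, hes0]
  have hΦt : Tendsto Φ (𝓝 0) (𝓝 0) := by
    simpa [hΦ0] using hΦc.self_of_nhds.continuousAt.tendsto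
  have hΦS : ∀ᶠ x in 𝓝 0, S (x, Φ x) = 0 := htar.mono fun x hx => by
    have h := e.right_inv hx
    rw [he] at h
    have h' : e.symm (x, 0) = (x, Φ x) := Prod.ext (congrArg Prod.fst h :) rfl
    rw [h'] at h
    simpa using h
  -- Strict differentiability compares S(x, v) with S(x, Φ(x)) = 0 and gives S(x, v) = -(v - Φ(x))
  -- up to a relative error 1/2. This determines the sign of S and yields the constant 2 in the
  -- distance estimate.
  have hstrict := (hSc.self_of_nhds.hasStrictFDerivAt' hSd (by simp)).isLittleO.def
    (show (0 : ℝ) < 1 / 2 by norm_num)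
  have key : ∀ᶠ a : RSpace n × ℝ in 𝓝 0, |S a + (a.2 - Φ a.1)| ≤ 1 / 2 * |a.2 - Φ a.1| := by
    have h1 : Tendsto (fun a : RSpace n × ℝ => a.1) (𝓝 0) (𝓝 0) := continuous_fst.tendsto _
    have h2 : Tendsto (fun a : RSpace n × ℝ => (a, (a.1, Φ a.1))) (𝓝 0) (𝓝 (0, 0)) :=
      tendsto_id.prodMk_nhds (h1.prodMk_nhds (hΦt.comp h1))
    filter_upwards [h2.eventually hstrict, h1.eventually hΦS] with a ha hz
    have e1 : a - (a.1, Φ a.1) = (0, a.2 - Φ a.1) := by ext <;> simp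
    simp only [hz, e1, sub_zero] at ha
    simpa [Prod.norm_mk, sub_eq_add_neg] using ha
  refine ⟨Φ, hΦc, ?_, fun g hg => ?_⟩
  · have h2 : Tendsto (fun y : Space n => ((y.1, y.2.re), y.2.im)) (𝓝 0) (𝓝 0) := by
      have : Continuous fun y : Space n => ((y.1, y.2.re), y.2.im) := by fun_prop
      simpa [Prod.mk_zero_zero] using this.tendsto 0
    filter_upwards [h2.eventually key] with y hy
    have e1 : ι ((y.1, y.2.re), y.2.im) = y := by
      rw [hιa]
      ext
      · simp
      · simp [mul_comm Complex.I, Complex.re_add_im]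
    simp only [S, e1] at hy
    rw [abs_le] at hy
    constructor
    · intro h
      by_contra hc
      rw [abs_of_nonpos (by linarith)] at hy
      linarith [hy.1, hy.2]
    · intro h
      rw [abs_of_pos (by linarith)] at hy
      linarith [hy.1, hy.2]
  · have h2 : Tendsto (fun x : RSpace n => (x, g x)) (𝓝 0) (𝓝 0) := by
      simpa [Prod.mk_zero_zero] using tendsto_id.prodMk_nhds hg
    filter_upwards [h2.eventually key] with x hx
    simp only [S, hιa] at hx
    rw [abs_sub_comm (Φ x)]
    set s := σ (x.1, x.2 + Complex.I * (g x : ℂ))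
    have := abs_sub_abs_le_abs_sub (g x - Φ x) (-s)
    rw [abs_neg, sub_neg_eq_add, add_comm _ s] at this
    linarith

/-- Existence of Chern-Moser coordinates of any given weight, tangent to given coordinates. -/
theorem exists_chernMoserCoord (hn : 1 ≤ n) {D : Set (Space n)} {p : Space n}
    {φ₀ : OpenPartialHomeomorph (Space n) (Space n)} (hφ₀ : IsLocalCoord p φ₀)
    {ρ : Space n → ℝ} (hρ : IsModelFunction ρ) (hD : ∀ᶠ q in 𝓝 p, q ∈ D ↔ ρ (φ₀ q) < 0) (m : ℕ) :
    ∃ φ, IsChernMoserCoord D p m φ ∧ fderiv ℂ φ p = fderiv ℂ φ₀ p := by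
  -- The normalization starts at weight 2, so for smaller m it is carried out to weight 2.
  obtain ⟨H, P, hH, hH0, hH1, hP, hPre, h⟩ :=
    exists_normalization hn (le_max_right m 2) hρ
  obtain ⟨e, he, hes, hsymm⟩ := exists_local_inverse (𝕜 := ℂ) (H := H) (a := 0)
    (A := ContinuousLinearEquiv.refl ℂ (Space n)) (Eventually.of_forall fun x => hH.contDiffAt) hH1
  have he0 : e 0 = 0 := by rw [he, hH0]
  have het : (0 : Space n) ∈ e.target := he0 ▸ e.map_source hes
  have hes0 : e.symm 0 = 0 := by conv_lhs => rw [← he0, e.left_inv hes]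
  have hφc : ContinuousAt φ₀ p := φ₀.continuousAt hφ₀.mem
  -- The new coordinates are H⁻¹ ∘ φ₀, with the same differential as φ₀ because dH = id.
  set φ := φ₀.trans e.symm
  have hφp : φ p = 0 := by simp [φ, hφ₀.map, hes0]
  have hloc : IsLocalCoord p φ := by
    refine ⟨?_, hφp, ?_, ?_⟩
    · rw [OpenPartialHomeomorph.trans_source]
      exact ⟨hφ₀.mem, by simpa [hφ₀.map] using het⟩
    · intro q hq
      rw [OpenPartialHomeomorph.trans_source] at hq
      exact (((hsymm _ hq.2).1.differentiableAt (by simp)).comp_differentiableWithinAt q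
        (hφ₀.holomorphic.mono Set.inter_subset_left q hq))
    · intro q hq
      have hq' : q ∈ e.source ∧ e q ∈ φ₀.target := by
        simpa [φ, OpenPartialHomeomorph.trans_target] using hq
      have h1 : DifferentiableAt ℂ e q := by
        rw [he]; exact hH.differentiable (by simp) q
      have h2 : DifferentiableAt ℂ φ₀.symm (e q) :=
        hφ₀.holomorphic_symm.differentiableAt (φ₀.open_target.mem_nhds hq'.2)
      exact (h2.comp q h1).differentiableWithinAt
  have hφc' : Tendsto φ (𝓝 p) (𝓝 0) := by
    simpa [hφp] using (φ.continuousAt hloc.mem).tendsto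
  have hHφ : ∀ᶠ q in 𝓝 p, H (φ q) = φ₀ q := by
    filter_upwards [φ.open_source.mem_nhds hloc.mem] with q hq
    rw [OpenPartialHomeomorph.trans_source] at hq
    rw [← he]
    exact e.right_inv hq.2
  have hHt : Tendsto H (𝓝 0) (𝓝 0) := by simpa [hH0] using hH.continuous.tendsto 0
  have hσ : ∀ᶠ y in 𝓝 0, ContDiffAt ℝ ∞ (fun y => ρ (H y)) y :=
    (hHt.eventually hρ.contDiffAt).mono fun y hy =>
      hy.comp y (hH.restrict_scalars ℝ).contDiffAt
  have hσ1 : ∀ v, fderiv ℝ (fun y => ρ (H y)) 0 v = -v.2.im := fun v => by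
    have h1 : HasFDerivAt ρ (fderiv ℝ ρ 0) (H 0) := by
      rw [hH0]; exact (hρ.contDiffAt.self_of_nhds.differentiableAt (by simp)).hasFDerivAt
    have h2 := h1.comp 0 (hH1.restrictScalars ℝ)
    rw [show (fun y => ρ (H y)) = ρ ∘ H from rfl, h2.fderiv]
    simp [hρ.fderiv]
  obtain ⟨Φ, hΦ, hσΦ, hcomp⟩ := exists_graph hσ (by simp [hH0, hρ.zero]) hσ1
  refine ⟨φ, ⟨hloc, Φ, P, ⟨hΦ, ?_⟩, hP, ?_⟩, ?_⟩
  · filter_upwards [hD, hHφ, hφc'.eventually hσΦ] with q h1 h2 h3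
    rw [h1, ← h2, h3]
  · have hG : ContDiffAt ℝ ∞ (fun x => ρ (H (graphPt P x))) 0 := by
      have h1 : ContDiffAt ℝ ∞ (fun y => ρ (H y)) (graphPt P 0) := by
        rw [hP.graphPt_zero]; exact hσ.self_of_nhds
      exact h1.comp 0 (contDiff_graphPt P).contDiffAt
    have hO := (isBigO_of_dil hG h).trans
      (weightNorm_pow_isBigO (show m + 1 ≤ max m 2 + 1 by omega))
    have hg : Tendsto (fun x : RSpace n => ‖x.1‖ ^ 2 + (eval (varValue x) P).re) (𝓝 0) (𝓝 0) := by
      have hc : Continuous fun x : RSpace n => ‖x.1‖ ^ 2 + (eval (varValue x) P).re :=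
        (continuous_fst.norm.pow 2).add (Complex.continuous_re.comp
          (contDiff_eval (𝕜 := ℝ) (m := 0) contDiff_varValue P).continuous)
      have h0 := congrArg (fun y => y.2.im) hP.graphPt_zero
      simp only [graphPt, Complex.add_im, Complex.ofReal_im, Complex.mul_im, Complex.I_re,
        Complex.I_im, Complex.ofReal_re, zero_mul, one_mul, zero_add] at h0
      have := hc.tendsto 0
      rw [h0] at this
      exact this
    -- The distance from the true graph Φ to the model graph ‖z‖² + Re P is at most twice |ρ ∘ H| on
    -- the model graph, and that is of weight greater than m.
    refine IsBigO.trans (IsBigO.of_bound 2 ?_) hO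
    filter_upwards [hcomp _ hg] with x hx
    have e1 : ((Φ x - ‖x.1‖ ^ 2 : ℝ) : ℂ) - eval (varValue x) P =
        ((Φ x - (‖x.1‖ ^ 2 + (eval (varValue x) P).re) : ℝ) : ℂ) := by
      conv_lhs => rw [← Complex.re_add_im (eval (varValue x) P), hPre]
      push_cast
      ring
    rw [e1, Complex.norm_real]
    exact hx
  · have h1 : HasFDerivAt e (ContinuousLinearEquiv.refl ℂ (Space n) : Space n →L[ℂ] Space n)
        (e.symm (φ₀ p)) := by
      rw [hφ₀.map, hes0, he]; exact hH1
    have h2 := e.hasFDerivAt_symm (by rw [hφ₀.map]; exact het) h1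
    have h3 : HasFDerivAt φ₀ (fderiv ℂ φ₀ p) p :=
      (hφ₀.holomorphic.differentiableAt (φ₀.open_source.mem_nhds hφ₀.mem)).hasFDerivAt
    have h4 := (h2.comp p h3).fderiv
    exact h4.trans (by ext <;> simp)

end FlatGerm

end

/-! ### Non-tangential regions and differentials under coordinate changes -/

noncomputable section

namespace FlatGerm

variable {n : ℕ}

/-- Holomorphic maps are locally Lipschitz. -/
theorem exists_lipschitz_ball {E F : Type*} [NormedAddCommGroup E] [NormedSpace ℂ E]
    [NormedAddCommGroup F] [NormedSpace ℂ F] {f : E → F} {s : Set E} {p : E}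
    (hf : DifferentiableOn ℂ f s) (hs : s ∈ 𝓝 p) :
    ∃ K > 0, ∃ r > 0, ∀ x ∈ Metric.ball p r, ∀ y ∈ Metric.ball p r,
      dist (f x) (f y) ≤ K * dist x y := by
  have hc : ContinuousAt f p := (hf.differentiableAt hs).continuousAt
  obtain ⟨R, hR, hball⟩ := Metric.eventually_nhds_iff_ball.1
    ((eventually_mem_set.2 hs).and (hc.eventually (Metric.ball_mem_nhds (f p) one_pos)))
  -- On the ball of radius R/2 about y, the map f stays within distance 2 of f(y); the Schwarz lemma
  -- then gives this Lipschitz constant.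
  refine ⟨2 / (R / 2), by positivity, R / 4, by positivity, fun x hx y hy => ?_⟩
  rw [Metric.mem_ball] at hx hy
  have hsub : Metric.ball y (R / 2) ⊆ Metric.ball p R := Metric.ball_subset_ball' (by linarith)
  refine Complex.dist_le_div_mul_dist_of_mapsTo_ball
    (hf.mono fun z hz => (hball z (hsub hz)).1) (fun z hz => ?_) ?_
  · have h1 := (hball z (hsub hz)).2
    have h2 := (hball y (hsub (Metric.mem_ball_self (by positivity)))).2
    rw [Metric.mem_closedBall]
    linarith [dist_triangle_right (f z) (f y) (f p)]
  · rw [Metric.mem_ball]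
    linarith [dist_triangle_right x y p]

theorem mem_frontier_iff_frequently {X : Type*} [TopologicalSpace X] {D : Set X} {x : X} :
    x ∈ frontier D ↔ (∃ᶠ y in 𝓝 x, y ∈ D) ∧ ∃ᶠ y in 𝓝 x, y ∉ D := by
  rw [frontier_eq_closure_inter_closure, Set.mem_inter_iff, mem_closure_iff_frequently,
    mem_closure_iff_frequently]
  rfl

theorem mem_frontier_of_tendsto {X Y : Type*} [TopologicalSpace X] [TopologicalSpace Y]
    {D : Set X} {D' : Set Y} {f : X → Y} {x : X} (hf : ContinuousAt f x)
    (hD : ∀ᶠ y in 𝓝 x, y ∈ D ↔ f y ∈ D') (hx : x ∈ frontier D) : f x ∈ frontier D' := by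
  rw [mem_frontier_iff_frequently] at hx ⊢
  exact ⟨hf.tendsto.frequently ((hx.1.and_eventually hD).mono fun y hy => hy.2.1 hy.1),
    hf.tendsto.frequently ((hx.2.and_eventually hD).mono fun y hy => mt hy.2.2 hy.1)⟩

/-- A bi-Lipschitz change of coordinates preserves non-tangential approach regions. -/
theorem exists_approachRegion_map {D D' : Set (Space n)} {p : Space n}
    (ψ : OpenPartialHomeomorph (Space n) (Space n)) (hp : p ∈ ψ.source)
    (hψ : DifferentiableOn ℂ ψ ψ.source) (hψs : DifferentiableOn ℂ ψ.symm ψ.target)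
    (hD : ∀ᶠ q in 𝓝 p, q ∈ D ↔ ψ q ∈ D') (hpD : p ∈ frontier D) (c : ℝ) :
    ∃ c', ∀ᶠ Z in 𝓝 p, Z ∈ approachRegion D p c → ψ Z ∈ approachRegion D' (ψ p) c' := by
  have hpt := ψ.map_source hp
  obtain ⟨K, hK, r, hr, hLip⟩ := exists_lipschitz_ball hψ (ψ.open_source.mem_nhds hp)
  obtain ⟨K', hK', r', hr', hLip'⟩ := exists_lipschitz_ball hψs (ψ.open_target.mem_nhds hpt)
  have hψc : ContinuousAt ψ p := ψ.continuousAt hp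
  have hψsc : Tendsto ψ.symm (𝓝 (ψ p)) (𝓝 p) := by
    simpa [ψ.left_inv hp] using (ψ.symm.continuousAt hpt).tendsto
  have hpD' : ψ p ∈ frontier D' := mem_frontier_of_tendsto hψc hD hpD
  have hev : ∀ᶠ y in 𝓝 (ψ p), y ∈ ψ.target ∧ (ψ.symm y ∈ D ↔ y ∈ D') := by
    filter_upwards [hψsc.eventually hD, ψ.open_target.mem_nhds hpt] with y hy ht
    rw [ψ.right_inv ht] at hy
    exact ⟨ht, hy⟩
  obtain ⟨s, hs, hsball⟩ := Metric.eventually_nhds_iff_ball.1 hev.eventually_nhds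
  set s' := min s r'
  have hs' : 0 < s' := lt_min hs hr'
  refine ⟨K * |c| * K', ?_⟩
  filter_upwards [hD, Metric.ball_mem_nhds p hr, ψ.open_source.mem_nhds hp,
    Metric.ball_mem_nhds p (show 0 < K' * (s' / 2) by positivity),
    hψc.eventually (Metric.ball_mem_nhds (ψ p) (half_pos hs'))] with Z hZD hZr hZs hZK hZψ hZ
  refine ⟨hZD.1 hZ.1, ?_⟩
  rw [Metric.mem_ball] at hZK
  -- Were this false, a point q of ∂D' would lie too close to ψ(Z). For Z near p such a q is near
  -- ψ(p), so ψ⁻¹(q) lies in ∂D and, by the Lipschitz bound for ψ⁻¹, closer to Z than ∂D is.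
  have hd : Metric.infDist Z (frontier D) ≤ K' * Metric.infDist (ψ Z) (frontier D') := by
    by_contra! hlt
    rw [← lt_div_iff₀' hK'] at hlt
    obtain ⟨q, hq, hqd⟩ := (Metric.infDist_lt_iff ⟨_, hpD'⟩).1 hlt
    have h1 : Metric.infDist Z (frontier D) ≤ dist Z p := Metric.infDist_le_dist_of_mem hpD
    have h2 : dist (ψ Z) q < s' / 2 := by
      refine hqd.trans ?_
      rw [div_lt_iff₀' hK']
      linarith
    have h3 : dist q (ψ p) < s' := by
      linarith [dist_triangle_left q (ψ p) (ψ Z)]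
    have hqs := hsball q (Metric.mem_ball.2 (h3.trans_le (min_le_left _ _)))
    have h4 : ψ.symm q ∈ frontier D := mem_frontier_of_tendsto
      (ψ.symm.continuousAt hqs.self_of_nhds.1) (hqs.mono fun y hy => hy.2.symm) hq
    have h5 := hLip' (ψ Z) (Metric.mem_ball.2 (by linarith [min_le_right s r']))
      q (Metric.mem_ball.2 (h3.trans_le (min_le_right _ _)))
    rw [ψ.left_inv hZs] at h5
    have h6 := Metric.infDist_le_dist_of_mem (x := Z) h4
    rw [lt_div_iff₀' hK'] at hqd
    linarith
  have h1 := hLip Z hZr p (Metric.mem_ball_self hr)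
  have h2 : c * Metric.infDist Z (frontier D) ≤ |c| * Metric.infDist Z (frontier D) :=
    mul_le_mul_of_nonneg_right (le_abs_self c) Metric.infDist_nonneg
  calc dist (ψ Z) (ψ p) ≤ K * dist Z p := h1
    _ ≤ K * (|c| * (K' * Metric.infDist (ψ Z) (frontier D'))) := by
        gcongr
        exact hZ.2.trans (h2.trans (by gcongr))
    _ = _ := by ring

namespace IsLocalCoord

variable {p : Space n} {φ : OpenPartialHomeomorph (Space n) (Space n)}

theorem zero_mem (hφ : IsLocalCoord p φ) : (0 : Space n) ∈ φ.target := hφ.map ▸ φ.map_source hφ.mem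

theorem symm_zero (hφ : IsLocalCoord p φ) : φ.symm 0 = p := by
  rw [← hφ.map, φ.left_inv hφ.mem]

theorem tendsto_symm (hφ : IsLocalCoord p φ) : Tendsto φ.symm (𝓝 0) (𝓝 p) := by
  simpa [hφ.symm_zero] using (φ.symm.continuousAt hφ.zero_mem).tendsto

theorem hasFDerivAt (hφ : IsLocalCoord p φ) : HasFDerivAt φ (fderiv ℂ φ p) p :=
  (hφ.holomorphic.differentiableAt (φ.open_source.mem_nhds hφ.mem)).hasFDerivAt

theorem hasFDerivAt_symm (hφ : IsLocalCoord p φ) : HasFDerivAt φ.symm (fderiv ℂ φ.symm 0) 0 :=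
  (hφ.holomorphic_symm.differentiableAt (φ.open_target.mem_nhds hφ.zero_mem)).hasFDerivAt

theorem fderiv_comp_fderiv_symm (hφ : IsLocalCoord p φ) :
    (fderiv ℂ φ p).comp (fderiv ℂ φ.symm 0) = ContinuousLinearMap.id ℂ (Space n) := by
  have h1 : HasFDerivAt φ (fderiv ℂ φ p) (φ.symm 0) := by rw [hφ.symm_zero]; exact hφ.hasFDerivAt
  have h2 := h1.comp 0 hφ.hasFDerivAt_symm
  refine h2.unique ((hasFDerivAt_id 0).congr_of_eventuallyEq ?_)
  filter_upwards [φ.open_target.mem_nhds hφ.zero_mem] with x hx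
  exact φ.right_inv hx

theorem fderiv_symm_comp_fderiv (hφ : IsLocalCoord p φ) :
    (fderiv ℂ φ.symm 0).comp (fderiv ℂ φ p) = ContinuousLinearMap.id ℂ (Space n) := by
  have h1 : HasFDerivAt φ.symm (fderiv ℂ φ.symm 0) (φ p) := by
    rw [hφ.map]; exact hφ.hasFDerivAt_symm
  have h2 := h1.comp p hφ.hasFDerivAt
  refine h2.unique ((hasFDerivAt_id p).congr_of_eventuallyEq ?_)
  filter_upwards [φ.open_source.mem_nhds hφ.mem] with x hx
  exact φ.left_inv hx

variable {D : Set (Space n)}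

theorem eventually_mem_iff (hφ : IsLocalCoord p φ) :
    ∀ᶠ q in 𝓝 p, q ∈ D ↔ φ q ∈ φ.target ∩ φ.symm ⁻¹' D := by
  filter_upwards [φ.open_source.mem_nhds hφ.mem] with q hq
  simp [φ.left_inv hq, φ.map_source hq]

theorem zero_mem_frontier (hφ : IsLocalCoord p φ) (hp : p ∈ frontier D) :
    (0 : Space n) ∈ frontier (φ.target ∩ φ.symm ⁻¹' D) := by
  rw [← hφ.map]
  exact mem_frontier_of_tendsto (φ.continuousAt hφ.mem) hφ.eventually_mem_iff hp

theorem exists_approachRegion (hφ : IsLocalCoord p φ) (hp : p ∈ frontier D) (c : ℝ) :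
    ∃ c', ∀ᶠ Z in 𝓝 p, Z ∈ approachRegion D p c →
      φ Z ∈ approachRegion (φ.target ∩ φ.symm ⁻¹' D) 0 c' := by
  have := exists_approachRegion_map φ hφ.mem hφ.holomorphic hφ.holomorphic_symm
    hφ.eventually_mem_iff hp c
  rwa [hφ.map] at this

theorem exists_approachRegion_symm (hφ : IsLocalCoord p φ) (hp : p ∈ frontier D) (c : ℝ) :
    ∃ c', ∀ᶠ x in 𝓝 0, x ∈ approachRegion (φ.target ∩ φ.symm ⁻¹' D) 0 c →
      φ.symm x ∈ approachRegion D p c' := by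
  have := exists_approachRegion_map (D' := D) φ.symm hφ.zero_mem hφ.holomorphic_symm
    hφ.holomorphic (by
      filter_upwards [φ.open_target.mem_nhds hφ.zero_mem] with x hx
      simp [hx]) (hφ.zero_mem_frontier hp) c
  rwa [hφ.symm_zero] at this

end IsLocalCoord

/-- Chain rule for non-tangential differentials. -/
theorem HasNTDifferential.comp {F ψ χ : Space n → Space n} {D₀ D : Set (Space n)}
    {a b b' b'' : Space n} {L A B : Space n →L[ℂ] Space n} (hF : HasNTDifferential F D b b' L)
    (hψ : HasFDerivAt ψ A a) (hψa : ψ a = b) (hχ : HasFDerivAt χ B b') (hχb : χ b' = b'')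
    (hreg : ∀ c, ∃ c', ∀ᶠ x in 𝓝 a, x ∈ approachRegion D₀ a c → ψ x ∈ approachRegion D b c') :
    HasNTDifferential (fun x => χ (F (ψ x))) D₀ a b'' (B.comp (L.comp A)) := by
  intro c
  obtain ⟨c', hc'⟩ := hreg c
  set l := 𝓝[approachRegion D₀ a c] a
  have hψt : Tendsto ψ l (𝓝[approachRegion D b c'] b) := by
    refine tendsto_nhdsWithin_iff.2 ⟨?_, ?_⟩
    · rw [← hψa]
      exact hψ.continuousAt.tendsto.mono_left nhdsWithin_le_nhds
    · filter_upwards [nhdsWithin_le_nhds hc', self_mem_nhdsWithin] with x h1 h2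
      exact h1 h2
  have hψl : (fun x => ψ x - b - A (x - a)) =o[l] fun x => x - a := by
    have := hψ.isLittleO
    rw [hψa] at this
    exact this.mono nhdsWithin_le_nhds
  have hψO : (fun x => ψ x - b) =O[l] fun x => x - a :=
    (hψl.isBigO.add (A.isBigO_sub l a)).congr_left fun x => by simp
  have h1 : (fun x => F (ψ x) - b' - L (ψ x - b)) =o[l] fun x => x - a :=
    ((hF c').comp_tendsto hψt).trans_isBigO hψO
  have h2 : (fun x => L (ψ x - b - A (x - a))) =o[l] fun x => x - a :=
    (L.isBigO_comp _ l).trans_isLittleO hψl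
  have h3 : (fun x => F (ψ x) - b' - L (A (x - a))) =o[l] fun x => x - a :=
    (h1.add h2).congr_left fun x => by simp
  have h4 : (fun x => F (ψ x) - b') =O[l] fun x => x - a :=
    (h3.isBigO.add ((L.comp A).isBigO_sub l a)).congr_left fun x => by simp
  have hla : Tendsto (fun x => x - a) l (𝓝 0) := by
    have : Tendsto (fun x : Space n => x - a) (𝓝 a) (𝓝 0) := by
      simpa using (continuous_id.sub continuous_const).tendsto (x := a) (f := fun x : Space n => x - a)
    exact this.mono_left nhdsWithin_le_nhds
  have h5 : Tendsto (fun x => F (ψ x)) l (𝓝 b') := by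
    simpa using (h4.trans_tendsto hla).add_const b'
  have h6 := (hχ.isLittleO.comp_tendsto h5).trans_isBigO h4
  rw [hχb] at h6
  have h7 : (fun x => B (F (ψ x) - b' - L (A (x - a)))) =o[l] fun x => x - a :=
    (B.isBigO_comp _ l).trans_isLittleO h3
  refine (h6.add h7).congr_left fun x => ?_
  simp

theorem HasNTDifferential.congr {F G : Space n → Space n} {D : Set (Space n)} {p p' : Space n}
    {L : Space n →L[ℂ] Space n} (hF : HasNTDifferential F D p p' L)
    (h : ∀ c, ∀ᶠ Z in 𝓝[approachRegion D p c] p, F Z = G Z) : HasNTDifferential G D p p' L :=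
  fun c => (hF c).congr' ((h c).mono fun Z hZ => by simp only [hZ]) EventuallyEq.rfl

/-- The expression of a non-tangential differential in coordinates. -/
theorem HasNTDifferential.inCoords {F : Space n → Space n} {D : Set (Space n)} {p p' : Space n}
    {φ φ' : OpenPartialHomeomorph (Space n) (Space n)} (hφ : IsLocalCoord p φ)
    (hφ' : IsLocalCoord p' φ') (hp : p ∈ frontier D) {L : Space n →L[ℂ] Space n}
    (hF : HasNTDifferential F D p p' L) :
    HasNTDifferential (fun x => φ' (F (φ.symm x))) (φ.target ∩ φ.symm ⁻¹' D) 0 0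
      (inCoords p' φ φ' L) :=
  hF.comp hφ.hasFDerivAt_symm hφ.symm_zero hφ'.hasFDerivAt hφ'.map
    (hφ.exists_approachRegion_symm hp)

/-- The coordinate expression involves only φ' ∘ F, where φ' is meaningless off its source. The
non-tangential limit places F(Z) in that source, so that F is recovered by φ'⁻¹. -/
theorem HasNTDifferential.of_coords {F : Space n → Space n} {D : Set (Space n)} {p p' : Space n}
    {φ φ' : OpenPartialHomeomorph (Space n) (Space n)} (hφ : IsLocalCoord p φ)
    (hφ' : IsLocalCoord p' φ') (hp : p ∈ frontier D) (hlim : HasNTLimit F D p p')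
    {M : Space n →L[ℂ] Space n}
    (hF : HasNTDifferential (fun x => φ' (F (φ.symm x))) (φ.target ∩ φ.symm ⁻¹' D) 0 0 M) :
    HasNTDifferential F D p p' ((fderiv ℂ φ'.symm 0).comp (M.comp (fderiv ℂ φ p))) := by
  refine (hF.comp hφ.hasFDerivAt hφ.map hφ'.hasFDerivAt_symm hφ'.symm_zero
    (hφ.exists_approachRegion hp)).congr fun c => ?_
  filter_upwards [nhdsWithin_le_nhds (φ.open_source.mem_nhds hφ.mem),
    (hlim c).eventually (φ'.open_source.mem_nhds hφ'.mem)] with Z h1 h2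
  rw [φ.left_inv h1, φ'.left_inv h2]

end FlatGerm

end

/-! ### The differential in normalized coordinates is block triangular -/

noncomputable section

namespace FlatGerm

variable {n : ℕ}

/-- Near the origin, the set is given by `Im w > ‖z‖² + O(|(z, Re w)|³)`. -/
def IsNormalizedGraph (Ω : Set (Space n)) : Prop :=
  ∃ Φ : RSpace n → ℝ, (∀ᶠ x in 𝓝 0, x ∈ Ω ↔ Φ (x.1, x.2.re) < x.2.im) ∧
    (fun x => Φ x - ‖x.1‖ ^ 2) =O[𝓝 0] fun x => ‖x‖ ^ 3

theorem IsNormalizedCoord.isNormalizedGraph {D : Set (Space n)} {p : Space n}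
    {φ : OpenPartialHomeomorph (Space n) (Space n)} (hφ : IsNormalizedCoord D p φ) :
    IsNormalizedGraph (φ.target ∩ φ.symm ⁻¹' D) := by
  obtain ⟨hc, Φ, ⟨-, h⟩, hO⟩ := hφ
  refine ⟨Φ, ?_, hO⟩
  filter_upwards [hc.tendsto_symm.eventually h, φ.open_target.mem_nhds hc.zero_mem] with x hx ht
  rw [φ.right_inv ht] at hx
  simp [ht, hx]

theorem tendsto_fst_re : Tendsto (fun x : Space n => ((x.1, x.2.re) : RSpace n)) (𝓝 0) (𝓝 0) := by
  have : Continuous fun x : Space n => ((x.1, x.2.re) : RSpace n) := by fun_prop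
  exact this.tendsto' _ _ (by simp)

theorem norm_fst_re_le (x : Space n) : ‖((x.1, x.2.re) : RSpace n)‖ ≤ ‖x‖ := by
  rw [Prod.norm_def, Prod.norm_def]
  exact max_le_max le_rfl (Complex.abs_re_le_norm _)

theorem isBigO_fst_re {Φ : RSpace n → ℝ} {k : ℕ} (h : Φ =O[𝓝 0] fun x => ‖x‖ ^ k) :
    (fun x : Space n => Φ (x.1, x.2.re)) =O[𝓝 0] fun x => ‖x‖ ^ k :=
  (h.comp_tendsto tendsto_fst_re).trans
    (IsBigO.of_bound 1 (Eventually.of_forall fun x => by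
      simp only [Function.comp_apply, norm_pow, norm_norm, one_mul]
      exact pow_le_pow_left₀ (norm_nonneg _) (norm_fst_re_le x) k))

theorem isBigO_sq_of_normalized {Φ : RSpace n → ℝ}
    (h : (fun x => Φ x - ‖x.1‖ ^ 2) =O[𝓝 0] fun x => ‖x‖ ^ 3) :
    Φ =O[𝓝 0] fun x => ‖x‖ ^ 2 := by
  have h1 : (fun x : RSpace n => ‖x.1‖ ^ 2) =O[𝓝 0] fun x => ‖x‖ ^ 2 :=
    IsBigO.of_bound 1 (Eventually.of_forall fun x => by
      simpa using pow_le_pow_left₀ (norm_nonneg _) (norm_fst_le x) 2)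
  have h2 : (fun x : RSpace n => ‖x‖ ^ 3) =O[𝓝 0] fun x => ‖x‖ ^ 2 := by
    refine IsBigO.of_bound 1 ?_
    filter_upwards [Metric.closedBall_mem_nhds (0 : RSpace n) one_pos] with x hx
    rw [mem_closedBall_zero_iff] at hx
    simpa using pow_le_pow_of_le_one (norm_nonneg _) hx (show 2 ≤ 3 by norm_num)
  simpa using (h.trans h2).add h1

/-- Points above the tangent hyperplane are approached non-tangentially along real rays. -/
theorem IsNormalizedGraph.exists_ray {Ω : Set (Space n)} (hΩ : IsNormalizedGraph Ω)
    (h0 : (0 : Space n) ∈ frontier Ω) {v : Space n} (hv : 0 < v.2.im) :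
    ∃ c, ∀ᶠ t : ℝ in 𝓝[>] 0, t • v ∈ approachRegion Ω 0 c := by
  obtain ⟨Φ, hΦ, hO⟩ := hΩ
  obtain ⟨K, hK, hb⟩ := (isBigO_fst_re (isBigO_sq_of_normalized hO)).exists_pos
  obtain ⟨r, hr, hball⟩ := Metric.eventually_nhds_iff_ball.1 (hΦ.and hb.bound)
  set δ := v.2.im / 2
  have hδ : 0 < δ := half_pos hv
  set R := ‖v‖ + δ
  have hR : 0 < R := by positivity
  refine ⟨‖v‖ / δ, ?_⟩
  have e1 : ∀ᶠ t : ℝ in 𝓝[>] 0, t * R < r :=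
    nhdsWithin_le_nhds ((by fun_prop : Continuous fun t : ℝ => t * R).tendsto' 0 0 (by simp)
      |>.eventually (gt_mem_nhds hr))
  have e2 : ∀ᶠ t : ℝ in 𝓝[>] 0, K * R ^ 2 * t < δ :=
    nhdsWithin_le_nhds ((by fun_prop : Continuous fun t : ℝ => K * R ^ 2 * t).tendsto' 0 0 (by simp)
      |>.eventually (gt_mem_nhds hδ))
  filter_upwards [e1, e2, self_mem_nhdsWithin] with t h1 h2 (ht : 0 < t)
  -- At height 2δt, a ball of radius δt about tv stays above height δt, while Φ is only O(t²) on it.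
  -- Hence dist(tv, ∂Ω) ≥ δt, which explains the aperture ‖v‖/δ.
  have hsub : Metric.ball (t • v) (δ * t) ⊆ Ω := by
    intro x hx
    rw [Metric.mem_ball, dist_eq_norm] at hx
    have hxn : ‖x‖ ≤ t * R := by
      have := norm_sub_norm_le x (t • v)
      rw [norm_smul, Real.norm_of_nonneg ht.le] at this
      simp only [R]; linarith
    have hxr := hball x (by rw [mem_ball_zero_iff]; linarith)
    rw [hxr.1]
    have hΦx := (le_abs_self _).trans hxr.2
    rw [norm_pow, norm_norm] at hΦx
    have him : |x.2.im - t * v.2.im| ≤ ‖x - t • v‖ := by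
      refine le_trans ?_ (norm_snd_le _)
      have := Complex.abs_im_le_norm (x - t • v).2
      simpa using this
    have h3 : ‖x‖ ^ 2 ≤ (t * R) ^ 2 := by gcongr
    have h4 := (abs_le.1 him).1
    have h5 : K * ‖x‖ ^ 2 ≤ K * (t * R) ^ 2 := by gcongr
    have h6 : K * (t * R) ^ 2 < δ * t := by nlinarith
    have h7 : v.2.im = 2 * δ := by simp only [δ]; ring
    rw [h7] at h4
    linarith
  have hδt : 0 < δ * t := by positivity
  refine ⟨hsub (Metric.mem_ball_self hδt), ?_⟩
  have hinf : δ * t ≤ Metric.infDist (t • v) (frontier Ω) := by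
    rw [Metric.le_infDist ⟨0, h0⟩]
    intro y hy
    by_contra! hlt
    have : y ∈ interior Ω := interior_maximal hsub Metric.isOpen_ball (by rwa [Metric.mem_ball'])
    exact hy.2 this
  rw [dist_zero_right, norm_smul, Real.norm_of_nonneg ht.le]
  calc t * ‖v‖ = ‖v‖ / δ * (δ * t) := by field_simp
    _ ≤ _ := by gcongr

/-- The structure of `M = (C A; 0 λ)` with `λ ≥ 0`. -/
structure IsUpper (M : Space n →L[ℂ] Space n) : Prop where
  tangent : ∀ z, (M (z, 0)).2 = 0
  im : (blockLambda M).im = 0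
  nonneg : 0 ≤ (blockLambda M).re

/-- The functional (Mv)₂ cannot depend on z, since z is unrestricted and could push the imaginary
part to -∞. Multiplication by λ must then send the upper half plane into its closure, so λ is real
and nonnegative. -/
theorem isUpper_of_im_nonneg {M : Space n →L[ℂ] Space n}
    (h : ∀ v : Space n, 0 < v.2.im → 0 ≤ (M v).2.im) : IsUpper M := by
  have hdec : ∀ z (w : ℂ), (M (z, w)).2 = (M (z, 0)).2 + w * blockLambda M := by
    intro z w
    have : ((z, w) : Space n) = (z, 0) + w • (0, 1) := by simp
    rw [this, map_add, map_smul]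
    simp [blockLambda]
  have ht : ∀ z, (M (z, 0)).2 = 0 := by
    intro z
    by_contra hne
    set a := (M (z, 0)).2
    set R : ℝ := (Complex.I * blockLambda M).im + 1
    -- The multiple of z is chosen so that its contribution is -iR; with R = Im(iλ) + 1 the total
    -- imaginary part is -1.
    have := h ((-Complex.I * R / a) • z, Complex.I) (by simp)
    rw [hdec, show (((-Complex.I * R / a) • z, 0) : Space n) = (-Complex.I * R / a) • (z, 0) by simp,
      map_smul, Prod.smul_snd, smul_eq_mul, div_mul_cancel₀ _ hne, Complex.add_im] at this
    simp [R] at this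
    linarith
  have hl : ∀ s : ℝ, 0 ≤ s * (blockLambda M).im + (blockLambda M).re := by
    intro s
    have := h (0, s + Complex.I) (by simp)
    rw [hdec, ht] at this
    simpa using this
  refine ⟨ht, ?_, by simpa using hl 0⟩
  by_contra hne
  have := hl (-((blockLambda M).re + 1) / (blockLambda M).im)
  rw [div_mul_cancel₀ _ hne] at this
  linarith

/-- Along the non-tangential ray tv one has G(tv) = tMv + o(t) and Im G₂ > Φ = O(t²). Dividing by t
gives Im (Mv)₂ ≥ 0. -/
theorem IsNormalizedGraph.isUpper {Ω Ω' : Set (Space n)} (hΩ : IsNormalizedGraph Ω)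
    (hΩ' : IsNormalizedGraph Ω') (h0 : (0 : Space n) ∈ frontier Ω) {G : Space n → Space n}
    {M : Space n →L[ℂ] Space n} (hG : HasNTDifferential G Ω 0 0 M)
    (hmap : ∀ c, ∀ᶠ x in 𝓝[approachRegion Ω 0 c] 0, G x ∈ Ω') : IsUpper M := by
  refine isUpper_of_im_nonneg fun v hv => ?_
  obtain ⟨c, hc⟩ := hΩ.exists_ray h0 hv
  obtain ⟨Φ, hΦ, hO⟩ := hΩ'
  have hray : Tendsto (fun t : ℝ => t • v) (𝓝[>] 0) (𝓝[approachRegion Ω 0 c] 0) := by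
    refine tendsto_nhdsWithin_iff.2 ⟨?_, hc⟩
    exact ((by fun_prop : Continuous fun t : ℝ => t • v).tendsto' 0 0 (by simp)).mono_left
      nhdsWithin_le_nhds
  have hvO : (fun t : ℝ => t • v) =O[𝓝[>] 0] fun t => t :=
    IsBigO.of_bound ‖v‖ (Eventually.of_forall fun t => by rw [norm_smul, mul_comm])
  have h1 : (fun t : ℝ => G (t • v) - t • M v) =o[𝓝[>] 0] fun t => t := by
    have := ((hG c).comp_tendsto hray).trans_isBigO (by simpa [Function.comp_def] using hvO)
    refine this.congr_left fun t => ?_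
    simp only [Function.comp_apply, sub_zero]
    rw [M.map_smul_of_tower]
  have h2 : (fun t : ℝ => G (t • v)) =O[𝓝[>] 0] fun t => t := by
    have h3 : (fun t : ℝ => t • M v) =O[𝓝[>] 0] fun t => t :=
      IsBigO.of_bound ‖M v‖ (Eventually.of_forall fun t => by rw [norm_smul, mul_comm])
    simpa using h1.isBigO.add h3
  have hid : Tendsto (fun t : ℝ => t) (𝓝[>] 0) (𝓝 0) := tendsto_id.mono_left nhdsWithin_le_nhds
  have hG0 : Tendsto (fun t : ℝ => G (t • v)) (𝓝[>] 0) (𝓝 0) := h2.trans_tendsto hid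
  have h4 : (fun t : ℝ => Φ ((G (t • v)).1, (G (t • v)).2.re)) =o[𝓝[>] 0] fun t => t := by
    have := ((isBigO_fst_re (isBigO_sq_of_normalized hO)).comp_tendsto hG0).trans
      (by simpa [Function.comp_def] using (h2.norm_left.pow 2))
    refine this.trans_isLittleO ?_
    simpa using isLittleO_pow_nhdsGT (show 1 < 2 by norm_num)
  have h5 : (fun t : ℝ => (G (t • v)).2.im - t * (M v).2.im) =o[𝓝[>] 0] fun t => t := by
    refine IsBigO.trans_isLittleO (IsBigO.of_bound 1 (Eventually.of_forall fun t => ?_)) h1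
    have := (Complex.abs_im_le_norm (G (t • v) - t • M v).2).trans (norm_snd_le _)
    simpa using this
  have h6 : Tendsto (fun t : ℝ => t * (M v).2.im / t) (𝓝[>] 0) (𝓝 (M v).2.im) := by
    refine tendsto_const_nhds.congr' ?_
    filter_upwards [self_mem_nhdsWithin] with t (ht : 0 < t)
    field_simp
  have h7 := (h5.sub h4).tendsto_div_nhds_zero.add h6
  rw [zero_add] at h7
  refine ge_of_tendsto h7 ?_
  filter_upwards [self_mem_nhdsWithin, hray.eventually (hmap c), hG0.eventually hΦ] with
    t (ht : 0 < t) h8 h9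
  have := h9.1 h8
  rw [← add_div]
  refine div_nonneg ?_ ht.le
  linarith

end FlatGerm

end

/-! ### The minimum principle bound ‖Cz‖² ≤ λ‖z‖² -/

noncomputable section

namespace FlatGerm

variable {n : ℕ}

/-- A local lower bound for the second component of a map between normalized domains. -/
theorem eventually_le_im {Ω Ω' : Set (Space n)} (hΩ' : IsNormalizedGraph Ω')
    {T : Space n → Space n} {M : Space n →L[ℂ] Space n} (hT : HasFDerivAt T M 0) (hT0 : T 0 = 0)
    (hmap : ∀ᶠ x in 𝓝 0, x ∈ Ω → T x ∈ Ω') {η : ℝ} (hη : 0 < η) :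
    ∀ᶠ x in 𝓝 0, x ∈ Ω → ‖(M x).1‖ ^ 2 - η * ‖x‖ ^ 2 ≤ (T x).2.im := by
  obtain ⟨Φ, hΦ, hO⟩ := hΩ'
  have hTt : Tendsto T (𝓝 0) (𝓝 0) := by simpa [hT0] using hT.continuousAt.tendsto
  have h1 : (fun x => T x - M x) =o[𝓝 0] fun x => x := by simpa [hT0] using hT.isLittleO
  have hM : (fun x => M x) =O[𝓝 0] fun x => x := by simpa using M.isBigO_sub (𝓝 0) 0
  have hTO : T =O[𝓝 0] fun x => x := by simpa using h1.isBigO.add hM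
  have h2 : (fun x => Φ ((T x).1, (T x).2.re) - ‖(T x).1‖ ^ 2) =o[𝓝 0] fun x => ‖x‖ ^ 2 := by
    have h3 := ((isBigO_fst_re (Φ := fun x => Φ x - ‖x.1‖ ^ 2) hO).comp_tendsto hTt).trans
      (hTO.norm_norm.pow 3)
    exact h3.trans_isLittleO (isLittleO_norm_pow_norm_pow (by norm_num))
  have h4 : (fun x => ‖(T x).1‖ ^ 2 - ‖(M x).1‖ ^ 2) =o[𝓝 0] fun x => ‖x‖ ^ 2 := by
    have ha : (fun x => ‖(T x).1‖ - ‖(M x).1‖) =o[𝓝 0] fun x => ‖x‖ := by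
      refine IsBigO.trans_isLittleO (IsBigO.of_bound 1 (Eventually.of_forall fun x => ?_))
        h1.norm_right
      rw [one_mul, Real.norm_eq_abs]
      exact (abs_norm_sub_norm_le _ _).trans (norm_fst_le (T x - M x))
    have hb : (fun x => ‖(T x).1‖ + ‖(M x).1‖) =O[𝓝 0] fun x => ‖x‖ := by
      refine IsBigO.add ?_ ?_
      · exact (IsBigO.of_bound 1 (Eventually.of_forall fun x => by
          simpa using norm_fst_le (T x))).trans hTO.norm_right
      · exact (IsBigO.of_bound 1 (Eventually.of_forall fun x => by
          simpa using norm_fst_le (M x))).trans hM.norm_right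
    exact (ha.mul_isBigO hb).congr (fun x => by ring) (fun x => by ring)
  have h5 := (h2.add h4).def hη
  filter_upwards [h5, hmap, hTt.eventually hΦ] with x h6 h7 h8 hx
  have h9 := h8.1 (h7 hx)
  rw [Real.norm_eq_abs, norm_pow, norm_norm] at h6
  linarith [(abs_le.1 h6).1]

/-- A map which is holomorphic across the boundary and preserves normalized domains does not expand
the complex tangential directions more than the normal one. -/
theorem norm_sq_le_of_mapsTo {Ω Ω' : Set (Space n)} (hΩ : IsNormalizedGraph Ω)
    (hΩ' : IsNormalizedGraph Ω') {T : Space n → Space n}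
    (hT : ∀ᶠ x in 𝓝 0, DifferentiableAt ℂ T x) (hT0 : T 0 = 0)
    (hmap : ∀ᶠ x in 𝓝 0, x ∈ Ω → T x ∈ Ω') (z : EuclideanSpace ℂ (Fin n)) :
    ‖(fderiv ℂ T 0 (z, 0)).1‖ ^ 2 ≤ (blockLambda (fderiv ℂ T 0)).re * ‖z‖ ^ 2 := by
  set M := fderiv ℂ T 0
  have hTd : HasFDerivAt T M 0 := hT.self_of_nhds.hasFDerivAt
  set l := (blockLambda M).re
  suffices h : ∀ ε > 0, ‖(M (z, 0)).1‖ ^ 2 ≤ l * (‖z‖ ^ 2 + ε) + ε by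
    have h1 : Tendsto (fun ε : ℝ => l * (‖z‖ ^ 2 + ε) + ε) (𝓝[>] 0) (𝓝 (l * ‖z‖ ^ 2)) :=
      ((by fun_prop : Continuous fun ε : ℝ => l * (‖z‖ ^ 2 + ε) + ε).tendsto' 0 _
        (by simp)).mono_left nhdsWithin_le_nhds
    exact ge_of_tendsto h1 (by filter_upwards [self_mem_nhdsWithin] with ε hε using h ε hε)
  intro ε hε
  set Y := ‖z‖ ^ 2 + ε
  have hY : 0 < Y := by positivity
  set K := ‖z‖ + Y
  have hK : 0 < K := by positivity
  set b := ‖(M (z, 0)).1‖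
  set a := ‖(M (0, Y * Complex.I)).1‖
  -- For |ζ| ≤ t these are discs in the direction z at the constant height Y t². As Y exceeds ‖z‖²
  -- by ε, the boundary circle lies inside Ω for small t.
  set X : ℝ → ℂ → Space n := fun t ζ => (ζ • z, (Y * t ^ 2 : ℝ) * Complex.I)
  have hXn : ∀ t : ℝ, 0 < t → t < 1 → ∀ ζ : ℂ, ‖ζ‖ ≤ t → ‖X t ζ‖ ≤ K * t := by
    intro t ht ht1 ζ hζ
    simp only [X, Prod.norm_def, norm_smul, norm_mul, Complex.norm_I, Complex.norm_real, mul_one]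
    rw [Real.norm_of_nonneg hY.le, Real.norm_of_nonneg (sq_nonneg t)]
    refine max_le ?_ ?_
    · nlinarith [norm_nonneg z]
    · nlinarith [norm_nonneg z, mul_pos hY ht, mul_pos (mul_pos hY ht) (sub_pos.2 ht1)]
  have hXev : ∀ {Q : Space n → Prop}, (∀ᶠ x in 𝓝 0, Q x) →
      ∀ᶠ t : ℝ in 𝓝[>] 0, ∀ ζ : ℂ, ‖ζ‖ ≤ t → Q (X t ζ) := by
    intro Q hQ
    obtain ⟨r, hr, hball⟩ := Metric.eventually_nhds_iff_ball.1 hQ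
    have e1 : ∀ᶠ t : ℝ in 𝓝[>] 0, K * t < r :=
      nhdsWithin_le_nhds ((by fun_prop : Continuous fun t : ℝ => K * t).tendsto' 0 0 (by simp)
        |>.eventually (gt_mem_nhds hr))
    filter_upwards [e1, self_mem_nhdsWithin, nhdsWithin_le_nhds (gt_mem_nhds one_pos)] with
      t h1 (h2 : 0 < t) h3 ζ hζ
    exact hball _ (mem_ball_zero_iff.2 ((hXn t h2 h3 ζ hζ).trans_lt h1))
  obtain ⟨Φ, hΦ, hO⟩ := hΩ
  obtain ⟨κ, hκ, hκb⟩ := (isBigO_fst_re (Φ := fun x => Φ x - ‖x.1‖ ^ 2) hO).exists_pos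
  have hη : 0 < ε / K ^ 2 := by positivity
  have key : ∀ᶠ t : ℝ in 𝓝[>] 0,
      t ^ 2 * (b ^ 2 - 2 * a * b * t - ε) ≤ (T (X t 0)).2.im := by
    have e2 : ∀ᶠ t : ℝ in 𝓝[>] 0, κ * K ^ 3 * t < ε :=
      nhdsWithin_le_nhds ((by fun_prop : Continuous fun t : ℝ => κ * K ^ 3 * t).tendsto' 0 0
        (by simp) |>.eventually (gt_mem_nhds hε))
    filter_upwards [hXev hT, hXev hΦ, hXev hκb.bound, hXev (eventually_le_im hΩ' hTd hT0 hmap hη),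
      self_mem_nhdsWithin, nhdsWithin_le_nhds (gt_mem_nhds one_pos), e2] with
      t hd hiff hbd hle (ht : 0 < t) ht1 he2
    set m := t ^ 2 * (b ^ 2 - 2 * a * b * t - ε)
    -- On the circle Im T₂ is at least about ‖M₁‖², and M₁ = ζC z + O(t²). Here `a` bounds the
    -- contribution of the height and `b` = ‖C z‖.
    have hcirc : ∀ ζ : ℂ, ‖ζ‖ = t → m ≤ (T (X t ζ)).2.im := by
      intro ζ hζ
      have hXt := hXn t ht ht1 ζ hζ.le
      have hmem : X t ζ ∈ Ω := by
        rw [hiff ζ hζ.le]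
        have h1 := (le_abs_self _).trans (hbd ζ hζ.le)
        rw [norm_pow, norm_norm] at h1
        have h2 : κ * ‖X t ζ‖ ^ 3 ≤ κ * (K * t) ^ 3 := by gcongr
        have h3 : (X t ζ).2.im = Y * t ^ 2 := by simp [X, -Complex.ofReal_mul, -Complex.ofReal_pow]
        have h4 : ‖(X t ζ).1‖ ^ 2 = t ^ 2 * ‖z‖ ^ 2 := by
          simp [X, norm_smul, hζ, mul_pow]
        have h5 : κ * (K * t) ^ 3 < ε * t ^ 2 := by
          have := mul_lt_mul_of_pos_right he2 (show 0 < t ^ 2 by positivity)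
          linarith [show κ * (K * t) ^ 3 = κ * K ^ 3 * t * t ^ 2 by ring]
        rw [h3]
        simp only [h4] at h1
        simp only [Y]
        linarith
      refine le_trans ?_ (hle ζ hζ.le hmem)
      have h6 : (M (X t ζ)).1 = ζ • (M (z, 0)).1 + (t ^ 2 : ℂ) • (M (0, Y * Complex.I)).1 := by
        have : X t ζ = ζ • ((z, 0) : Space n) + (t ^ 2 : ℂ) • (0, Y * Complex.I) := by
          simp only [X, Prod.smul_mk, Prod.mk_add_mk, smul_zero, add_zero, smul_eq_mul]
          push_cast
          congr 1
          ring
        rw [this, map_add, map_smul, map_smul]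
        rfl
      have h7 : t * b - t ^ 2 * a ≤ ‖(M (X t ζ)).1‖ := by
        rw [h6]
        have := norm_sub_le_norm_add (ζ • (M (z, 0)).1) ((t ^ 2 : ℂ) • (M (0, Y * Complex.I)).1)
        rw [norm_smul, norm_smul, hζ, norm_pow, Complex.norm_real, Real.norm_of_nonneg ht.le] at this
        exact this
      have hb0 : 0 ≤ b := norm_nonneg _
      have ha0 : 0 ≤ a := norm_nonneg _
      have h8 : t ^ 2 * (b ^ 2 - 2 * a * b * t) ≤ ‖(M (X t ζ)).1‖ ^ 2 := by
        have h9 := norm_nonneg (M (X t ζ)).1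
        rcases le_or_gt 0 (t * b - t ^ 2 * a) with h | h
        · nlinarith [mul_self_le_mul_self h h7, sq_nonneg (t ^ 2 * a)]
        · have : b ^ 2 - 2 * a * b * t ≤ 0 := by
            have h10 : b < t * a := by nlinarith
            nlinarith
          nlinarith [sq_nonneg ‖(M (X t ζ)).1‖, mul_nonneg (sq_nonneg t) (neg_nonneg.2 this)]
      have h11 : ε / K ^ 2 * ‖X t ζ‖ ^ 2 ≤ ε * t ^ 2 := by
        calc ε / K ^ 2 * ‖X t ζ‖ ^ 2 ≤ ε / K ^ 2 * (K * t) ^ 2 := by gcongr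
          _ = ε * t ^ 2 := by field_simp
      simp only [m]
      linarith
    -- The modulus of exp(iT₂) is exp(-Im T₂), so the maximum modulus principle for g is the minimum
    -- principle for Im T₂: the lower bound on the circle passes to the centre.
    set g : ℂ → ℂ := fun ζ => Complex.exp (Complex.I * (T (X t ζ)).2)
    have hgn : ∀ ζ, ‖g ζ‖ = Real.exp (-(T (X t ζ)).2.im) := by
      intro ζ
      simp [g, Complex.norm_exp]
    have hgd : DifferentiableOn ℂ g (Metric.closedBall 0 t) := by
      intro ζ hζ
      rw [mem_closedBall_zero_iff] at hζ
      have hX : DifferentiableAt ℂ (X t) ζ := by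
        simp only [X]; fun_prop
      have := (hd ζ hζ).comp ζ hX
      exact ((this.snd.const_mul Complex.I).cexp).differentiableWithinAt
    have hdc : DiffContOnCl ℂ g (Metric.ball 0 t) := by
      refine DifferentiableOn.diffContOnCl ?_
      rwa [closure_ball _ ht.ne']
    have hmax := Complex.norm_le_of_forall_mem_frontier_norm_le (C := Real.exp (-m))
      Metric.isBounded_ball hdc (fun ζ hζ => by
        rw [frontier_ball _ ht.ne', mem_sphere_zero_iff_norm] at hζ
        rw [hgn]
        exact Real.exp_le_exp.2 (neg_le_neg (hcirc ζ hζ)))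
      (subset_closure (Metric.mem_ball_self ht))
    rw [hgn, Real.exp_le_exp, neg_le_neg_iff] at hmax
    exact hmax
  -- At the centre T₂ is governed by the normal direction: Im T₂ = λYt² + o(t²). Comparison with the
  -- lower bound as t → 0, and afterwards ε → 0, gives the claim.
  have hlim : Tendsto (fun t : ℝ => (T (X t 0)).2.im / t ^ 2) (𝓝[>] 0) (𝓝 (l * Y)) := by
    have hX0 : Tendsto (fun t => X t 0) (𝓝[>] 0) (𝓝 0) := by
      refine ((?_ : Continuous fun t => X t 0).tendsto' 0 0 (by simp [X])).mono_left
        nhdsWithin_le_nhds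
      simp only [X]; fun_prop
    have hXO : (fun t => X t 0) =O[𝓝[>] 0] fun t : ℝ => t ^ 2 := by
      refine IsBigO.of_bound Y (Eventually.of_forall fun t => ?_)
      simp only [X, zero_smul, Prod.norm_def, norm_zero, norm_mul, Complex.norm_real, Complex.norm_I,
        mul_one, norm_pow, Real.norm_of_nonneg hY.le]
      exact max_le (by positivity) le_rfl
    have h1 : (fun x => T x - M x) =o[𝓝 0] fun x => x := by simpa [hT0] using hTd.isLittleO
    have h2 := (h1.comp_tendsto hX0).trans_isBigO hXO
    have h3 : (fun t : ℝ => (T (X t 0)).2.im - t ^ 2 * (l * Y)) =o[𝓝[>] 0] fun t => t ^ 2 := by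
      refine IsBigO.trans_isLittleO (IsBigO.of_bound 1 (Eventually.of_forall fun t => ?_)) h2
      have h4 := (Complex.abs_im_le_norm (T (X t 0) - M (X t 0)).2).trans (norm_snd_le _)
      have h5 : (M (X t 0)).2.im = t ^ 2 * (l * Y) := by
        have : X t 0 = ((Y * t ^ 2 : ℝ) * Complex.I : ℂ) • ((0, 1) : Space n) := by simp [X]
        rw [this, map_smul, Prod.smul_snd, smul_eq_mul, mul_assoc, Complex.im_ofReal_mul,
          Complex.I_mul_im]
        simp only [l, blockLambda]
        ring
      rw [Prod.snd_sub, Complex.sub_im, h5] at h4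
      simpa using h4
    have h6 : Tendsto (fun t : ℝ => t ^ 2 * (l * Y) / t ^ 2) (𝓝[>] 0) (𝓝 (l * Y)) := by
      refine tendsto_const_nhds.congr' ?_
      filter_upwards [self_mem_nhdsWithin] with t (ht : 0 < t)
      field_simp
    have h7 := h3.tendsto_div_nhds_zero.add h6
    rw [zero_add] at h7
    exact h7.congr fun t => by rw [← add_div, sub_add_cancel]
  have hlow : Tendsto (fun t : ℝ => b ^ 2 - 2 * a * b * t - ε) (𝓝[>] 0) (𝓝 (b ^ 2 - ε)) :=
    ((by fun_prop : Continuous fun t : ℝ => b ^ 2 - 2 * a * b * t - ε).tendsto' 0 _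
      (by simp)).mono_left nhdsWithin_le_nhds
  have := le_of_tendsto_of_tendsto hlow hlim (by
    filter_upwards [key, self_mem_nhdsWithin] with t h1 (ht : 0 < t)
    rw [le_div_iff₀ (by positivity), mul_comm]
    exact h1)
  linarith

end FlatGerm

end

/-! ### Conformal differentials, singular values and changes of normalized coordinates -/

noncomputable section

namespace FlatGerm

variable {n : ℕ}

/-- The structure of `M = (C A; 0 λ)` with `λ > 0` and `C` a multiple of a unitary map, with
`C* C = λ`. -/
structure IsConformal (M : Space n →L[ℂ] Space n) : Prop extends IsUpper M where
  pos : 0 < (blockLambda M).re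
  norm_sq : ∀ z, ‖(M (z, 0)).1‖ ^ 2 = (blockLambda M).re * ‖z‖ ^ 2

theorem IsUpper.eq_ofReal {M : Space n →L[ℂ] Space n} (hM : IsUpper M) :
    blockLambda M = ((blockLambda M).re : ℂ) := Complex.ext rfl (by simp [hM.im])

theorem IsUpper.snd_apply {M : Space n →L[ℂ] Space n} (hM : IsUpper M) (v : Space n) :
    (M v).2 = ((blockLambda M).re : ℂ) * v.2 := by
  have : v = (v.1, 0) + v.2 • (0, 1) := by ext <;> simp
  conv_lhs => rw [this, map_add, map_smul, Prod.snd_add, hM.tangent, Prod.smul_snd, smul_eq_mul,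
    zero_add]
  rw [← hM.eq_ofReal, mul_comm]
  rfl

theorem IsUpper.apply_tangent {M : Space n →L[ℂ] Space n} (hM : IsUpper M)
    (z : EuclideanSpace ℂ (Fin n)) : M (z, 0) = ((M (z, 0)).1, 0) :=
  Prod.ext rfl (hM.tangent z)

theorem IsUpper.blockLambda_comp {M M' : Space n →L[ℂ] Space n} (hM : IsUpper M)
    (hM' : IsUpper M') :
    (blockLambda (M'.comp M)).re = (blockLambda M').re * (blockLambda M).re := by
  have : blockLambda (M'.comp M) = (M' (M (0, 1))).2 := rfl
  rw [this, hM'.snd_apply, hM.snd_apply]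
  simp

theorem IsConformal.comp {M M' : Space n →L[ℂ] Space n} (hM' : IsConformal M')
    (hM : IsConformal M) : IsConformal (M'.comp M) where
  tangent z := by
    rw [ContinuousLinearMap.comp_apply, hM'.snd_apply, hM.tangent, mul_zero]
  im := by
    have : blockLambda (M'.comp M) = (M' (M (0, 1))).2 := rfl
    rw [this, hM'.snd_apply, hM.snd_apply]
    simp
  nonneg := by
    rw [hM.toIsUpper.blockLambda_comp hM'.toIsUpper]
    exact mul_nonneg hM'.nonneg hM.nonneg
  pos := by
    rw [hM.toIsUpper.blockLambda_comp hM'.toIsUpper]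
    exact mul_pos hM'.pos hM.pos
  norm_sq z := by
    rw [hM.toIsUpper.blockLambda_comp hM'.toIsUpper, ContinuousLinearMap.comp_apply,
      hM.apply_tangent, hM'.norm_sq, hM.norm_sq, mul_assoc]

/-- The singular values of `T` are all equal to `s` if and only if `T` is `s` times an isometry. -/
theorem singularValues_eq_iff {E : Type*} [NormedAddCommGroup E] [InnerProductSpace ℂ E]
    [FiniteDimensional ℂ E] (hE : Module.finrank ℂ E = n) (T : E →ₗ[ℂ] E) {s : ℝ} (hs : 0 ≤ s) :
    (∀ j : Fin n, T.singularValues j = s) ↔ ∀ z, ‖T z‖ ^ 2 = s ^ 2 * ‖z‖ ^ 2 := by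
  have hinner : ∀ z, (inner ℂ (T.adjoint (T z)) z : ℂ) = ((‖T z‖ ^ 2 : ℝ) : ℂ) := fun z => by
    rw [LinearMap.adjoint_inner_left, inner_self_eq_norm_sq_to_K]
    norm_cast
  set hT := T.isSymmetric_adjoint_comp_self
  constructor
  · intro h
    have hev : ∀ j, hT.eigenvalues hE j = s ^ 2 := fun j => by
      rw [← T.sq_singularValues_fin hE, h]
    have hid : T.adjoint ∘ₗ T = ((s ^ 2 : ℝ) : ℂ) • LinearMap.id := by
      refine (hT.eigenvectorBasis hE).toBasis.ext fun j => ?_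
      rw [OrthonormalBasis.coe_toBasis, hT.apply_eigenvectorBasis, hev]
      rfl
    intro z
    have h1 := hinner z
    rw [show T.adjoint (T z) = (T.adjoint ∘ₗ T) z from rfl, hid, LinearMap.smul_apply,
      inner_smul_left, LinearMap.id_apply, inner_self_eq_norm_sq_to_K, Complex.conj_ofReal] at h1
    exact Complex.ofReal_injective (by push_cast; push_cast at h1; exact h1.symm)
  · intro h j
    have h1 := hinner (hT.eigenvectorBasis hE j)
    rw [show T.adjoint (T (hT.eigenvectorBasis hE j)) =
      (T.adjoint ∘ₗ T) (hT.eigenvectorBasis hE j) from rfl, hT.apply_eigenvectorBasis, h,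
      inner_smul_left, inner_self_eq_norm_sq_to_K, (hT.eigenvectorBasis hE).norm_eq_one] at h1
    have h2 : hT.eigenvalues hE j = s ^ 2 := by
      simp only [map_one, one_pow, mul_one] at h1
      have := congrArg Complex.re h1
      simpa [-Complex.ofReal_pow] using this
    rw [T.singularValues_fin hE, h2, Real.sqrt_sq hs]

theorem IsUpper.isConformal_iff (hn : 1 ≤ n) {M : Space n →L[ℂ] Space n} (hM : IsUpper M) :
    IsConformal M ↔ ∀ j : Fin n, singularValue M j = 1 := by
  have hC : ∀ z, blockC M z = (M (z, 0)).1 := fun z => rfl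
  have h := singularValues_eq_iff (finrank_euclideanSpace_fin (𝕜 := ℂ) (n := n)) (blockC M)
    (Real.sqrt_nonneg (blockLambda M).re)
  rw [Real.sq_sqrt hM.nonneg] at h
  constructor
  · intro hc j
    have := h.2 (fun z => hc.norm_sq z) j
    rw [singularValue, this, div_self (Real.sqrt_pos.2 hc.pos).ne']
  · intro hj
    have hpos : 0 < (blockLambda M).re := by
      -- If λ were 0, division by √0 would make each quotient 0 rather than 1; as n ≥ 1, there is an
      -- index to contradict this.
      rcases hM.nonneg.lt_or_eq with hp | hp
      · exact hp
      · have := hj ⟨0, hn⟩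
        rw [singularValue, ← hp] at this
        simp at this
    refine ⟨hM, hpos, fun z => h.1 (fun j => ?_) z⟩
    have := hj j
    rwa [singularValue, div_eq_one_iff_eq (Real.sqrt_pos.2 hpos).ne'] at this

/-- The differentials of coordinate changes. -/
def transition (p : Space n) (φ φ₁ : OpenPartialHomeomorph (Space n) (Space n)) :
    Space n →L[ℂ] Space n :=
  (fderiv ℂ φ₁ p).comp (fderiv ℂ φ.symm 0)

section Transition

variable {D : Set (Space n)} {p : Space n} {φ φ₁ : OpenPartialHomeomorph (Space n) (Space n)}

theorem transition_comp_transition (hφ : IsLocalCoord p φ) (hφ₁ : IsLocalCoord p φ₁) :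
    (transition p φ₁ φ).comp (transition p φ φ₁) = ContinuousLinearMap.id ℂ (Space n) := by
  calc _ = (fderiv ℂ φ p).comp (((fderiv ℂ φ₁.symm 0).comp (fderiv ℂ φ₁ p)).comp
        (fderiv ℂ φ.symm 0)) := rfl
    _ = _ := by
      rw [hφ₁.fderiv_symm_comp_fderiv, ContinuousLinearMap.id_comp, hφ.fderiv_comp_fderiv_symm]

theorem hasFDerivAt_transition (hφ : IsLocalCoord p φ) (hφ₁ : IsLocalCoord p φ₁) :
    HasFDerivAt (fun x => φ₁ (φ.symm x)) (transition p φ φ₁) 0 := by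
  have h1 : HasFDerivAt φ₁ (fderiv ℂ φ₁ p) (φ.symm 0) := by rw [hφ.symm_zero]; exact hφ₁.hasFDerivAt
  exact h1.comp 0 hφ.hasFDerivAt_symm

theorem eventually_transition_mem (hφ : IsLocalCoord p φ) (hφ₁ : IsLocalCoord p φ₁) :
    ∀ᶠ x in 𝓝 0, x ∈ φ.target ∩ φ.symm ⁻¹' D → φ₁ (φ.symm x) ∈ φ₁.target ∩ φ₁.symm ⁻¹' D := by
  filter_upwards [hφ.tendsto_symm.eventually (φ₁.open_source.mem_nhds hφ₁.mem)] with x hx h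
  exact ⟨φ₁.map_source hx, by simpa [φ₁.left_inv hx] using h.2⟩

theorem isUpper_transition (hp : p ∈ frontier D) (hφ : IsNormalizedCoord D p φ)
    (hφ₁ : IsNormalizedCoord D p φ₁) : IsUpper (transition p φ φ₁) := by
  refine hφ.isNormalizedGraph.isUpper hφ₁.isNormalizedGraph (hφ.1.zero_mem_frontier hp)
    (G := fun x => φ₁ (φ.symm x)) (fun c => ?_) fun c => ?_
  · have := (hasFDerivAt_transition hφ.1 hφ₁.1).isLittleO
    simp only [hφ.1.symm_zero, hφ₁.1.map] at this
    exact this.mono nhdsWithin_le_nhds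
  · filter_upwards [nhdsWithin_le_nhds (eventually_transition_mem (D := D) hφ.1 hφ₁.1),
      self_mem_nhdsWithin] with x h1 h2
    exact h1 h2.1

theorem norm_sq_transition_le (hφ : IsNormalizedCoord D p φ) (hφ₁ : IsNormalizedCoord D p φ₁)
    (z : EuclideanSpace ℂ (Fin n)) : ‖(transition p φ φ₁ (z, 0)).1‖ ^ 2 ≤
      (blockLambda (transition p φ φ₁)).re * ‖z‖ ^ 2 := by
  have h := norm_sq_le_of_mapsTo hφ.isNormalizedGraph hφ₁.isNormalizedGraph
    (T := fun x => φ₁ (φ.symm x)) ?_ (by simp [hφ.1.symm_zero, hφ₁.1.map])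
    (eventually_transition_mem hφ.1 hφ₁.1) z
  · rwa [(hasFDerivAt_transition hφ.1 hφ₁.1).fderiv] at h
  · filter_upwards [φ.open_target.mem_nhds hφ.1.zero_mem,
      hφ.1.tendsto_symm.eventually (φ₁.open_source.mem_nhds hφ₁.1.mem)] with x h1 h2
    exact (hφ₁.1.holomorphic.differentiableAt (φ₁.open_source.mem_nhds h2)).comp x
      (hφ.1.holomorphic_symm.differentiableAt (φ.open_target.mem_nhds h1))

/-- The differential of a change between normalized coordinates. -/
theorem isConformal_transition (hp : p ∈ frontier D) (hφ : IsNormalizedCoord D p φ)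
    (hφ₁ : IsNormalizedCoord D p φ₁) : IsConformal (transition p φ φ₁) := by
  have h := isUpper_transition hp hφ hφ₁
  have h' := isUpper_transition hp hφ₁ hφ
  have hcomp := transition_comp_transition hφ.1 hφ₁.1
  have hl : (blockLambda (transition p φ₁ φ)).re * (blockLambda (transition p φ φ₁)).re = 1 := by
    rw [← h.blockLambda_comp h', hcomp]
    simp [blockLambda]
  have hpos : 0 < (blockLambda (transition p φ φ₁)).re :=
    h.nonneg.lt_of_ne fun h0 => by simp [← h0] at hl
  refine ⟨h, hpos, fun z => le_antisymm (norm_sq_transition_le hφ hφ₁ z) ?_⟩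
  -- The bound for the inverse change, whose block λ is the reciprocal, turns the inequality into an
  -- equality.
  have h1 := norm_sq_transition_le hφ₁ hφ (transition p φ φ₁ (z, 0)).1
  rw [← h.apply_tangent, ← ContinuousLinearMap.comp_apply, hcomp] at h1
  simp only [ContinuousLinearMap.id_apply] at h1
  have h2 := mul_le_mul_of_nonneg_left h1 hpos.le
  rw [← mul_assoc, mul_comm _ (blockLambda (transition p φ₁ φ)).re, hl, one_mul] at h2
  exact h2

end Transition

/-- Weight 5 suffices: the remainder is of weight 6, the weight of u³, hence O(|x|³), and a normal
polynomial P is O(‖z‖⁴). -/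
theorem IsChernMoserCoord.isNormalizedCoord {D : Set (Space n)} {p : Space n}
    {φ : OpenPartialHomeomorph (Space n) (Space n)} (h : IsChernMoserCoord D p 5 φ) :
    IsNormalizedCoord D p φ := by
  obtain ⟨hφ, Φ, P, hΦ, hP, hO⟩ := h
  refine ⟨hφ, Φ, hΦ, ?_⟩
  have h1 : (fun x : RSpace n => (‖x.1‖ + √|x.2|) ^ 6) =O[𝓝 0] fun x => ‖x‖ ^ 3 := by
    refine IsBigO.of_bound 64 ?_
    filter_upwards [Metric.closedBall_mem_nhds (0 : RSpace n) one_pos] with x hx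
    rw [mem_closedBall_zero_iff] at hx
    have h2 : ‖x.1‖ ≤ √‖x‖ := Real.le_sqrt_of_sq_le (by
      nlinarith [norm_fst_le x, norm_nonneg x.1, norm_nonneg x])
    have h3 : √|x.2| ≤ √‖x‖ := Real.sqrt_le_sqrt (norm_snd_le x)
    rw [norm_pow, norm_pow, norm_norm, Real.norm_of_nonneg (by positivity)]
    calc (‖x.1‖ + √|x.2|) ^ 6 ≤ (√‖x‖ + √‖x‖) ^ 6 := by gcongr
      _ = 64 * (√‖x‖ ^ 2) ^ 3 := by ring
      _ = 64 * ‖x‖ ^ 3 := by rw [Real.sq_sqrt (norm_nonneg x)]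
  have h4 : (fun x : RSpace n => ‖x.1‖ ^ 4) =O[𝓝 0] fun x => ‖x‖ ^ 3 := by
    refine IsBigO.of_bound 1 ?_
    filter_upwards [Metric.closedBall_mem_nhds (0 : RSpace n) one_pos] with x hx
    rw [mem_closedBall_zero_iff] at hx
    rw [norm_pow, norm_pow, norm_norm, norm_norm, one_mul]
    calc ‖x.1‖ ^ 4 ≤ ‖x‖ ^ 4 := by gcongr; exact norm_fst_le x
      _ ≤ ‖x‖ ^ 3 := pow_le_pow_of_le_one (norm_nonneg _) hx (by norm_num)
  have h5 := (hO.trans h1).add (hP.isBigO.trans h4)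
  refine (h5.norm_left).congr_left (fun x => ?_) |>.of_norm_left
  rw [sub_add_cancel, Complex.norm_real]

end FlatGerm

end

/-! ### Second-order expansions and model functions -/

noncomputable section

namespace FlatGerm

section Expansion

variable {E : Type*} [NormedAddCommGroup E] [NormedSpace ℝ E]

theorem isLittleO_expansion {ρ : E → ℝ} (hρ : ContDiffAt ℝ ∞ ρ 0) {a : ℝ → E}
    (ha : a =O[𝓝[>] 0] fun t => t) :
    (fun t => ρ (a t) - ρ 0 - fderiv ℝ ρ 0 (a t) -
      (1 / 2) * fderiv ℝ (fderiv ℝ ρ) 0 (a t) (a t)) =o[𝓝[>] 0] fun t => t ^ 2 := by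
  have := isLittleO_increment (m := 1) (b := fun _ => 0) hρ ha (isBigO_zero _ _) (by simpa using ha)
  simpa using this

theorem eq_zero_of_isLittleO_sq {c₀ c₁ c₂ : ℝ}
    (h : (fun t => c₀ + t * c₁ + t ^ 2 * c₂) =o[𝓝[>] 0] fun t : ℝ => t ^ 2) :
    c₀ = 0 ∧ c₁ = 0 ∧ c₂ = 0 := by
  have hc : ∀ (k : ℕ) (c : ℝ), (fun t : ℝ => t ^ k * c) =o[𝓝[>] 0] (fun t => t ^ k) → c = 0 := by
    intro k c hk
    have h1 := hk.tendsto_div_nhds_zero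
    have h2 : Tendsto (fun t : ℝ => t ^ k * c / t ^ k) (𝓝[>] 0) (𝓝 c) := by
      refine tendsto_const_nhds.congr' ?_
      filter_upwards [self_mem_nhdsWithin] with t (ht : 0 < t)
      field_simp
    exact tendsto_nhds_unique h2 h1
  have hO : ∀ (k : ℕ) (c : ℝ), (fun t : ℝ => t ^ k * c) =O[𝓝[>] 0] (fun t => t ^ k) := fun k c =>
    IsBigO.of_bound ‖c‖ (Eventually.of_forall fun t => by rw [norm_mul, mul_comm])
  have h0 : c₀ = 0 := by
    refine hc 0 c₀ ?_
    have := ((h.trans (isLittleO_pow_nhdsGT (show 0 < 2 by norm_num))).sub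
      ((hO 1 c₁).trans_isLittleO (isLittleO_pow_nhdsGT (show 0 < 1 by norm_num)))).sub
      ((hO 2 c₂).trans_isLittleO (isLittleO_pow_nhdsGT (show 0 < 2 by norm_num)))
    refine this.congr_left fun t => ?_
    ring
  subst h0
  have h1 : c₁ = 0 := by
    refine hc 1 c₁ ?_
    have := (h.trans (isLittleO_pow_nhdsGT (show 1 < 2 by norm_num))).sub
      ((hO 2 c₂).trans_isLittleO (isLittleO_pow_nhdsGT (show 1 < 2 by norm_num)))
    refine this.congr_left fun t => ?_
    ring
  subst h1
  refine ⟨rfl, rfl, hc 2 c₂ (h.congr_left fun t => ?_)⟩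
  ring

theorem isBigO_smul_vec {v : E} : (fun t : ℝ => t • v) =O[𝓝[>] 0] fun t => t :=
  IsBigO.of_bound ‖v‖ (Eventually.of_forall fun t => by rw [norm_smul, mul_comm])

theorem derivatives_of_expansion {ρ : E → ℝ} (hρ : ContDiffAt ℝ ∞ ρ 0) {v : E} {a b : ℝ}
    (h : (fun t : ℝ => ρ (t • v) - t * a - t ^ 2 * b) =o[𝓝[>] 0] fun t => t ^ 2) :
    ρ 0 = 0 ∧ fderiv ℝ ρ 0 v = a ∧ fderiv ℝ (fderiv ℝ ρ) 0 v v = 2 * b := by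
  have h1 := h.sub (isLittleO_expansion hρ (isBigO_smul_vec (v := v)))
  have h2 := eq_zero_of_isLittleO_sq (c₀ := ρ 0) (c₁ := fderiv ℝ ρ 0 v - a)
    (c₂ := (1 / 2) * fderiv ℝ (fderiv ℝ ρ) 0 v v - b) (h1.congr_left fun t => by
      simp only [map_smul, smul_apply, smul_eq_mul]
      ring)
  exact ⟨h2.1, sub_eq_zero.1 h2.2.1, by linarith [h2.2.2]⟩

end Expansion

variable {n : ℕ}

/-- A model function is recognized from its second-order expansion along real rays. The quadratic
coefficient is prescribed only on v₂ = 0, since the other quadratic terms have weight at least 3. -/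
theorem IsModelFunction.of_expansion {ρ : Space n → ℝ} (hρ : ∀ᶠ y in 𝓝 0, ContDiffAt ℝ ∞ ρ y)
    (h : ∀ v : Space n, ∃ b, (v.2 = 0 → b = ‖v.1‖ ^ 2) ∧
      (fun t : ℝ => ρ (t • v) + t * v.2.im - t ^ 2 * b) =o[𝓝[>] 0] fun t => t ^ 2) :
    IsModelFunction ρ := by
  have key : ∀ v : Space n, ∃ b, (v.2 = 0 → b = ‖v.1‖ ^ 2) ∧ ρ 0 = 0 ∧
      _root_.fderiv ℝ ρ 0 v = -v.2.im ∧ _root_.fderiv ℝ (_root_.fderiv ℝ ρ) 0 v v = 2 * b := by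
    intro v
    obtain ⟨b, hb, ho⟩ := h v
    exact ⟨b, hb, derivatives_of_expansion hρ.self_of_nhds (a := -v.2.im)
      (ho.congr_left fun t => by ring)⟩
  refine ⟨hρ, ?_, fun v => ?_, fun z => ?_⟩
  · obtain ⟨b, -, h0, -⟩ := key 0
    exact h0
  · obtain ⟨b, -, -, h1, -⟩ := key v
    exact h1
  · obtain ⟨b, hb, -, -, h2⟩ := key (z, 0)
    rw [h2, hb rfl]

theorem IsNormalizedCoord.exists_model {D : Set (Space n)} {p : Space n}
    {φ : OpenPartialHomeomorph (Space n) (Space n)} (hφ : IsNormalizedCoord D p φ) :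
    ∃ ρ, IsModelFunction ρ ∧ ∀ᶠ q in 𝓝 p, q ∈ D ↔ ρ (φ q) < 0 := by
  obtain ⟨hc, Φ, ⟨hΦ, hD⟩, hO⟩ := hφ
  refine ⟨fun y => Φ (y.1, y.2.re) - y.2.im, IsModelFunction.of_expansion ?_ fun v => ?_, ?_⟩
  · filter_upwards [tendsto_fst_re.eventually hΦ] with y hy
    have h1 : ContDiffAt ℝ ∞ (fun y : Space n => ((y.1, y.2.re) : RSpace n)) y :=
      contDiffAt_fst.prodMk (Complex.reCLM.contDiff.contDiffAt.comp y contDiffAt_snd)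
    exact (hy.comp y h1).sub (Complex.imCLM.contDiff.contDiffAt.comp y contDiffAt_snd)
  · refine ⟨‖v.1‖ ^ 2, fun _ => rfl, ?_⟩
    have h1 := (isBigO_fst_re (Φ := fun x => Φ x - ‖x.1‖ ^ 2) hO).comp_tendsto
      (((by fun_prop : Continuous fun t : ℝ => t • v).tendsto' 0 0 (by simp)).mono_left
        (nhdsWithin_le_nhds (s := Set.Ioi 0)))
    have h2 : (fun t : ℝ => ‖t • v‖ ^ 3) =O[𝓝[>] 0] fun t => t ^ 3 :=
      (isBigO_smul_vec (v := v)).norm_left.pow 3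
    refine ((h1.trans h2).trans_isLittleO (isLittleO_pow_nhdsGT (by norm_num))).congr_left
      fun t => ?_
    simp only [Function.comp_apply, Prod.smul_fst, Prod.smul_snd, norm_smul, Complex.smul_im,
      smul_eq_mul, mul_pow, Real.norm_eq_abs, sq_abs]
    ring
  · filter_upwards [hD] with q hq
    rw [hq, sub_neg]

/-- Here conformality is used for sufficiency: composition with M multiplies both -Im w and ‖z‖² by
λ, so after division by λ the model form is restored. The block A only affects terms containing w.
-/
theorem IsModelFunction.comp_conformal {ρ : Space n → ℝ} (hρ : IsModelFunction ρ)
    {M : Space n →L[ℂ] Space n} (hM : IsConformal M) :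
    IsModelFunction fun y => (blockLambda M).re⁻¹ * ρ (M y) := by
  have hcont : Tendsto M (𝓝 0) (𝓝 0) := M.continuous.tendsto' _ _ (map_zero M)
  refine IsModelFunction.of_expansion ?_ fun v => ?_
  · filter_upwards [hcont.eventually hρ.contDiffAt] with y hy
    exact contDiffAt_const.mul (hy.comp y (M.restrictScalars ℝ).contDiff.contDiffAt)
  · refine ⟨(blockLambda M).re⁻¹ * ((1 / 2) * _root_.fderiv ℝ (_root_.fderiv ℝ ρ) 0 (M v) (M v)), fun hv => ?_, ?_⟩
    · have : v = (v.1, 0) := Prod.ext rfl hv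
      rw [this, hM.apply_tangent, hρ.hess, hM.norm_sq]
      field_simp [hM.pos.ne']
    · have h1 := (isLittleO_expansion hρ.contDiffAt.self_of_nhds
        (isBigO_smul_vec (v := M v))).const_mul_left (blockLambda M).re⁻¹
      refine h1.congr_left fun t => ?_
      rw [M.map_smul_of_tower, hρ.zero, hρ.fderiv]
      simp only [map_smul, smul_apply, smul_eq_mul, Prod.smul_snd,
        Complex.smul_im, hM.snd_apply, Complex.im_ofReal_mul]
      field_simp [hM.pos.ne']
      ring

end FlatGerm

end

/-! ### Linear algebra of the Levi form -/

noncomputable section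

namespace FlatGerm

variable {n : ℕ}

/-- A positive definite real form invariant under `i` is the square of a Hermitian norm. -/
theorem exists_hermitian_coords {V : Type*} [AddCommGroup V] [Module ℂ V] [FiniteDimensional ℂ V]
    (hV : Module.finrank ℂ V = n) (G : V →ₗ[ℝ] V →ₗ[ℝ] ℝ) (hsymm : ∀ u v, G u v = G v u)
    (hI : ∀ u v, G (Complex.I • u) (Complex.I • v) = G u v) (hpos : ∀ v, v ≠ 0 → 0 < G v v) :
    ∃ e : EuclideanSpace ℂ (Fin n) ≃ₗ[ℂ] V, ∀ z, G (e z) (e z) = ‖z‖ ^ 2 := by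
  have hI' : ∀ u v, G u (Complex.I • v) = -G (Complex.I • u) v := fun u v => by
    rw [← hI u (Complex.I • v), smul_smul, Complex.I_mul_I, neg_one_smul, map_neg]
  have hsmul : ∀ (c : ℂ) (v : V), c • v = c.re • v + c.im • (Complex.I • v) := fun c v => by
    rw [← Complex.coe_smul, ← Complex.coe_smul, smul_smul, ← add_smul, Complex.re_add_im]
  have hII : ∀ v, G (Complex.I • v) v = 0 := fun v => by
    have h1 := hI' v v
    rw [hsymm] at h1
    linarith
  -- The Hermitian form with real part G; the sign of the imaginary part makes it conjugate linear
  -- in the first argument.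
  let core : InnerProductSpace.Core ℂ V :=
    { inner := fun u v => (G u v : ℂ) + Complex.I * (G (Complex.I • u) v : ℂ)
      conj_inner_symm := fun u v => by
        have h1 : G (Complex.I • v) u = -G (Complex.I • u) v := by
          rw [hsymm, hI']
        simp [h1, hsymm v u]
      re_inner_nonneg := fun v => by
        rw [hII]
        rcases eq_or_ne v 0 with rfl | hv
        · simp
        · simpa using (hpos v hv).le
      add_left := fun u v w => by
        simp only [smul_add, map_add, LinearMap.add_apply, Complex.ofReal_add]
        ring
      smul_left := fun u v c => by
        rw [hsmul c u]
        simp only [smul_add, map_add, LinearMap.add_apply, smul_comm Complex.I (_ : ℝ), map_smul,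
          LinearMap.smul_apply, smul_eq_mul, smul_smul, Complex.I_mul_I, neg_smul, one_smul,
          map_neg, LinearMap.neg_apply]
        push_cast
        conv_rhs => rw [← Complex.re_add_im c, map_add, map_mul, Complex.conj_I,
          Complex.conj_ofReal, Complex.conj_ofReal]
        linear_combination ((c.im : ℂ) * (G (Complex.I • u) v : ℂ)) * Complex.I_mul_I
      definite := fun v hv => by
        by_contra hne
        rw [hII] at hv
        have : G v v = 0 := by simpa using hv
        exact (hpos v hne).ne' this }
  let _ : NormedAddCommGroup V := core.toNormedAddCommGroup
  let _ : InnerProductSpace ℂ V := InnerProductSpace.ofCore core.toCore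
  let b := stdOrthonormalBasis ℂ V
  let b' := b.reindex (finCongr hV)
  refine ⟨b'.repr.symm.toLinearEquiv, fun z => ?_⟩
  have h1 : ‖b'.repr.symm z‖ = ‖z‖ := b'.repr.symm.norm_map z
  have h2 : (inner ℂ (b'.repr.symm z) (b'.repr.symm z) : ℂ) = (‖b'.repr.symm z‖ : ℂ) ^ 2 :=
    inner_self_eq_norm_sq_to_K _
  have h3 : (inner ℂ (b'.repr.symm z) (b'.repr.symm z) : ℂ) =
      (G (b'.repr.symm z) (b'.repr.symm z) : ℂ) +
        Complex.I * (G (Complex.I • b'.repr.symm z) (b'.repr.symm z) : ℂ) := rfl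
  rw [h3, hII, h1] at h2
  have h4 : ((G (b'.repr.symm z) (b'.repr.symm z) : ℝ) : ℂ) = ((‖z‖ ^ 2 : ℝ) : ℂ) := by
    push_cast
    simpa using h2
  exact Complex.ofReal_injective h4

/-- The holomorphic quadratic form whose real part is the pure part of a real quadratic form. -/
theorem exists_pure_part {E : Type*} [NormedAddCommGroup E] [NormedSpace ℂ E]
    [FiniteDimensional ℂ E] (B : E →L[ℝ] E →L[ℝ] ℝ) (hB : ∀ u v, B u v = B v u) :
    ∃ S : E →L[ℂ] E →L[ℂ] ℂ,
      ∀ v, (S v v).re = (B v v - B (Complex.I • v) (Complex.I • v)) / 2 := by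
  have hsmul : ∀ (c : ℂ) (v : E), c • v = c.re • v + c.im • (Complex.I • v) := fun c v => by
    rw [← Complex.coe_smul, ← Complex.coe_smul, smul_smul, ← add_smul, Complex.re_add_im]
  -- The symmetric complex bilinear form obtained by polarizing the (2, 0) part of B.
  let f : E → E → ℂ := fun u v =>
    ((B u v - B (Complex.I • u) (Complex.I • v)) / 2 : ℝ) -
      Complex.I * ((B u (Complex.I • v) + B (Complex.I • u) v) / 2 : ℝ)
  have hf : ∀ u v, f u v = f v u := fun u v => by
    simp only [f, hB v u, hB (Complex.I • v), hB v, add_comm (B (Complex.I • u) v)]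
  have hadd : ∀ u u' v, f (u + u') v = f u v + f u' v := fun u u' v => by
    simp only [f, smul_add, map_add, add_apply]
    push_cast
    ring
  have hsm : ∀ (c : ℂ) u v, f (c • u) v = c • f u v := fun c u v => by
    conv_lhs => rw [hsmul c u]
    simp only [f, smul_add, map_add, add_apply, smul_comm Complex.I (_ : ℝ), map_smul,
      smul_apply, smul_eq_mul, smul_smul, Complex.I_mul_I, neg_smul, one_smul,
      map_neg, neg_apply]
    push_cast
    conv_rhs => rw [← Complex.re_add_im c]
    linear_combination (c.im / 2 * (B u (Complex.I • v) + B (Complex.I • u) v) : ℂ) *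
      Complex.I_mul_I
  let S₀ : E →ₗ[ℂ] E →ₗ[ℂ] ℂ := LinearMap.mk₂ ℂ f hadd hsm
    (fun u v v' => by rw [hf, hadd, hf v, hf v']) (fun c u v => by rw [hf, hsm, hf v])
  refine ⟨LinearMap.toContinuousLinearMap
    ((LinearMap.toContinuousLinearMap (𝕜 := ℂ) (E := E) (F' := ℂ)).toLinearMap ∘ₗ S₀), fun v => ?_⟩
  change (f v v).re = _
  simp [f, -Complex.ofReal_div, -Complex.ofReal_add, -Complex.ofReal_sub]

/-- Linear coordinates adapted to a real hyperplane and a positive form on its complex tangent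
space. -/
theorem exists_adapted_coords (ℓ : Space n →L[ℝ] ℝ) (hℓ : ℓ ≠ 0)
    (B : Space n →L[ℝ] Space n →L[ℝ] ℝ) (hB : ∀ u v, B u v = B v u)
    (hpos : ∀ v, v ≠ 0 → ℓ v = 0 → ℓ (Complex.I • v) = 0 →
      0 < B v v + B (Complex.I • v) (Complex.I • v)) :
    ∃ A : Space n ≃L[ℂ] Space n, (∀ v, ℓ (A v) = -v.2.im) ∧
      ∀ z, B (A (z, 0)) (A (z, 0)) + B (Complex.I • A (z, 0)) (Complex.I • A (z, 0)) =
        4 * ‖z‖ ^ 2 := by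
  -- The complex linear functional with Im W = -ℓ. It becomes the coordinate w, and its kernel is
  -- the complex tangent space.
  let W : Space n →ₗ[ℂ] ℂ := -Complex.I • (StrongDual.extendRCLike (𝕜 := ℂ) ℓ).toLinearMap
  have hW : ∀ v, W v = -(ℓ (Complex.I • v) : ℂ) - Complex.I * ℓ v := fun v => by
    simp only [W, LinearMap.smul_apply, ContinuousLinearMap.coe_coe,
      StrongDual.extendRCLike_apply, smul_eq_mul]
    simp only [RCLike.I_to_complex, Complex.coe_algebraMap]
    linear_combination (ℓ (Complex.I • v) : ℂ) * Complex.I_mul_I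
  have hWim : ∀ v, ℓ v = -(W v).im := fun v => by rw [hW]; simp
  have hWre : ∀ v, ℓ (Complex.I • v) = -(W v).re := fun v => by rw [hW]; simp
  obtain ⟨N, hN⟩ : ∃ N, W N = 1 := by
    obtain ⟨v, hv⟩ : ∃ v, ℓ v ≠ 0 := by
      by_contra! h
      exact hℓ (ContinuousLinearMap.ext h)
    have : W v ≠ 0 := fun h => hv (by rw [hWim, h]; simp)
    exact ⟨(W v)⁻¹ • v, by rw [map_smul, smul_eq_mul, inv_mul_cancel₀ this]⟩
  have hker : Module.finrank ℂ (LinearMap.ker W) = n := by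
    have h1 := W.finrank_range_add_finrank_ker
    have h2 : LinearMap.range W = ⊤ := LinearMap.range_eq_top.2 fun c =>
      ⟨c • N, by rw [map_smul, hN, smul_eq_mul, mul_one]⟩
    rw [h2, finrank_top, Module.finrank_self, Module.finrank_prod, finrank_euclideanSpace_fin,
      Module.finrank_self] at h1
    omega
  -- The i-invariant part of ½B. The divisor 4 makes it equal to ‖z‖² in the new coordinates.
  let G₀ : Space n →ₗ[ℝ] Space n →ₗ[ℝ] ℝ := LinearMap.mk₂ ℝ
    (fun u v => (B u v + B (Complex.I • u) (Complex.I • v)) / 4)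
    (fun u u' v => by simp only [smul_add, map_add, add_apply]; ring)
    (fun c u v => by
      simp only [smul_comm Complex.I (_ : ℝ), map_smul, smul_apply, smul_eq_mul]; ring)
    (fun u v v' => by simp only [smul_add, map_add]; ring)
    (fun c u v => by
      simp only [smul_comm Complex.I (_ : ℝ), map_smul, smul_eq_mul]; ring)
  have hG₀ : ∀ u v, G₀ u v = (B u v + B (Complex.I • u) (Complex.I • v)) / 4 := fun u v => rfl
  let ι : LinearMap.ker W →ₗ[ℝ] Space n := (LinearMap.ker W).subtype.restrictScalars ℝ
  obtain ⟨e, he⟩ := exists_hermitian_coords hker (G₀.compl₁₂ ι ι)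
    (fun u v => by
      simp only [LinearMap.compl₁₂_apply, hG₀]
      rw [hB, hB (Complex.I • ι u)])
    (fun u v => by
      have : ∀ u, ι (Complex.I • u) = Complex.I • ι u := fun u => rfl
      simp only [LinearMap.compl₁₂_apply, hG₀, this, smul_smul, Complex.I_mul_I, neg_smul, one_smul,
        map_neg, neg_apply, neg_neg]
      ring)
    (fun v hv => by
      have h1 : W (ι v) = 0 := v.2
      simp only [LinearMap.compl₁₂_apply, hG₀]
      refine div_pos (hpos (ι v) (fun h => hv (Subtype.ext h)) ?_ ?_) (by norm_num)
      · rw [hWim, h1]; simp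
      · rw [hWre, h1]; simp)
  let A₀ : Space n →ₗ[ℂ] Space n :=
    ((LinearMap.ker W).subtype ∘ₗ e.toLinearMap).coprod (LinearMap.toSpanSingleton ℂ _ N)
  have hA₀ : ∀ v, A₀ v = (e v.1 : Space n) + v.2 • N := fun v => rfl
  have hWA : ∀ v, W (A₀ v) = v.2 := fun v => by
    rw [hA₀, map_add, map_smul, hN, show W (e v.1) = 0 from (e v.1).2]
    simp
  have hinj : Function.Injective A₀ := by
    rw [← LinearMap.ker_eq_bot, LinearMap.ker_eq_bot']
    intro v hv
    have h2 : v.2 = 0 := by rw [← hWA, hv, map_zero]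
    rw [hA₀, h2, zero_smul, add_zero] at hv
    have h1 : v.1 = 0 := e.map_eq_zero_iff.1 (Subtype.ext hv)
    exact Prod.ext h1 h2
  refine ⟨(LinearEquiv.ofInjectiveEndo A₀ hinj).toContinuousLinearEquiv, fun v => ?_, fun z => ?_⟩
  · change ℓ (A₀ v) = _
    rw [hWim, hWA]
  · change B (A₀ (z, 0)) (A₀ (z, 0)) + B (Complex.I • A₀ (z, 0)) (Complex.I • A₀ (z, 0)) = _
    have h1 := he z
    simp only [LinearMap.compl₁₂_apply, hG₀] at h1
    have h2 : A₀ (z, 0) = ι (e z) := by rw [hA₀]; simp [ι]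
    rw [h2]
    linarith

end FlatGerm

end

/-! ### Model coordinates at a strongly pseudoconvex point -/

noncomputable section

namespace FlatGerm

variable {n : ℕ}

/-- The shear `(z, w) ↦ (z, w + q(z))`. -/
def shear (q : EuclideanSpace ℂ (Fin n) → ℂ) (hq : Continuous q) : Space n ≃ₜ Space n where
  toFun v := (v.1, v.2 + q v.1)
  invFun v := (v.1, v.2 - q v.1)
  left_inv v := by simp
  right_inv v := by simp
  continuous_toFun := by fun_prop
  continuous_invFun := by fun_prop

/-- At a strongly pseudoconvex point there are local coordinates in which the domain is defined by
a model function. -/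
theorem IsStronglyPseudoconvexAt.exists_model {D : Set (Space n)} {p : Space n}
    (h : IsStronglyPseudoconvexAt D p) :
    ∃ (φ : OpenPartialHomeomorph (Space n) (Space n)) (ρ : Space n → ℝ),
      IsLocalCoord p φ ∧ IsModelFunction ρ ∧ ∀ᶠ q in 𝓝 p, q ∈ D ↔ ρ (φ q) < 0 := by
  obtain ⟨V, r, hV, hpV, hr, hD, hr0, hdr, hlevi⟩ := h
  have hrV : ∀ᶠ q in 𝓝 p, ContDiffAt ℝ ∞ r q := by
    filter_upwards [hV.mem_nhds hpV] with q hq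
    exact hr.contDiffAt (hV.mem_nhds hq)
  set ℓ := fderiv ℝ r p
  set B := fderiv ℝ (fderiv ℝ r) p
  have hB : ∀ u v, B u v = B v u := fun u v =>
    (hrV.self_of_nhds.isSymmSndFDerivAt
      (by simp; exact WithTop.coe_le_coe.2 (le_top : (2 : ℕ∞) ≤ ⊤))).eq u v
  obtain ⟨A, hA, hAB⟩ := exists_adapted_coords ℓ hdr B hB fun v hv h1 h2 => by
    have := hlevi v hv h1 h2
    simpa [leviForm, iteratedFDeriv_two_apply] using this
  obtain ⟨S, hS⟩ := exists_pure_part B hB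
  -- The shear w ↦ w + q(z) adds -Im q = -½ Re S to the defining function. This cancels the
  -- pluriharmonic part of ½B on the complex tangent space and leaves ‖z‖².
  set q : EuclideanSpace ℂ (Fin n) → ℂ := fun z =>
    Complex.I / 2 * S (A (z, 0)) (A (z, 0))
  have hqd : Differentiable ℂ q := by
    have h1 : Differentiable ℂ fun z : EuclideanSpace ℂ (Fin n) => A (z, 0) :=
      A.differentiable.comp (differentiable_id.prodMk (differentiable_const 0))
    exact ((S.differentiable.comp h1).clm_apply h1).const_mul _
  have hq2 : ∀ (t : ℝ) z, q (t • z) = (t ^ 2 : ℝ) * q z := fun t z => by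
    have : A (t • z, 0) = (t : ℂ) • A (z, 0) := by
      rw [← map_smul]
      simp
    simp only [q, this, map_smul, smul_apply, smul_eq_mul]
    push_cast
    ring
  let e : Space n ≃ₜ Space n :=
    ((shear q hqd.continuous).trans A.toHomeomorph).trans (Homeomorph.addLeft p)
  have he : ∀ v, e v = p + A (v.1, v.2 + q v.1) := fun v => rfl
  have hed : Differentiable ℂ e := by
    have : Differentiable ℂ fun v : Space n => p + A (v.1, v.2 + q v.1) :=
      (A.differentiable.comp (differentiable_fst.prodMk
        (differentiable_snd.add (hqd.comp differentiable_fst)))).const_add p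
    exact this
  have hesd : Differentiable ℂ e.symm := by
    have h1 : Differentiable ℂ fun x : Space n => A.symm (-p + x) :=
      A.symm.differentiable.comp (differentiable_id.const_add _)
    have : Differentiable ℂ fun x : Space n =>
        ((A.symm (-p + x)).1, (A.symm (-p + x)).2 - q (A.symm (-p + x)).1) :=
      h1.fst.prodMk (h1.snd.sub (hqd.comp h1.fst))
    exact this
  have hq0 : q 0 = 0 := by simpa using hq2 0 0
  have he0 : e 0 = p := by rw [he]; simp [hq0]
  have he0' : e.symm p = 0 := by rw [← he0, e.symm_apply_apply]
  have hec : ContDiff ℝ ∞ e := by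
    have h1 : ContDiff ℂ ∞ fun z : EuclideanSpace ℂ (Fin n) => A (z, 0) :=
      A.contDiff.comp (contDiff_id.prodMk contDiff_const)
    have h2 : ContDiff ℂ ∞ q := contDiff_const.mul ((S.contDiff.comp h1).clm_apply h1)
    have h3 : ContDiff ℂ ∞ fun v : Space n => p + A (v.1, v.2 + q v.1) :=
      contDiff_const.add (A.contDiff.comp (contDiff_fst.prodMk
        (contDiff_snd.add (h2.comp contDiff_fst))))
    exact h3.restrict_scalars ℝ
  refine ⟨e.symm.toOpenPartialHomeomorph, fun y => r (e y), ⟨by simp, he0', ?_, ?_⟩,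
    IsModelFunction.of_expansion ?_ fun v => ?_, ?_⟩
  · exact hesd.differentiableOn
  · exact hed.differentiableOn
  · filter_upwards [(hec.continuous.tendsto' 0 p he0).eventually hrV] with y hy
    exact hy.comp y hec.contDiffAt
  · set a : ℝ → Space n := fun t => t • A v + t ^ 2 • A (0, q v.1)
    have hpow : ∀ {k : ℕ} (c : ℝ), 2 < k → (fun t : ℝ => t ^ k * c) =o[𝓝[>] 0] fun t => t ^ 2 :=
      fun {k} c hk => by
        have := (isLittleO_pow_nhdsGT hk).const_mul_left c
        exact this.congr_left fun t => mul_comm _ _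
    have haO : a =O[𝓝[>] 0] fun t => t := by
      refine isBigO_smul_vec.add (IsBigO.trans (g := fun t : ℝ => t ^ 2) ?_ ?_)
      · exact IsBigO.of_bound ‖A (0, q v.1)‖ (Eventually.of_forall fun t => by
          rw [norm_smul, mul_comm])
      · simpa using (isLittleO_pow_nhdsGT (show 1 < 2 by norm_num)).isBigO
    have hea : ∀ t : ℝ, e (t • v) = p + a t := fun t => by
      have h1 : (((t • v).1, (t • v).2 + q (t • v).1) : Space n) =
          (t : ℂ) • v + ((t ^ 2 : ℝ) : ℂ) • (0, q v.1) := by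
        ext1
        · simp
        · simp [hq2]
      rw [he, h1, map_add, map_smul, map_smul]
      simp only [a, Complex.coe_smul]
    have hR : ContDiffAt ℝ ∞ (fun x => r (p + x)) 0 := by
      have h1 : ContDiffAt ℝ ∞ r (p + 0) := by rw [add_zero]; exact hrV.self_of_nhds
      exact h1.comp 0 (contDiffAt_const.add contDiffAt_id)
    have hR1 : fderiv ℝ (fun x => r (p + x)) = fun x => fderiv ℝ r (p + x) :=
      funext fun x => fderiv_comp_add_left p
    have hR2 : fderiv ℝ (fderiv ℝ fun x => r (p + x)) 0 = B := by
      rw [hR1, fderiv_comp_add_left (f := fderiv ℝ r), add_zero]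
    have hexp := isLittleO_expansion hR haO
    rw [hR2, hR1] at hexp
    simp only [add_zero, hr0, sub_zero] at hexp
    refine ⟨-(q v.1).im + (1 / 2) * B (A v) (A v), fun hv => ?_, ?_⟩
    · have hv' : v = (v.1, 0) := Prod.ext rfl hv
      have h1 := hS (A (v.1, 0))
      have h2 := hAB v.1
      have h3 : (q v.1).im = (S (A (v.1, 0)) (A (v.1, 0))).re / 2 := by
        simp only [q]
        rw [div_mul_eq_mul_div, ← Complex.ofReal_ofNat, Complex.div_ofReal_im, Complex.I_mul_im]
      rw [h3, h1]
      conv_lhs => rw [hv']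
      linarith
    · have h1 := (hexp.add (hpow (k := 3) (B (A v) (A (0, q v.1))) (by norm_num))).add
        (hpow (k := 4) ((1 / 2) * B (A (0, q v.1)) (A (0, q v.1))) (by norm_num))
      refine h1.congr_left fun t => ?_
      rw [hea]
      have h2 : ℓ (a t) = -(t * v.2.im) - t ^ 2 * (q v.1).im := by
        simp only [a, map_add, map_smul, hA, smul_eq_mul]
        ring
      have h3 : B (a t) (a t) = t ^ 2 * B (A v) (A v) + 2 * t ^ 3 * B (A v) (A (0, q v.1)) +
          t ^ 4 * B (A (0, q v.1)) (A (0, q v.1)) := by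
        simp only [a, map_add, map_smul, add_apply, smul_apply, smul_eq_mul,
          hB (A (0, q v.1)) (A v)]
        ring
      have h4 : fderiv ℝ r p (a t) = ℓ (a t) := rfl
      rw [h4, h2, h3]
      ring
  · filter_upwards [hV.mem_nhds hpV] with x hx
    rw [hD x hx]
    simp

end FlatGerm

end

/-! ### Flat germs and conformal differentials -/

noncomputable section

namespace FlatGerm

variable {n : ℕ}

theorem IsStronglyPseudoconvexAt.exists_isNormalizedCoord (hn : 1 ≤ n) {D : Set (Space n)}
    {p : Space n} (h : IsStronglyPseudoconvexAt D p) : ∃ φ, IsNormalizedCoord D p φ := by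
  obtain ⟨φ₀, ρ, hφ₀, hρ, hD⟩ := h.exists_model
  obtain ⟨φ, hφ, -⟩ := exists_chernMoserCoord hn hφ₀ hρ hD 5
  exact ⟨φ, hφ.isNormalizedCoord⟩

theorem IsLocalCoord.postcomp {p : Space n} {φ : OpenPartialHomeomorph (Space n) (Space n)}
    (hφ : IsLocalCoord p φ) (A : Space n ≃L[ℂ] Space n) :
    IsLocalCoord p (φ.transHomeomorph A.toHomeomorph) where
  mem := hφ.mem
  map := by
    change A (φ p) = 0
    rw [hφ.map, map_zero]
  holomorphic := A.differentiable.comp_differentiableOn hφ.holomorphic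
  holomorphic_symm := hφ.holomorphic_symm.comp A.symm.differentiable.differentiableOn
    fun _ hx => hx

theorem IsConformal.injective {M : Space n →L[ℂ] Space n} (hM : IsConformal M) :
    Function.Injective M := by
  rw [injective_iff_map_eq_zero]
  intro v hv
  have h2 : v.2 = 0 := by
    have := hM.snd_apply v
    rw [hv, Prod.snd_zero] at this
    exact (mul_eq_zero.1 this.symm).resolve_left (Complex.ofReal_ne_zero.2 hM.pos.ne')
  have hv' : v = (v.1, 0) := Prod.ext rfl h2
  have h1 := hM.norm_sq v.1
  rw [← hv', hv] at h1
  have h3 : ‖v.1‖ ^ 2 = 0 := by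
    simp only [Prod.fst_zero, norm_zero, ne_eq, OfNat.ofNat_ne_zero, not_false_eq_true, zero_pow] at h1
    exact (mul_eq_zero.1 h1.symm).resolve_left hM.pos.ne'
  exact Prod.ext (norm_eq_zero.1 (pow_eq_zero_iff two_ne_zero |>.1 h3)) h2

theorem IsConformal.exists_equiv {M : Space n →L[ℂ] Space n} (hM : IsConformal M) :
    ∃ A : Space n ≃L[ℂ] Space n, (A : Space n →L[ℂ] Space n) = M :=
  ⟨(LinearEquiv.ofInjectiveEndo M.toLinearMap hM.injective).toContinuousLinearEquiv,
    ContinuousLinearMap.ext fun _ => rfl⟩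

section Germ

variable {D D' : Set (Space n)} {p p' : Space n} {U : Set (Space n)} {F : Space n → Space n}
  {φ φ' : OpenPartialHomeomorph (Space n) (Space n)}

theorem RepresentsGerm.isUpper (hF : RepresentsGerm D D' p p' U F) (hp : p ∈ frontier D)
    (hφ : IsNormalizedCoord D p φ) (hφ' : IsNormalizedCoord D' p' φ') {L : Space n →L[ℂ] Space n}
    (hL : HasNTDifferential F D p p' L) : IsUpper (inCoords p' φ φ' L) := by
  refine hφ.isNormalizedGraph.isUpper hφ'.isNormalizedGraph (hφ.1.zero_mem_frontier hp)
    (hL.inCoords hφ.1 hφ'.1 hp) fun c => ?_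
  obtain ⟨c', hc'⟩ := hφ.1.exists_approachRegion_symm hp c
  have ht : Tendsto φ.symm (𝓝[approachRegion (φ.target ∩ φ.symm ⁻¹' D) 0 c] 0)
      (𝓝[approachRegion D p c'] p) := by
    refine tendsto_nhdsWithin_iff.2 ⟨hφ.1.tendsto_symm.mono_left nhdsWithin_le_nhds, ?_⟩
    filter_upwards [nhdsWithin_le_nhds hc', self_mem_nhdsWithin] with x h1 h2
    exact h1 h2
  filter_upwards [((hF.ntLimit c').comp ht).eventually (φ'.open_source.mem_nhds hφ'.1.mem),
    ht.eventually self_mem_nhdsWithin,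
    (ht.mono_right nhdsWithin_le_nhds).eventually (hF.isOpen.mem_nhds hF.mem)] with x h1 h2 h3
  refine ⟨φ'.map_source h1, ?_⟩
  rw [Set.mem_preimage, show φ'.symm (φ' (F (φ.symm x))) = F (φ.symm x) from φ'.left_inv h1]
  exact hF.mapsTo ⟨h3, h2.1⟩

theorem RepresentsGerm.allSingularValuesOne_iff (hn : 1 ≤ n) (hF : RepresentsGerm D D' p p' U F)
    (hp : p ∈ frontier D) (hφ : IsNormalizedCoord D p φ) (hφ' : IsNormalizedCoord D' p' φ') :
    AllSingularValuesOne D p p' φ φ' F ↔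
      ∃ L, HasNTDifferential F D p p' L ∧ IsConformal (inCoords p' φ φ' L) := by
  refine exists_congr fun L => and_congr_right fun hL => ?_
  exact ((hF.isUpper hp hφ hφ' hL).isConformal_iff hn).symm

/-- Flatness at the single weight 5 already forces conformality, since then the coordinates are
normalized and M is a product of two transitions. Conversely, conformality lets M be absorbed into
φ', and Chern-Moser coordinates of every weight exist with the resulting differentials. -/
theorem RepresentsGerm.isOneFlat_iff (hn : 1 ≤ n) (hF : RepresentsGerm D D' p p' U F)
    (hp : p ∈ frontier D) (hp' : p' ∈ frontier D') (hφ : IsNormalizedCoord D p φ)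
    (hφ' : IsNormalizedCoord D' p' φ') :
    IsOneFlat D D' p p' F ↔
      ∃ L, HasNTDifferential F D p p' L ∧ IsConformal (inCoords p' φ φ' L) := by
  constructor
  · intro h
    obtain ⟨φ₁, φ₁', hφ₁, hφ₁', hid⟩ := h 5
    replace hφ₁ := hφ₁.isNormalizedCoord
    replace hφ₁' := hφ₁'.isNormalizedCoord
    refine ⟨_, hid.of_coords hφ₁.1 hφ₁'.1 hp hF.ntLimit, ?_⟩
    have : inCoords p' φ φ' ((fderiv ℂ φ₁'.symm 0).comp
        ((ContinuousLinearMap.id ℂ (Space n)).comp (fderiv ℂ φ₁ p))) =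
        (transition p' φ₁' φ').comp (transition p φ φ₁) := rfl
    rw [this]
    exact (isConformal_transition hp' hφ₁' hφ').comp (isConformal_transition hp hφ hφ₁)
  · rintro ⟨L, hL, hM⟩ m
    set M := inCoords p' φ φ' L
    obtain ⟨A, hA⟩ := hM.exists_equiv
    have hAM : ∀ v, A v = M v := fun v => by rw [← hA]; rfl
    obtain ⟨ρ, hρ, hD⟩ := hφ.exists_model
    obtain ⟨ρ', hρ', hD'⟩ := hφ'.exists_model
    obtain ⟨φ₁, hφ₁, hd⟩ := exists_chernMoserCoord hn hφ.1 hρ hD m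
    -- In the coordinates M⁻¹ ∘ φ' the differential of F is the identity, and D' is still defined by
    -- a model function, namely λ⁻¹ρ' ∘ M.
    have hc' := hφ'.1.postcomp A.symm
    obtain ⟨φ₁', hφ₁', hd'⟩ := exists_chernMoserCoord (D := D') hn hc' (hρ'.comp_conformal hM) (by
      filter_upwards [hD'] with q hq
      have h1 : M ((φ'.transHomeomorph A.symm.toHomeomorph) q) = φ' q := by
        rw [← hAM]
        exact A.apply_symm_apply _
      have hpos := inv_pos.2 hM.pos
      rw [hq, h1]
      exact ⟨fun h => mul_neg_of_pos_of_neg hpos h, fun h => neg_of_mul_neg_right h hpos.le⟩) m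
    refine ⟨φ₁, φ₁', hφ₁, hφ₁', ?_⟩
    have hres := hL.inCoords hφ₁.1 hφ₁'.1 hp
    have hdA : fderiv ℂ φ₁' p' = (A.symm : Space n →L[ℂ] Space n).comp (fderiv ℂ φ' p') := by
      rw [hd']
      exact (A.symm.hasFDerivAt.comp p' hφ'.1.hasFDerivAt).fderiv
    have hsymm : fderiv ℂ φ₁.symm 0 = fderiv ℂ φ.symm 0 := by
      calc fderiv ℂ φ₁.symm 0 = ((fderiv ℂ φ.symm 0).comp (fderiv ℂ φ p)).comp
            (fderiv ℂ φ₁.symm 0) := by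
            rw [hφ.1.fderiv_symm_comp_fderiv, ContinuousLinearMap.id_comp]
        _ = (fderiv ℂ φ.symm 0).comp ((fderiv ℂ φ₁ p).comp (fderiv ℂ φ₁.symm 0)) := by
            rw [hd]; rfl
        _ = _ := by rw [hφ₁.1.fderiv_comp_fderiv_symm, ContinuousLinearMap.comp_id]
    have hid : inCoords p' φ₁ φ₁' L = ContinuousLinearMap.id ℂ (Space n) := by
      have h1 : inCoords p' φ₁ φ₁' L = (A.symm : Space n →L[ℂ] Space n).comp M := by
        rw [inCoords, hdA, hsymm]
        rfl
      rw [h1]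
      refine ContinuousLinearMap.ext fun v => ?_
      rw [ContinuousLinearMap.comp_apply, ← hAM]
      exact A.symm_apply_apply v
    rwa [hid] at hres

end Germ

end FlatGerm

end

theorem corollary2p4 {n : ℕ} (hn : 1 ≤ n) (D D' : Set (FlatGerm.Space n))
    (hD : IsOpen D) (hDc : IsConnected D) (hD' : IsOpen D') (hDc' : IsConnected D')
    (p p' : FlatGerm.Space n) (hp : p ∈ frontier D) (hp' : p' ∈ frontier D')
    (hpsc : FlatGerm.IsStronglyPseudoconvexAt D p)
    (hpsc' : FlatGerm.IsStronglyPseudoconvexAt D' p')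
    (U : Set (FlatGerm.Space n)) (F : FlatGerm.Space n → FlatGerm.Space n)
    (hF : FlatGerm.RepresentsGerm D D' p p' U F) :
    (∃ φ, FlatGerm.IsNormalizedCoord D p φ) ∧ (∃ φ', FlatGerm.IsNormalizedCoord D' p' φ') ∧
      ∀ φ φ' : OpenPartialHomeomorph (FlatGerm.Space n) (FlatGerm.Space n),
        FlatGerm.IsNormalizedCoord D p φ → FlatGerm.IsNormalizedCoord D' p' φ' →
          (FlatGerm.IsOneFlat D D' p p' F ↔
            FlatGerm.AllSingularValuesOne D p p' φ φ' F) :=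
  ⟨hpsc.exists_isNormalizedCoord hn, hpsc'.exists_isNormalizedCoord hn, fun _ _ hφ hφ' =>
    (hF.isOneFlat_iff hn hp hp' hφ hφ').trans (hF.allSingularValuesOne_iff hn hp hφ hφ').symm⟩
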